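/- **Setting.** Let $d\in\{2,3\}$, let $k'\ge 1$ and $0\le\alpha'\le k'-1$ be integers, and let $\hat\Omega=\prod_{i=1}^d(a_i,b_i)$ carry a tensor-product mesh given by knot values $a_i=\zeta_{i,1}<\dots<\zeta_{i,n_i}=b_i$ ($n_i\ge2$). Let $\mathcal F$ be an injective map on the closed box $\overline{\hat\Omega}$ which is $C^{\alpha'+1}$ there, $C^{\alpha'+2}$ on every closed element $\overline{\hat K}$, and has $\det D\mathcal F\neq0$ everywhere. Put $\Omega=\mathcal F(\hat\Omega)$, $K=\mathcal F(\hat K)$; let $\mathcal E_0,\mathcal E_\partial$ be the sets of interior and boundary facets, $\boldsymbol n$ the unit normal (outward on $\partial\Omega$), $[\![\cdot]\!]$ the jump across an interior facet, $\partial_{\boldsymbol n}=\boldsymbol n\cdot\nabla$, and $\nabla^s$ the symmetric gradient. The discrete velocity space $\mathcal V_h$ consists of the fields $\boldsymbol u$ on $\overline\Omega$ with $\boldsymbol u\cdot\boldsymbol n=0$ on $\partial\Omega$ such that the $i$-th component of the pullback $\det(D\mathcal F)(D\mathcal F)^{-1}(\boldsymbol u\circ\mathcal F)$ is, for every $i$,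 a tensor-product spline of degree $k'+1$ and interior regularity $C^{\alpha'+1}$ in direction $i$ and of degree $k'$ and interior regularity $C^{\alpha'}$ in the other directions. Let $\mathring{\mathcal V}_h=\{\boldsymbol u\in\mathcal V_h:\nabla\cdot\boldsymbol u=0\}$. For $\nu>0$, $h>0$, $C_{\rm Nit}>0$ and a function $\eta\ge0$ (which may depend on $\boldsymbol u_h$), let $(\cdot,\cdot)$ be the $L^2(\Omega)$ inner product and $$\begin{aligned}\mathscr A_{\rm stb}(\boldsymbol u,\boldsymbol v)={}&(2\nu\nabla^s\boldsymbol u,\nabla^s\boldsymbol v)-(2\nu\,\boldsymbol n\cdot\nabla^s\boldsymbol u,\boldsymbol v)_{\partial\Omega}-(2\nu\,\boldsymbol n\cdot\nabla^s\boldsymbol v,\boldsymbol u)_{\partial\Omega}+\Big(2\nu\tfrac{C_{\rm Nit}}{h}\boldsymbol u,\boldsymbol v\Big)_{\partial\Omega}\\&+\sum_{e\in\mathcal E_0}\big(\eta[\![\partial_{\boldsymbol n}^{\alpha'+1}\boldsymbol u]\!],[\![\partial_{\boldsymbol n}^{\alpha'+1}\boldsymbol v]\!]\big)_e-(\boldsymbol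 u\otimes\boldsymbol u,\nabla\boldsymbol v),\end{aligned}$$ $$|||\boldsymbol u|||^2=2\nu(\nabla^s\boldsymbol u,\nabla^s\boldsymbol u)+2\nu\tfrac{C_{\rm Nit}}{h}\|\boldsymbol u\|^2_{L^2(\mathcal E_\partial)}+\big\|\eta^{1/2}[\![\partial_{\boldsymbol n}^{\alpha'+1}\boldsymbol u]\!]\big\|^2_{L^2(\mathcal E_0)} .$$ Call $C_{\rm tr}>0$ a *trace constant* for a set $V$ of fields if $\|\boldsymbol n\cdot\nabla^s\boldsymbol u\|^2_{L^2(\mathcal E_\partial)}\le\frac{C_{\rm tr}}{h}(\nabla^s\boldsymbol u,\nabla^s\boldsymbol u)$ for all $\boldsymbol u\in V$. **Lemma (Coercivity).** 1. For every such discretization and every $h>0$ a trace constant for $\mathcal V_h$ exists. If $C_{\rm tr}$ is any trace constant for $\mathring{\mathcal V}_h$ and $C_{\rm Nit}\ge4C_{\rm tr}$, then for all $\nu>0$, all $\boldsymbol u_h\in\mathring{\mathcal V}_h$ and all $\eta\ge0$ $$\mathscr A_{\rm stb}(\boldsymbol u_h,\boldsymbol u_h)\ \ge\ C_{\rm coer}\,|||\boldsymbol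 u_h|||^2,\qquad C_{\rm coer}=\tfrac12 .$$ 2. If moreover $\mathcal F$ is rational on each closed element of some coarse mesh (as B-spline and NURBS maps are), and is admissible in the above sense with respect to that coarse mesh, then for every $\kappa>0$ there is one $C_{\rm tr}>0$, depending only on $\mathcal F$, the coarse mesh, $k'$, $\alpha'$ and $\kappa$, such that for every refinement of the coarse mesh and every $h>0$ for which all elements satisfy $\kappa h\le\operatorname{diam}K\le h/\kappa$ and contain a ball of radius $\kappa h$: $C_{\rm tr}$ is a trace constant for $\mathcal V_h$, and the coercivity bound of part 1 holds whenever $C_{\rm Nit}\ge4C_{\rm tr}$. -/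

import Mathlib

open Set Filter Topology MeasureTheory

noncomputable section

/-- Physical space `ℝᵈ` with the Euclidean norm. -/
abbrev Phys (d : ℕ) : Type := EuclideanSpace ℝ (Fin d)

/-- Parametric space `ℝᵈ` (coordinates only; its norm plays no role). -/
abbrev Param (d : ℕ) : Type := Fin d → ℝ

/-! ### Parametric meshes -/

/-- A tensor-product mesh of the parametric box `∏ᵢ [a i, b i]`: in direction `i` the unique knot
values `ζ i 0 < ζ i 1 < ⋯ < ζ i (n i)`, from `a i` to `b i`, cutting it into `n i ≥ 1` spans. -/
structure ParamMesh {d : ℕ} (a b : Param d) where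
  n : Fin d → ℕ
  n_pos : ∀ i, 0 < n i
  ζ : ∀ i, Fin (n i + 1) → ℝ
  strictMono : ∀ i, StrictMono (ζ i)
  first : ∀ i, ζ i 0 = a i
  last : ∀ i, ζ i (Fin.last (n i)) = b i

namespace ParamMesh

variable {d m : ℕ}

/-- Indices of the elements: one knot span in every direction. -/
abbrev Cell {a b : Param d} (M : ParamMesh a b) : Type := ∀ i, Fin (M.n i)

/-- Lower corner of a parametric element. -/
def lo {a b : Param d} (M : ParamMesh a b) (c : M.Cell) : Param d := fun i => M.ζ i (c i).castSucc

/-- Upper corner of a parametric element. -/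
def hi {a b : Param d} (M : ParamMesh a b) (c : M.Cell) : Param d := fun i => M.ζ i (c i).succ

/-- The closed parametric element. -/
def closedCell {a b : Param d} (M : ParamMesh a b) (c : M.Cell) : Set (Param d) :=
  Icc (M.lo c) (M.hi c)

/-- The open parametric element. -/
def openCell {a b : Param d} (M : ParamMesh a b) (c : M.Cell) : Set (Param d) :=
  Set.pi univ fun i => Ioo (M.lo c i) (M.hi c i)

/-- `M` is obtained from `M₀` by inserting further knot values. -/
def Refines {a b : Param d} (M M₀ : ParamMesh a b) : Prop :=
  ∀ i, range (M₀.ζ i) ⊆ range (M.ζ i)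

end ParamMesh

/-! ### Spline spaces -/

/-- The univariate spline space of degree `p` and regularity `r` over the unique knot values
`ζ 0 < ⋯ < ζ n`: piecewise polynomials of degree at most `p` which are `C^r` across the interior
knots, i.e. the span of the B-splines of degree `p` over the open knot vector in which every
interior knot has multiplicity `p - r`.  Only the values on `[ζ 0, ζ n]` matter. -/
def splineSpace {n : ℕ} (ζ : Fin (n + 1) → ℝ) (p r : ℕ) : Set (ℝ → ℝ) :=
  {f | ContDiffOn ℝ (r : WithTop ℕ∞) f (Icc (ζ 0) (ζ (Fin.last n))) ∧
    ∀ j : Fin n, ∃ q : Polynomial ℝ, q.natDegree ≤ p ∧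
      ∀ x ∈ Icc (ζ j.castSucc) (ζ j.succ), f x = q.eval x}

/-- The `d`-variate spline space: the span of the products of univariate splines, of degree `p j`
and regularity `r j` in direction `j`. -/
def tensorSplineSpace {d : ℕ} {a b : Param d} (M : ParamMesh a b) (p r : Fin d → ℕ) :
    Submodule ℝ (Param d → ℝ) :=
  Submodule.span ℝ
    {g | ∃ f : Fin d → ℝ → ℝ, (∀ j, f j ∈ splineSpace (M.ζ j) (p j) (r j)) ∧
      g = fun x => ∏ j, f j (x j)}

/-! ### The geometry map -/

/-- Jacobian matrix `DF`, `(DF) i j = ∂F i / ∂x̂ j`, on the closed parametric domain (one-sided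
derivatives on its boundary). -/
def jac {d : ℕ} (a b : Param d) (F : Param d → Phys d) (x : Param d) : Matrix (Fin d) (Fin d) ℝ :=
  Matrix.of fun i j => (fderivWithin ℝ F (Icc a b) x (Pi.single j 1)) i

/-- The physical domain `Ω = F(Ω̂)`, with `Ω̂ = ∏ᵢ (a i, b i)`. -/
def physDomain {d : ℕ} (a b : Param d) (F : Param d → Phys d) : Set (Phys d) :=
  F '' Set.pi univ fun i => Ioo (a i) (b i)

/-- The contravariant (Piola) pullback `ι(v) = det(DF) (DF)⁻¹ (v ∘ F)`. -/
def piolaPullback {d : ℕ} (a b : Param d) (F : Param d → Phys d) (v : Phys d → Phys d)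
    (x : Param d) : Fin d → ℝ :=
  (jac a b F x).det • ((jac a b F x)⁻¹.mulVec (v (F x)).ofLp)

namespace ParamMesh

variable {d m : ℕ}

/-- Admissible geometry maps: a `C^(α+1)` bijection of the closed parametric domain onto its image
(so that the mapped splines are `C^α`), with nowhere singular Jacobian, and `C^(α+2)` on every
closed element (so that derivatives of order `α + 1` of mapped splines have traces on facets). -/
structure IsGeometryMap {a b : Param d} (M : ParamMesh a b) (α : ℕ) (F : Param d → Phys d) :
    Prop where
  contDiffOn : ContDiffOn ℝ ((α + 1 : ℕ) : WithTop ℕ∞) F (Icc a b)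
  contDiffOn_cell : ∀ c : M.Cell, ContDiffOn ℝ ((α + 2 : ℕ) : WithTop ℕ∞) F (M.closedCell c)
  injOn : InjOn F (Icc a b)
  det_ne_zero : ∀ x ∈ Icc a b, (jac a b F x).det ≠ 0

/-- `F` is rational on every closed element of `M` (as B-spline and NURBS geometry maps are). -/
def IsRationalMap {a b : Param d} (M : ParamMesh a b) (F : Param d → Phys d) : Prop :=
  ∀ c : M.Cell, ∃ (W : MvPolynomial (Fin d) ℝ) (N : Fin d → MvPolynomial (Fin d) ℝ),
    ∀ x ∈ M.closedCell c, MvPolynomial.eval x W ≠ 0 ∧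
      ∀ i, F x i = MvPolynomial.eval x (N i) / MvPolynomial.eval x W

/-- The physical element `K = F(K̂)`. -/
def elem {a b : Param d} (M : ParamMesh a b) (F : Param d → Phys d) (c : M.Cell) : Set (Phys d) :=
  F '' M.openCell c

/-- Quasi-uniformity with constant `κ` and global mesh size `h`: all diameters `h_K` satisfy
`κ h ≤ h_K ≤ h / κ`, and the elements are shape regular: each contains a ball of radius `κ h`. -/
def QuasiUniform {a b : Param d} (M : ParamMesh a b) (F : Param d → Phys d) (κ h : ℝ) : Prop :=
  ∀ c : M.Cell, κ * h ≤ Metric.diam (M.elem F c) ∧ Metric.diam (M.elem F c) ≤ h / κ ∧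
    ∃ x, Metric.ball x (κ * h) ⊆ M.elem F c

end ParamMesh

/-! ### Normals and facets -/

/-- `(DF)⁻ᵀ eᵢ`, which is normal to the image of the coordinate hyperplane through `x`, and points
in the direction of increasing `x̂ᵢ`. -/
def normalCovector {d : ℕ} (a b : Param d) (F : Param d → Phys d) (i : Fin d) (x : Param d) :
    Phys d :=
  WithLp.toLp 2 ((jac a b F x)⁻¹.transpose.mulVec (Pi.single i 1))

/-- Unit normal, at `F x`, to the image of the facet in the hyperplane `x̂ᵢ = const`; it points to
increasing `x̂ᵢ` if `s = true`, to decreasing `x̂ᵢ` if `s = false`. -/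
def unitNormal {d : ℕ} (a b : Param d) (F : Param d → Phys d) (i : Fin d) (s : Bool)
    (x : Param d) : Phys d :=
  (if s then (1 : ℝ) else -1) • ‖normalCovector a b F i x‖⁻¹ • normalCovector a b F i x

/-- Surface area element `|det DF| |(DF)⁻ᵀ eᵢ|` of the image of the hyperplane `x̂ᵢ = const`. -/
def areaElement {d : ℕ} (a b : Param d) (F : Param d → Phys d) (i : Fin d) (x : Param d) : ℝ :=
  |(jac a b F x).det| * ‖normalCovector a b F i x‖

namespace ParamMesh

variable {m : ℕ}

/-- Facets, as sides of elements: the element, the direction of the parametric normal, and whether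
it is the upper (`true`) or lower (`false`) side. -/
abbrev Facet {a b : Param (m + 1)} (M : ParamMesh a b) : Type := M.Cell × Fin (m + 1) × Bool

open Classical in
/-- The boundary facets `𝓔_∂`. -/
def boundaryFacets {a b : Param (m + 1)} (M : ParamMesh a b) : Finset M.Facet :=
  Finset.univ.filter fun e =>
    if e.2.2 then (e.1 e.2.1 : ℕ) + 1 = M.n e.2.1 else (e.1 e.2.1 : ℕ) = 0

open Classical in
/-- The interior facets `𝓔₀`, each listed once, as the upper side of its lower neighbour (which is
the "positive" element of the facet, so that `n = n⁺` points to increasing `x̂ᵢ`). -/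
def interiorFacets {a b : Param (m + 1)} (M : ParamMesh a b) : Finset M.Facet :=
  Finset.univ.filter fun e => e.2.2 = true ∧ (e.1 e.2.1 : ℕ) + 1 < M.n e.2.1

/-- The constant value of `x̂ᵢ` on a parametric facet. -/
def facetLevel {a b : Param (m + 1)} (M : ParamMesh a b) (e : M.Facet) : ℝ :=
  if e.2.2 then M.hi e.1 e.2.1 else M.lo e.1 e.2.1

/-- The surface integral `∫ₑ g ds` over the physical facet `e = F(ê)`, where the integrand is given
as a function of the parametric point `x̂ ∈ ê`. -/
def facetIntegral {a b : Param (m + 1)} (M : ParamMesh a b) (F : Param (m + 1) → Phys (m + 1))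
    (e : M.Facet) (g : Param (m + 1) → ℝ) : ℝ :=
  ∫ y in Icc (fun l => M.lo e.1 (e.2.1.succAbove l)) (fun l => M.hi e.1 (e.2.1.succAbove l)),
    g (Fin.insertNth (α := fun _ => ℝ) e.2.1 (M.facetLevel e) y) *
      areaElement a b F e.2.1 (Fin.insertNth (α := fun _ => ℝ) e.2.1 (M.facetLevel e) y)

/-- The outward unit normal of the element of a facet, at the image of a parametric point. -/
def normal {a b : Param (m + 1)} (M : ParamMesh a b) (F : Param (m + 1) → Phys (m + 1))
    (e : M.Facet) (x : Param (m + 1)) : Phys (m + 1) :=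
  unitNormal a b F e.2.1 e.2.2 x

end ParamMesh

/-! ### Differential operators and traces -/

/-- Gradient `(∇u) i j = ∂u j / ∂x i`. -/
def vgrad {d : ℕ} (u : Phys d → Phys d) (x : Phys d) : Matrix (Fin d) (Fin d) ℝ :=
  Matrix.of fun i j => (fderiv ℝ u x (EuclideanSpace.single i 1)) j

/-- Symmetric gradient `∇ˢu`. -/
def symGrad {d : ℕ} (u : Phys d → Phys d) (x : Phys d) : Matrix (Fin d) (Fin d) ℝ :=
  (1 / 2 : ℝ) • (vgrad u x + (vgrad u x).transpose)

/-- Divergence `∇ · u`. -/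
def vdiv {d : ℕ} (u : Phys d → Phys d) (x : Phys d) : ℝ := (vgrad u x).trace

/-- `S : T = ∑ S i j * T i j`. -/
def ddot {d : ℕ} (S T : Matrix (Fin d) (Fin d) ℝ) : ℝ := ∑ i, ∑ j, S i j * T i j

/-- `∂ₙ = n · ∇` for a fixed vector `n`. -/
def dirDeriv {d : ℕ} (n : Phys d) (u : Phys d → Phys d) : Phys d → Phys d :=
  fun x => fderiv ℝ u x n

/-- The one-sided limit `lim_{ε → 0⁺} φ(x - ε n)`. -/
def oneSided {d : ℕ} (φ : Phys d → Phys d) (x n : Phys d) : Phys d :=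
  limUnder (𝓝[>] (0 : ℝ)) fun ε => φ (x - ε • n)

/-- The jump `⟦∂ₙ^r u⟧ = (∂ₙ^r u)⁺ - (∂ₙ^r u)⁻` at a point with unit normal `n = n⁺ = -n⁻`. -/
def normalDerivJump {d : ℕ} (r : ℕ) (u : Phys d → Phys d) (x n : Phys d) : Phys d :=
  oneSided ((dirDeriv n)^[r] u) x n - oneSided ((dirDeriv n)^[r] u) x (-n)

namespace ParamMesh

variable {m : ℕ}

/-- The vector `n · ∇ˢu` at a point of a facet `e`, where `∇ˢu` is the trace (limit) from the
element that `e` is a side of. -/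
def normalStrain {a b : Param (m + 1)} (M : ParamMesh a b) (F : Param (m + 1) → Phys (m + 1))
    (u : Phys (m + 1) → Phys (m + 1)) (e : M.Facet) (x : Param (m + 1)) : Phys (m + 1) :=
  WithLp.toLp 2
    (Matrix.vecMul (M.normal F e x).ofLp (limUnder (𝓝[M.elem F e.1] (F x)) (symGrad u)))

/-! ### Discrete velocity spaces -/

/-- The divergence-conforming B-spline velocity space `𝓥_h` of degree `k` and regularity `α`:
component `i` of the Piola pullback is a spline of degree `k + 1` and regularity `α + 1` in
direction `i`, and of degree `k` and regularity `α` in the other directions; and `u · n = 0` on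
`∂Ω`.  Such fields are continuous on `closure Ω` and piecewise `C¹`, hence in `H¹(Ω)`, and their
traces are their boundary values.  Values outside `closure Ω` are irrelevant. -/
def velocitySpace {a b : Param (m + 1)} (M : ParamMesh a b) (F : Param (m + 1) → Phys (m + 1))
    (k α : ℕ) : Set (Phys (m + 1) → Phys (m + 1)) :=
  {u | (∀ i, ∃ s ∈ tensorSplineSpace M (fun j => if j = i then k + 1 else k)
          (fun j => if j = i then α + 1 else α),
        ∀ x ∈ Icc a b, piolaPullback a b F u x i = s x) ∧
    ∀ e ∈ M.boundaryFacets, ∀ x ∈ M.closedCell e.1, x e.2.1 = M.facetLevel e →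
      inner ℝ (u (F x)) (M.normal F e x) = 0}

/-- The solenoidal subspace of `𝓥_h`. -/
def solenoidalSpace {a b : Param (m + 1)} (M : ParamMesh a b) (F : Param (m + 1) → Phys (m + 1))
    (k α : ℕ) : Set (Phys (m + 1) → Phys (m + 1)) :=
  {u ∈ M.velocitySpace F k α | ∀ c : M.Cell, ∀ x ∈ M.elem F c, vdiv u x = 0}

/-! ### Forms and norms -/

/-- `A(u, v) = (2ν ∇ˢu, ∇ˢv)`. -/
def viscousForm (a b : Param (m + 1)) (F : Param (m + 1) → Phys (m + 1)) (ν : ℝ)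
    (u v : Phys (m + 1) → Phys (m + 1)) : ℝ :=
  ∫ x in physDomain a b F, 2 * ν * ddot (symGrad u x) (symGrad v x)

/-- `C(w; u, v) = -(w ⊗ u, ∇v)`. -/
def convectionForm (a b : Param (m + 1)) (F : Param (m + 1) → Phys (m + 1))
    (w u v : Phys (m + 1) → Phys (m + 1)) : ℝ :=
  -∫ x in physDomain a b F, ddot (Matrix.vecMulVec (w x).ofLp (u x).ofLp) (vgrad v x)

/-- `J_h(u, v) = ∑_{e ∈ 𝓔₀} (η ⟦∂ₙ^(α+1) u⟧, ⟦∂ₙ^(α+1) v⟧)_e`. -/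
def jumpForm {a b : Param (m + 1)} (M : ParamMesh a b) (F : Param (m + 1) → Phys (m + 1)) (α : ℕ)
    (η : Phys (m + 1) → ℝ) (u v : Phys (m + 1) → Phys (m + 1)) : ℝ :=
  ∑ e ∈ M.interiorFacets, M.facetIntegral F e fun x =>
    η (F x) * inner ℝ (normalDerivJump (α + 1) u (F x) (M.normal F e x))
      (normalDerivJump (α + 1) v (F x) (M.normal F e x))

/-- `A_h(u, v) = A(u, v) - (2ν n·∇ˢu, v)_∂Ω - (2ν n·∇ˢv, u)_∂Ω + (2ν (C_Nit / h) u, v)_∂Ω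
+ J_h(u, v)`. -/
def nitscheForm {a b : Param (m + 1)} (M : ParamMesh a b) (F : Param (m + 1) → Phys (m + 1))
    (α : ℕ) (h CNit ν : ℝ) (η : Phys (m + 1) → ℝ) (u v : Phys (m + 1) → Phys (m + 1)) : ℝ :=
  viscousForm a b F ν u v
    - (∑ e ∈ M.boundaryFacets, M.facetIntegral F e fun x =>
        inner ℝ ((2 * ν) • M.normalStrain F u e x) (v (F x)))
    - (∑ e ∈ M.boundaryFacets, M.facetIntegral F e fun x =>
        inner ℝ ((2 * ν) • M.normalStrain F v e x) (u (F x)))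
    + (∑ e ∈ M.boundaryFacets, M.facetIntegral F e fun x =>
        inner ℝ ((2 * ν * (CNit / h)) • u (F x)) (v (F x)))
    + M.jumpForm F α η u v

/-- `𝒜_stb(u, v) = A_h(u, v) + C(u; u, v)`. -/
def stabForm {a b : Param (m + 1)} (M : ParamMesh a b) (F : Param (m + 1) → Phys (m + 1))
    (α : ℕ) (h CNit ν : ℝ) (η : Phys (m + 1) → ℝ) (u v : Phys (m + 1) → Phys (m + 1)) : ℝ :=
  M.nitscheForm F α h CNit ν η u v + convectionForm a b F u u v

/-- `(∇ˢu, ∇ˢu)`. -/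
def strainEnergy (a b : Param (m + 1)) (F : Param (m + 1) → Phys (m + 1))
    (u : Phys (m + 1) → Phys (m + 1)) : ℝ :=
  ∫ x in physDomain a b F, ddot (symGrad u x) (symGrad u x)

/-- `|||u|||² = 2ν (∇ˢu, ∇ˢu) + 2ν (C_Nit / h) ‖u‖²_{L²(𝓔_∂)} + ‖η^{1/2} ⟦∂ₙ^(α+1) u⟧‖²_{L²(𝓔₀)}`. -/
def energyNormSq {a b : Param (m + 1)} (M : ParamMesh a b) (F : Param (m + 1) → Phys (m + 1))
    (α : ℕ) (h CNit ν : ℝ) (η : Phys (m + 1) → ℝ) (u : Phys (m + 1) → Phys (m + 1)) : ℝ :=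
  2 * ν * strainEnergy a b F u
    + 2 * ν * (CNit / h) * (∑ e ∈ M.boundaryFacets, M.facetIntegral F e fun x => ‖u (F x)‖ ^ 2)
    + ∑ e ∈ M.interiorFacets, M.facetIntegral F e fun x =>
        ‖Real.sqrt (η (F x)) • normalDerivJump (α + 1) u (F x) (M.normal F e x)‖ ^ 2

/-- `C_tr` is a trace constant for the fields in `V`:
`‖n·∇ˢu‖²_{L²(𝓔_∂)} ≤ (C_tr / h) (∇ˢu, ∇ˢu)` for all `u ∈ V`. -/
def IsTraceConstant {a b : Param (m + 1)} (M : ParamMesh a b) (F : Param (m + 1) → Phys (m + 1))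
    (h : ℝ) (V : Set (Phys (m + 1) → Phys (m + 1))) (Ctr : ℝ) : Prop :=
  ∀ u ∈ V, (∑ e ∈ M.boundaryFacets, M.facetIntegral F e fun x => ‖M.normalStrain F u e x‖ ^ 2)
    ≤ Ctr / h * strainEnergy a b F u

/-- Coercivity of `𝒜_stb` on the solenoidal space with constant `Ccoer`, for a given Nitsche
parameter, uniformly in the viscosity `ν > 0`, the discrete field `u`, and the stabilization
parameter `η ≥ 0` (a function on the skeleton, which may depend on `u` and `ν`). -/
def IsCoercive {a b : Param (m + 1)} (M : ParamMesh a b) (F : Param (m + 1) → Phys (m + 1))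
    (k α : ℕ) (h CNit Ccoer : ℝ) : Prop :=
  ∀ ν : ℝ, 0 < ν → ∀ u ∈ M.solenoidalSpace F k α, ∀ η : Phys (m + 1) → ℝ, (∀ x, 0 ≤ η x) →
    Ccoer * M.energyNormSq F α h CNit ν η u ≤ M.stabForm F α h CNit ν η u u

end ParamMesh

end

/-! ### Inverse inequalities on finite-dimensional spaces of functions -/

/-! Test the form with `u` itself. The convective term then disappears, and the energy estimate is
Nitsche's: if T is the squared boundary norm of the normal strain, S the strain energy and B the
squared boundary norm of `u`, Young's inequality bounds each of the two equal consistency terms by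
2ν (h/(4 Ctr) T + (Ctr/h) B). The trace inequality T ≤ (Ctr/h) S and `4 * Ctr ≤ CNit` turn this into
a quarter of 2νS plus a quarter of the penalty. Two such terms consume half of each, and the jump
term is nonnegative; hence the constant 1/2 (`isCoercive_of_isTraceConstant`).

The convective term is treated on the parametric box. If s is the Piola pullback of `u` and φ = |u ∘
F|²/2, the Piola identity (`vdiv_eq`) makes s divergence free on each cell, so that u ⊗ u : ∇u,
transported by F, is det(DF)⁻¹ times the parametric divergence of s φ. The products s φ are
continuous across cells, and component l vanishes on the two faces normal to direction l because u ·
n = 0; by the fundamental theorem of calculus along lines the total integral is zero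
(`convectionForm_self_eq_zero`).

Trace constants come from finite dimensionality. On a cell the pulled-back strain depends linearly
on a tuple of polynomials of bounded degree, and on a finite-dimensional space of continuous
functions the supremum is bounded by the L² norm (`exists_sq_le_integral`). This settles any fixed
mesh.

For a constant uniform under refinement, rationality of F is used: on a coarse cell the entries of
all strains are rational functions with one common denominator and numerators of bounded degree
(`rationalOn.exists_common_denominator`). The denominator is bounded above and away from zero on the
compact coarse cell, so the scale-invariant trace inequality for polynomials on boxes passes to
every fine cell inside it, with a factor 1/(side length). A cell whose image contains a ball of
radius κh has all sides bounded below by a multiple of κh (`exists_side_lower_bound`), which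
produces exactly the factor 1/h in the definition of a trace constant. -/

/-- On a finite-dimensional space of continuous functions the supremum is controlled by the
`L²` norm. -/
theorem exists_sq_le_integral {V X : Type*} [AddCommGroup V] [Module ℝ V] [Module.Finite ℝ V]
    [TopologicalSpace X] [CompactSpace X] [MeasurableSpace X] [BorelSpace X]
    (μ : Measure X) [IsFiniteMeasure μ] [μ.IsOpenPosMeasure] (L : V →ₗ[ℝ] C(X, ℝ)) :
    ∃ K : ℝ, 0 < K ∧ ∀ v x, (L v x) ^ 2 ≤ K * ∫ y, (L v y) ^ 2 ∂μ := by
  -- The comparison of norms takes place on the range, since `L` need not be injective: the strain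
  -- annihilates rigid motions. On the range, a continuous function that is zero almost everywhere
  -- is zero, as `μ` charges every nonempty open set.
  let T : L.range →L[ℝ] Lp ℝ 2 μ :=
    (ContinuousMap.toLp 2 μ ℝ : C(X, ℝ) →L[ℝ] Lp ℝ 2 μ).comp L.range.subtypeL
  have hT : Function.Injective T :=
    (ContinuousMap.toLp_injective (𝕜 := ℝ) μ).comp Subtype.val_injective
  obtain ⟨K, hK, h⟩ := (LinearMap.injective_iff_antilipschitz (𝕜 := ℝ) (E := L.range)
    (F := Lp ℝ 2 μ) T.toLinearMap).1 hT
  refine ⟨(K : ℝ) ^ 2, by positivity, fun v x => ?_⟩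
  have h1 := h.le_mul_dist ⟨L v, v, rfl⟩ 0
  rw [map_zero, dist_zero_right, dist_zero_right] at h1
  have h2 : |L v x| ≤ ‖L v‖ := (L v).norm_coe_le_norm x
  have h3 : ‖T ⟨L v, v, rfl⟩‖ ^ 2 = ∫ y, (L v y) ^ 2 ∂μ := by
    rw [← real_inner_self_eq_norm_sq, L2.inner_def]
    refine integral_congr_ae ?_
    filter_upwards [ContinuousMap.coeFn_toLp (𝕜 := ℝ) (p := 2) μ (L v)] with y hy
    have : (T ⟨L v, v, rfl⟩ : X → ℝ) y = L v y := hy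
    rw [this, real_inner_self_eq_norm_sq, Real.norm_eq_abs, sq_abs]
  rw [← h3, ← mul_pow, ← sq_abs]
  exact pow_le_pow_left₀ (abs_nonneg _) (h2.trans h1) 2

/-- A nonempty relatively open subset of `s` meets the interior of `s` because `s` lies in the
closure of that interior. This supplies the positivity hypothesis of `exists_sq_le_integral` on
closed boxes. -/
theorem isOpenPosMeasure_comap {X : Type*} [TopologicalSpace X] [MeasurableSpace X]
    (μ : Measure X) [μ.IsOpenPosMeasure] {s : Set X} (hs : MeasurableSet s)
    (hcl : s ⊆ closure (interior s)) :
    (Measure.comap ((↑) : s → X) μ).IsOpenPosMeasure := by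
  refine ⟨fun U hU hne h0 => ?_⟩
  obtain ⟨O, hO, rfl⟩ := isOpen_induced_iff.1 hU
  obtain ⟨⟨x, hx⟩, hxO⟩ := hne
  rw [(MeasurableEmbedding.subtype_coe hs).comap_apply, Subtype.image_preimage_coe] at h0
  obtain ⟨y, hyO, hyI⟩ := mem_closure_iff.1 (hcl hx) O hO hxO
  exact ((isOpen_interior.inter hO).measure_pos μ ⟨y, hyI, hyO⟩).ne'
    (measure_mono_null (inter_subset_inter_left _ interior_subset) h0)

theorem interior_Icc_pi {d : ℕ} (l u : Fin d → ℝ) :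
    interior (Icc l u) = Set.pi univ fun i => Ioo (l i) (u i) := by
  rw [← pi_univ_Icc, interior_pi_set finite_univ]; simp

theorem closure_interior_Icc_pi {d : ℕ} {l u : Fin d → ℝ} (h : ∀ i, l i < u i) :
    closure (interior (Icc l u)) = Icc l u := by
  rw [interior_Icc_pi, closure_pi_set, ← pi_univ_Icc]
  simp only [closure_Ioo (h _).ne]

/-- Box version of `exists_sq_le_integral`. -/
theorem exists_sq_le_integral_Icc {V : Type*} [AddCommGroup V] [Module ℝ V] [Module.Finite ℝ V]
    {d : ℕ} {l u : Fin d → ℝ} (h : ∀ i, l i < u i) (L : V → (Fin d → ℝ) → ℝ)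
    (hc : ∀ v, ContinuousOn (L v) (Icc l u))
    (hadd : ∀ v w, ∀ x ∈ Icc l u, L (v + w) x = L v x + L w x)
    (hsmul : ∀ (c : ℝ) v, ∀ x ∈ Icc l u, L (c • v) x = c * L v x) :
    ∃ K : ℝ, 0 < K ∧ ∀ v, ∀ x ∈ Icc l u, (L v x) ^ 2 ≤ K * ∫ y in Icc l u, (L v y) ^ 2 := by
  let L' : V →ₗ[ℝ] C(Icc l u, ℝ) :=
    { toFun := fun v => ⟨(Icc l u).domRestrict (L v), (hc v).domRestrict⟩
      map_add' := fun v w => by ext x; exact hadd v w x x.2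
      map_smul' := fun c v => by ext x; exact hsmul c v x x.2 }
  have := isOpenPosMeasure_comap (volume : Measure (Fin d → ℝ)) measurableSet_Icc
    (closure_interior_Icc_pi h).ge
  have : IsFiniteMeasure (Measure.comap ((↑) : Icc l u → Fin d → ℝ) volume) := by
    refine ⟨?_⟩
    rw [(MeasurableEmbedding.subtype_coe measurableSet_Icc).comap_apply, image_univ,
      Subtype.range_coe]
    exact isCompact_Icc.measure_lt_top
  obtain ⟨K, hK, H⟩ := exists_sq_le_integral
    (Measure.comap ((↑) : Icc l u → Fin d → ℝ) volume) L'
  refine ⟨K, hK, fun v x hx => ?_⟩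
  have := H v ⟨x, hx⟩
  have h2 := integral_subtype_comap (μ := volume) (measurableSet_Icc (a := l) (b := u))
    fun y => (L v y) ^ 2
  rw [← h2]
  exact this

/-! ### Polynomial trace inequality -/

/-- Trace inequality for univariate polynomials on an interval, at an arbitrary point of it. -/
theorem exists_polynomial_sq_le (D : ℕ) : ∃ K : ℝ, 0 < K ∧ ∀ p : Polynomial ℝ, p.natDegree ≤ D →
    ∀ s t : ℝ, s < t → ∀ x ∈ Icc s t,
      (p.eval x) ^ 2 ≤ K / (t - s) * ∫ y in s..t, (p.eval y) ^ 2 := by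
  have : (volume : Measure unitInterval).IsOpenPosMeasure :=
    isOpenPosMeasure_comap volume measurableSet_Icc (by
      rw [interior_Icc, closure_Ioo zero_ne_one])
  obtain ⟨K, hK, H⟩ := exists_sq_le_integral (volume : Measure unitInterval)
    (V := Polynomial.degreeLT ℝ (D + 1))
    { toFun := fun p => ⟨fun x : unitInterval => (p : Polynomial ℝ).eval (x : ℝ), by fun_prop⟩
      map_add' := fun p q => by ext x; simp
      map_smul' := fun c p => by ext x; simp }
  refine ⟨K, hK, fun p hp s t hst x hx => ?_⟩
  have hd : 0 < t - s := sub_pos.2 hst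
  -- Rescaling to the unit interval keeps the degree, so one constant serves all intervals; the
  -- change of variables in the integral yields the factor 1/(t - s).
  let q : Polynomial ℝ := p.comp (Polynomial.C (t - s) * Polynomial.X + Polynomial.C s)
  have hq : q ∈ Polynomial.degreeLT ℝ (D + 1) := by
    rw [Polynomial.mem_degreeLT]
    refine lt_of_le_of_lt Polynomial.degree_le_natDegree ?_
    have : q.natDegree ≤ D := by
      refine Polynomial.natDegree_comp_le.trans ?_
      calc _ ≤ p.natDegree * 1 := Nat.mul_le_mul_left _ Polynomial.natDegree_linear_le
        _ ≤ D := by omega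
    exact_mod_cast Nat.lt_succ_of_le this
  have hqe : ∀ z, q.eval z = p.eval ((t - s) * z + s) := fun z => by simp [q]
  have hz : (x - s) / (t - s) ∈ Icc (0 : ℝ) 1 := by
    constructor
    · exact div_nonneg (by linarith [hx.1]) hd.le
    · rw [div_le_one hd]; linarith [hx.2]
  have h1 := H ⟨q, hq⟩ ⟨_, hz⟩
  simp only [LinearMap.coe_mk, AddHom.coe_mk, ContinuousMap.coe_mk, hqe] at h1
  rw [mul_div_cancel₀ _ hd.ne', sub_add_cancel] at h1
  have h2 : ∫ y : unitInterval, (p.eval ((t - s) * (y : ℝ) + s)) ^ 2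
      = (t - s)⁻¹ * ∫ y in s..t, (p.eval y) ^ 2 := by
    have h3 := integral_subtype_comap (μ := volume) (measurableSet_Icc (a := (0 : ℝ)) (b := 1))
      fun y => (p.eval ((t - s) * y + s)) ^ 2
    have h4 : ∫ y : unitInterval, (p.eval ((t - s) * (y : ℝ) + s)) ^ 2
      = ∫ y in Icc (0 : ℝ) 1, (p.eval ((t - s) * y + s)) ^ 2 := h3
    rw [h4, integral_Icc_eq_integral_Ioc, ← intervalIntegral.integral_of_le zero_le_one,
      intervalIntegral.integral_comp_mul_add (fun y => (p.eval y) ^ 2) hd.ne' s]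
    simp
  rw [h2] at h1
  rw [div_eq_mul_inv, mul_assoc]
  exact h1

theorem insertNth_mem_Icc_iff {m : ℕ} (i : Fin (m + 1)) {l u : Fin (m + 1) → ℝ} {t : ℝ}
    {y : Fin m → ℝ} : Fin.insertNth (α := fun _ => ℝ) i t y ∈ Icc l u ↔ t ∈ Icc (l i) (u i) ∧
      y ∈ Icc (fun j => l (i.succAbove j)) (fun j => u (i.succAbove j)) := by
  simp only [mem_Icc, Fin.insertNth_le_iff, Fin.le_insertNth_iff]
  exact ⟨fun ⟨⟨a1, a2⟩, a3, a4⟩ => ⟨⟨a1, a3⟩, a2, a4⟩, fun ⟨⟨a1, a3⟩, a2, a4⟩ =>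
    ⟨⟨a1, a2⟩, a3, a4⟩⟩

/-- Fubini on a box, slicing in direction `i`. -/
theorem integral_Icc_insertNth {m : ℕ} (i : Fin (m + 1)) {l u : Fin (m + 1) → ℝ}
    {g : (Fin (m + 1) → ℝ) → ℝ} (hg : IntegrableOn g (Icc l u)) :
    IntegrableOn (fun y => ∫ t in Icc (l i) (u i), g (Fin.insertNth (α := fun _ => ℝ) i t y))
        (Icc (fun j => l (i.succAbove j)) (fun j => u (i.succAbove j))) ∧
    (∀ᵐ y ∂(volume.restrict (Icc (fun j => l (i.succAbove j)) (fun j => u (i.succAbove j)))),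
      IntegrableOn (fun t => g (Fin.insertNth (α := fun _ => ℝ) i t y)) (Icc (l i) (u i))) ∧
    ∫ x in Icc l u, g x =
      ∫ y in Icc (fun j => l (i.succAbove j)) (fun j => u (i.succAbove j)),
        ∫ t in Icc (l i) (u i), g (Fin.insertNth (α := fun _ => ℝ) i t y) := by
  have e := (volume_preserving_piFinSuccAbove (fun _ : Fin (m + 1) => ℝ) i).symm
  have hpre : (MeasurableEquiv.piFinSuccAbove (fun _ => ℝ) i).symm ⁻¹' Icc l u
      = Icc (l i) (u i) ×ˢ Icc (fun j => l (i.succAbove j)) (fun j => u (i.succAbove j)) := by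
    ext ⟨t, y⟩
    exact insertNth_mem_Icc_iff i
  have hint : IntegrableOn (fun p : ℝ × (Fin m → ℝ) =>
      g ((MeasurableEquiv.piFinSuccAbove (fun _ => ℝ) i).symm p))
      (Icc (l i) (u i) ×ˢ Icc (fun j => l (i.succAbove j)) (fun j => u (i.succAbove j))) := by
    rw [← hpre]
    exact (e.integrableOn_comp_preimage (MeasurableEquiv.measurableEmbedding _)).2 hg
  rw [← e.setIntegral_preimage_emb (MeasurableEquiv.measurableEmbedding _), hpre]
  rw [IntegrableOn, Measure.volume_eq_prod, ← Measure.prod_restrict] at hint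
  rw [Measure.volume_eq_prod, ← Measure.prod_restrict, integral_prod_symm _ hint]
  exact ⟨hint.integral_prod_right, hint.prod_left_ae, rfl⟩

/-- Trace inequality for multivariate polynomials on a box, for a slice in direction `i`. -/
theorem exists_mvPolynomial_trace (m D : ℕ) : ∃ K : ℝ, 0 < K ∧
    ∀ P : MvPolynomial (Fin (m + 1)) ℝ, P.totalDegree ≤ D →
    ∀ l u : Fin (m + 1) → ℝ, (∀ j, l j < u j) → ∀ i, ∀ t ∈ Icc (l i) (u i),
      ∫ y in Icc (fun j => l (i.succAbove j)) (fun j => u (i.succAbove j)),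
        (MvPolynomial.eval (Fin.insertNth (α := fun _ => ℝ) i t y) P) ^ 2 ≤
      K / (u i - l i) * ∫ x in Icc l u, (MvPolynomial.eval x P) ^ 2 := by
  obtain ⟨K, hK, H⟩ := exists_polynomial_sq_le D
  refine ⟨K, hK, fun P hP l u hlu i t ht => ?_⟩
  have hcont : Continuous fun x : Fin (m + 1) → ℝ => (MvPolynomial.eval x P) ^ 2 :=
    (MvPolynomial.continuous_eval P).pow 2
  have hins : ∀ t, Continuous fun y : Fin m → ℝ => Fin.insertNth (α := fun _ => ℝ) i t y :=
    fun t => continuous_const.finInsertNth i continuous_id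
  obtain ⟨h1, -, h3⟩ := integral_Icc_insertNth i
    (hcont.continuousOn.integrableOn_compact (isCompact_Icc (a := l) (b := u)))
  rw [h3, ← integral_const_mul]
  refine setIntegral_mono_on ((hcont.comp (hins t)).continuousOn.integrableOn_compact isCompact_Icc)
    (h1.const_mul _) measurableSet_Icc fun y _ => ?_
  -- The restriction of `P` to the line through `y` in direction `i`; its degree is at most `D`, so
  -- the univariate inequality applies line by line and is integrated over `y`.
  let p : Polynomial ℝ := MvPolynomial.aeval
    (Fin.insertNth (α := fun _ => Polynomial ℝ) i Polynomial.X fun j => Polynomial.C (y j)) P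
  have hp : p.natDegree ≤ D := by
    have := MvPolynomial.aeval_natDegree_le (n := 1) P hP
      (Fin.insertNth (α := fun _ => Polynomial ℝ) i Polynomial.X fun j => Polynomial.C (y j)) (by
        intro j
        refine Fin.succAboveCases i ?_ (fun j => ?_) j
        · simp
        · simp)
    simpa using this
  have he : ∀ s, p.eval s = MvPolynomial.eval (Fin.insertNth (α := fun _ => ℝ) i s y) P := by
    intro s
    have : (Polynomial.evalRingHom s).comp ((MvPolynomial.aeval (R := ℝ)
      (Fin.insertNth (α := fun _ => Polynomial ℝ) i Polynomial.X
        fun j => Polynomial.C (y j))).toRingHom) =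
        MvPolynomial.eval (Fin.insertNth (α := fun _ => ℝ) i s y) := by
      apply MvPolynomial.ringHom_ext
      · intro r; simp
      · intro j
        refine Fin.succAboveCases i ?_ (fun j => ?_) j
        · simp
        · simp
    exact congrArg (fun f => f P) this
  have := H p hp (l i) (u i) (hlu i) t ht
  simp only [he] at this
  rwa [intervalIntegral.integral_of_le (hlu i).le, ← integral_Icc_eq_integral_Ioc] at this

/-! ### Rational functions on a set -/

/-- The derivative is expressed through formal partial derivatives, so that derivatives of rational
functions are visibly rational again. -/
theorem MvPolynomial.hasFDerivAt_eval {d : ℕ} (P : MvPolynomial (Fin d) ℝ) (x : Fin d → ℝ) :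
    HasFDerivAt (fun x => MvPolynomial.eval x P)
      (∑ j, MvPolynomial.eval x (MvPolynomial.pderiv j P) •
        (ContinuousLinearMap.proj j : (Fin d → ℝ) →L[ℝ] ℝ)) x := by
  induction P using MvPolynomial.induction_on with
  | C r => simpa using hasFDerivAt_const r x
  | add p q hp hq =>
    simp only [map_add, add_smul, Finset.sum_add_distrib]
    exact hp.add hq
  | mul_X p i hp =>
    have h := hp.mul (ContinuousLinearMap.proj i : (Fin d → ℝ) →L[ℝ] ℝ).hasFDerivAt
    simp only [map_mul, MvPolynomial.eval_X]
    refine h.congr_fderiv ?_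
    ext v
    simp only [Derivation.leibniz, MvPolynomial.pderiv_X, smul_eq_mul, map_add, map_mul,
      MvPolynomial.eval_X, add_apply, smul_apply,
      ContinuousLinearMap.proj_apply, sum_apply, add_mul,
      Finset.sum_add_distrib, Finset.mul_sum, mul_assoc]
    congr 1
    rw [Finset.sum_eq_single i]
    · simp
    · intro j _ hj; simp [hj.symm]
    · simp

/-- The algebra of functions which agree on `S` with a rational function without poles in `S`. -/
def rationalOn {d : ℕ} (S : Set (Fin d → ℝ)) : Subalgebra ℝ ((Fin d → ℝ) → ℝ) where
  carrier := {g | ∃ P Q : MvPolynomial (Fin d) ℝ, ∀ x ∈ S,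
    MvPolynomial.eval x Q ≠ 0 ∧ g x = MvPolynomial.eval x P / MvPolynomial.eval x Q}
  add_mem' := by
    rintro f g ⟨P, Q, h⟩ ⟨P', Q', h'⟩
    refine ⟨P * Q' + Q * P', Q * Q', fun x hx => ⟨?_, ?_⟩⟩
    · rw [map_mul]; exact mul_ne_zero (h x hx).1 (h' x hx).1
    · rw [Pi.add_apply, (h x hx).2, (h' x hx).2, div_add_div _ _ (h x hx).1 (h' x hx).1]
      simp
  mul_mem' := by
    rintro f g ⟨P, Q, h⟩ ⟨P', Q', h'⟩
    refine ⟨P * P', Q * Q', fun x hx => ⟨?_, ?_⟩⟩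
    · rw [map_mul]; exact mul_ne_zero (h x hx).1 (h' x hx).1
    · rw [Pi.mul_apply, (h x hx).2, (h' x hx).2, div_mul_div_comm]
      simp
  algebraMap_mem' := fun r => ⟨MvPolynomial.C r, 1, fun x _ => by simp⟩

namespace rationalOn

variable {d : ℕ} {S : Set (Fin d → ℝ)}

theorem eval_mem (P : MvPolynomial (Fin d) ℝ) : (fun x => MvPolynomial.eval x P) ∈ rationalOn S :=
  ⟨P, 1, fun x _ => by simp⟩

theorem const_mem (r : ℝ) : (fun _ => r) ∈ rationalOn S := (rationalOn S).algebraMap_mem r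

theorem congr {f g : (Fin d → ℝ) → ℝ} (hf : f ∈ rationalOn S) (h : EqOn g f S) :
    g ∈ rationalOn S := by
  obtain ⟨P, Q, H⟩ := hf
  exact ⟨P, Q, fun x hx => ⟨(H x hx).1, (h hx).trans (H x hx).2⟩⟩

theorem mul_mem {f g : (Fin d → ℝ) → ℝ} (hf : f ∈ rationalOn S) (hg : g ∈ rationalOn S) :
    (fun x => f x * g x) ∈ rationalOn S := (rationalOn S).mul_mem hf hg

theorem sum_mem {ι : Type*} (s : Finset ι) {f : ι → (Fin d → ℝ) → ℝ}
    (hf : ∀ i ∈ s, f i ∈ rationalOn S) : (fun x => ∑ i ∈ s, f i x) ∈ rationalOn S := by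
  have := (rationalOn S).sum_mem hf
  convert this using 1
  ext x; simp

theorem prod_mem {ι : Type*} (s : Finset ι) {f : ι → (Fin d → ℝ) → ℝ}
    (hf : ∀ i ∈ s, f i ∈ rationalOn S) : (fun x => ∏ i ∈ s, f i x) ∈ rationalOn S := by
  have := (rationalOn S).prod_mem hf
  convert this using 1
  ext x; simp

theorem inv_mem {f : (Fin d → ℝ) → ℝ} (hf : f ∈ rationalOn S) (h0 : ∀ x ∈ S, f x ≠ 0) :
    (fun x => (f x)⁻¹) ∈ rationalOn S := by
  obtain ⟨P, Q, h⟩ := hf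
  refine ⟨Q, P, fun x hx => ⟨fun hP => h0 x hx ?_, ?_⟩⟩
  · rw [(h x hx).2, hP, zero_div]
  · simp only [(h x hx).2, inv_div]

theorem det_mem {ι : Type*} [Fintype ι] [DecidableEq ι] {A : (Fin d → ℝ) → Matrix ι ι ℝ}
    (hA : ∀ i j, (fun x => A x i j) ∈ rationalOn S) : (fun x => (A x).det) ∈ rationalOn S := by
  simp only [Matrix.det_apply']
  exact sum_mem _ fun σ _ => mul_mem (const_mem _) (prod_mem _ fun i _ => hA _ _)

theorem matrix_inv_mem {ι : Type*} [Fintype ι] [DecidableEq ι] {A : (Fin d → ℝ) → Matrix ι ι ℝ}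
    (hA : ∀ i j, (fun x => A x i j) ∈ rationalOn S) (h0 : ∀ x ∈ S, (A x).det ≠ 0) (i j : ι) :
    (fun x => (A x)⁻¹ i j) ∈ rationalOn S := by
  -- Cramer's rule: each entry of the inverse is a quotient of determinants.
  have h : (fun x => (A x)⁻¹ i j) =
      fun x => (A x).det⁻¹ * ((A x).updateRow j (Pi.single i 1)).det := by
    ext x
    rw [Matrix.inv_def, Matrix.smul_apply, Matrix.adjugate_apply, Ring.inverse_eq_inv', smul_eq_mul]
  rw [h]
  refine mul_mem (inv_mem (det_mem hA) h0) (det_mem fun i' j' => ?_)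
  by_cases hi : i' = j
  · simp only [hi, Matrix.updateRow_self]; exact const_mem _
  · simp only [Matrix.updateRow_ne hi]; exact hA i' j'

/-- The quotient rule, with denominator Q² that still has no zero in `S`: the algebra is closed
under differentiation. -/
theorem hasFDerivWithinAt {g : (Fin d → ℝ) → ℝ} (hg : g ∈ rationalOn S) :
    ∃ g' : Fin d → (Fin d → ℝ) → ℝ, (∀ j, g' j ∈ rationalOn S) ∧ ∀ x ∈ S,
      HasFDerivWithinAt g (∑ j, g' j x • (ContinuousLinearMap.proj j : (Fin d → ℝ) →L[ℝ] ℝ)) S x := by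
  obtain ⟨P, Q, h⟩ := hg
  refine ⟨fun j x => MvPolynomial.eval x (MvPolynomial.pderiv j P * Q - P * MvPolynomial.pderiv j Q) /
    MvPolynomial.eval x (Q ^ 2), fun j => ⟨_, _, fun x hx => ⟨?_, rfl⟩⟩, fun x hx => ?_⟩
  · rw [map_pow]; exact pow_ne_zero 2 (h x hx).1
  · have hQ := (h x hx).1
    have h1 := ((P.hasFDerivAt_eval x).fun_mul ((hasDerivAt_inv hQ).comp_hasFDerivAt x
      (Q.hasFDerivAt_eval x))).hasFDerivWithinAt (s := S)
    refine (h1.congr (fun y hy => (h y hy).2.trans (div_eq_mul_inv _ _))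
      ((h x hx).2.trans (div_eq_mul_inv _ _))).congr_fderiv ?_
    ext v
    simp only [map_sub, map_mul, map_pow, sum_apply,
      smul_apply, ContinuousLinearMap.proj_apply, smul_eq_mul,
      add_apply, Finset.mul_sum, ← Finset.sum_add_distrib,
      Function.comp_apply]
    refine Finset.sum_congr rfl fun j _ => ?_
    field_simp
    ring

theorem continuousOn {g : (Fin d → ℝ) → ℝ} (hg : g ∈ rationalOn S) : ContinuousOn g S := by
  obtain ⟨g', -, h⟩ := hasFDerivWithinAt hg
  exact fun x hx => (h x hx).continuousWithinAt

theorem fderivWithin_mem {g : (Fin d → ℝ) → ℝ} (hg : g ∈ rationalOn S) (hS : UniqueDiffOn ℝ S)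
    (j : Fin d) : (fun x => fderivWithin ℝ g S x (Pi.single j 1)) ∈ rationalOn S := by
  obtain ⟨g', hg', h⟩ := hasFDerivWithinAt hg
  refine congr (hg' j) fun x hx => ?_
  simp only [(h x hx).fderivWithin (hS x hx), sum_apply,
    smul_apply, ContinuousLinearMap.proj_apply, smul_eq_mul]
  rw [Finset.sum_eq_single j]
  · simp
  · intro i _ hi; simp [hi]
  · simp

/-- A finite-dimensional family of rational functions has a common denominator, and numerators of
bounded degree. -/
theorem exists_common_denominator {V : Type*} [AddCommGroup V] [Module ℝ V] [Module.Finite ℝ V]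
    (L : V → (Fin d → ℝ) → ℝ) (hL : ∀ v, L v ∈ rationalOn S)
    (hadd : ∀ v w, ∀ x ∈ S, L (v + w) x = L v x + L w x)
    (hsmul : ∀ (c : ℝ) v, ∀ x ∈ S, L (c • v) x = c * L v x) :
    ∃ (Q : MvPolynomial (Fin d) ℝ) (D : ℕ), (∀ x ∈ S, MvPolynomial.eval x Q ≠ 0) ∧
      ∀ v, ∃ P : MvPolynomial (Fin d) ℝ, P.totalDegree ≤ D ∧
        ∀ x ∈ S, L v x = MvPolynomial.eval x P / MvPolynomial.eval x Q := by
  let β := Module.finBasis ℝ V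
  choose P Q h using fun i => hL (β i)
  -- The numerators of the basis elements after expansion to the product of all denominators; every
  -- other numerator is a linear combination of these, which bounds its degree.
  let N : Fin (Module.finrank ℝ V) → MvPolynomial (Fin d) ℝ :=
    fun i => P i * ∏ j ∈ Finset.univ.erase i, Q j
  have hQ : ∀ x ∈ S, MvPolynomial.eval x (∏ j, Q j) ≠ 0 := fun x hx => by
    rw [map_prod]; exact Finset.prod_ne_zero_iff.2 fun j _ => (h j x hx).1
  refine ⟨∏ j, Q j, Finset.univ.sup fun i => (N i).totalDegree, hQ, fun v =>
    ⟨∑ i, β.repr v i • N i, ?_, fun x hx => ?_⟩⟩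
  · rw [← MvPolynomial.mem_restrictTotalDegree]
    refine Submodule.sum_mem _ fun i _ => Submodule.smul_mem _ _ ?_
    rw [MvPolynomial.mem_restrictTotalDegree]
    exact Finset.le_sup (f := fun i => (N i).totalDegree) (Finset.mem_univ i)
  · let Lx : V →ₗ[ℝ] ℝ :=
      { toFun := fun v => L v x
        map_add' := fun v w => hadd v w x hx
        map_smul' := fun c v => hsmul c v x hx }
    have h1 : L v x = ∑ i, β.repr v i * L (β i) x := by
      have : Lx v = ∑ i, β.repr v i * Lx (β i) := by
        conv_lhs => rw [← β.sum_repr v, map_sum]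
        simp
      exact this
    rw [h1, eq_div_iff (hQ x hx), Finset.sum_mul, map_sum]
    refine Finset.sum_congr rfl fun i _ => ?_
    rw [(h i x hx).2, MvPolynomial.smul_eval, mul_assoc]
    congr 1
    simp only [N]
    rw [map_mul, ← Finset.mul_prod_erase _ _ (Finset.mem_univ i), map_mul, ← mul_assoc,
      div_mul_cancel₀ _ (h i x hx).1]

end rationalOn

/-! ### Trace inequality for rational functions on sub-boxes -/

theorem exists_bounds_of_continuousOn {X : Type*} [TopologicalSpace X] {S : Set X}
    (hS : IsCompact S) {f : X → ℝ} (hf : ContinuousOn f S) (hpos : ∀ x ∈ S, 0 < f x) :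
    ∃ c C : ℝ, 0 < c ∧ 0 < C ∧ ∀ x ∈ S, c ≤ f x ∧ f x ≤ C := by
  rcases S.eq_empty_or_nonempty with rfl | hne
  · exact ⟨1, 1, one_pos, one_pos, by simp⟩
  obtain ⟨x, hx, hmin⟩ := hS.exists_isMinOn hne hf
  obtain ⟨y, hy, hmax⟩ := hS.exists_isMaxOn hne hf
  exact ⟨f x, f y, hpos x hx, hpos y hy, fun z hz => ⟨hmin hz, hmax hz⟩⟩

theorem continuous_insertNth_const {m : ℕ} (i : Fin (m + 1)) (t : ℝ) :
    Continuous fun y : Fin m → ℝ => Fin.insertNth (α := fun _ => ℝ) i t y :=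
  continuous_const.finInsertNth i continuous_id

/-- Trace inequality on sub-boxes for a finite-dimensional space of rational functions. -/
theorem exists_rational_trace {m : ℕ} {V : Type*} [AddCommGroup V] [Module ℝ V]
    [Module.Finite ℝ V] {l₀ u₀ : Fin (m + 1) → ℝ} (L : V → (Fin (m + 1) → ℝ) → ℝ)
    (hL : ∀ v, L v ∈ rationalOn (Icc l₀ u₀))
    (hadd : ∀ v w, ∀ x ∈ Icc l₀ u₀, L (v + w) x = L v x + L w x)
    (hsmul : ∀ (c : ℝ) v, ∀ x ∈ Icc l₀ u₀, L (c • v) x = c * L v x) :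
    ∃ K : ℝ, 0 < K ∧ ∀ v, ∀ l u : Fin (m + 1) → ℝ, (∀ j, l j < u j) → Icc l u ⊆ Icc l₀ u₀ →
      ∀ i, ∀ t ∈ Icc (l i) (u i),
      ∫ y in Icc (fun j => l (i.succAbove j)) (fun j => u (i.succAbove j)),
        (L v (Fin.insertNth (α := fun _ => ℝ) i t y)) ^ 2 ≤
      K / (u i - l i) * ∫ x in Icc l u, (L v x) ^ 2 := by
  obtain ⟨Q, D, hQ, H⟩ := rationalOn.exists_common_denominator L hL hadd hsmul
  obtain ⟨K, hK, hT⟩ := exists_mvPolynomial_trace m D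
  obtain ⟨c, C, hc, hC, hcC⟩ := exists_bounds_of_continuousOn (isCompact_Icc (a := l₀) (b := u₀))
    (f := fun x => (MvPolynomial.eval x Q) ^ 2)
    ((MvPolynomial.continuous_eval Q).pow 2).continuousOn
    (fun x hx => by have := hQ x hx; positivity)
  -- The square of the common denominator lies in [c, C] on the large box: dividing by it on the
  -- slice costs c⁻¹, multiplying by it in the volume costs C. Neither depends on the sub-box.
  refine ⟨c⁻¹ * K * C, by positivity, fun v l u hlu hsub i t ht => ?_⟩
  obtain ⟨P, hP, hPQ⟩ := H v
  have hLc : ContinuousOn (fun x => (L v x) ^ 2) (Icc l u) :=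
    ((rationalOn.continuousOn (hL v)).mono hsub).pow 2
  have hPc : Continuous fun x : Fin (m + 1) → ℝ => (MvPolynomial.eval x P) ^ 2 :=
    (MvPolynomial.continuous_eval P).pow 2
  have hmem : ∀ y ∈ Icc (fun j => l (i.succAbove j)) (fun j => u (i.succAbove j)),
      Fin.insertNth (α := fun _ => ℝ) i t y ∈ Icc l u :=
    fun y hy => (insertNth_mem_Icc_iff i).2 ⟨ht, hy⟩
  have hd : 0 < u i - l i := sub_pos.2 (hlu i)
  calc _ ≤ ∫ y in Icc (fun j => l (i.succAbove j)) (fun j => u (i.succAbove j)),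
        c⁻¹ * (MvPolynomial.eval (Fin.insertNth (α := fun _ => ℝ) i t y) P) ^ 2 := by
        refine setIntegral_mono_on
          ((hLc.comp (continuous_insertNth_const i t).continuousOn hmem).integrableOn_compact
            isCompact_Icc)
          (((hPc.comp (continuous_insertNth_const i t)).continuousOn.integrableOn_compact
            isCompact_Icc).const_mul _) measurableSet_Icc fun y hy => ?_
        have hy' := hsub (hmem y hy)
        rw [hPQ _ hy', div_pow, div_eq_mul_inv, mul_comm]
        gcongr
        exact (hcC _ hy').1
    _ = c⁻¹ * ∫ y in Icc (fun j => l (i.succAbove j)) (fun j => u (i.succAbove j)),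
        (MvPolynomial.eval (Fin.insertNth (α := fun _ => ℝ) i t y) P) ^ 2 := integral_const_mul _ _
    _ ≤ c⁻¹ * (K / (u i - l i) * ∫ x in Icc l u, (MvPolynomial.eval x P) ^ 2) := by
        gcongr
        exact hT P hP l u hlu i t ht
    _ ≤ c⁻¹ * (K / (u i - l i) * ∫ x in Icc l u, C * (L v x) ^ 2) := by
        gcongr ?_ * (?_ * ?_)
        refine setIntegral_mono_on (hPc.continuousOn.integrableOn_compact isCompact_Icc)
          ((hLc.integrableOn_compact isCompact_Icc).const_mul _) measurableSet_Icc fun x hx => ?_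
        have hx' := hsub hx
        have h1 : MvPolynomial.eval x P = L v x * MvPolynomial.eval x Q := by
          rw [hPQ x hx', div_mul_cancel₀ _ (hQ x hx')]
        rw [h1, mul_pow, mul_comm]
        gcongr
        exact (hcC _ hx').2
    _ = _ := by rw [integral_const_mul]; ring

noncomputable section

/-! ### Jacobians and pulled-back gradients -/

variable {d : ℕ} {a b l u : Param d} {F w : Param d → Phys d} {x : Param d}

theorem uniqueDiffOn_Icc_pi (h : ∀ i, l i < u i) : UniqueDiffOn ℝ (Icc l u) := by
  refine uniqueDiffOn_convex (convex_Icc l u) ?_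
  rw [interior_Icc_pi]
  exact univ_pi_nonempty_iff.2 fun i => nonempty_Ioo.2 (h i)

theorem jac_mulVec (v : Param d) :
    (jac l u w x).mulVec v = (fderivWithin ℝ w (Icc l u) x v).ofLp := by
  ext i
  have h : v = ∑ j, v j • (Pi.single j (1 : ℝ) : Param d) := by
    rw [← pi_eq_sum_univ']
  conv_rhs => rw [h, map_sum]
  simp [Matrix.mulVec, dotProduct, jac, mul_comm]

theorem jac_congr {w' : Param d → Phys d} (h : EqOn w w' (Icc l u)) (hx : x ∈ Icc l u) :
    jac l u w x = jac l u w' x := by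
  simp only [jac, fderivWithin_congr h (h hx)]

/-- A nondegenerate box is a set of unique differentiability, so one-sided derivatives taken in a
cell and in a larger box agree, also on the boundary of the cell. -/
theorem jac_eq_of_subset {l' u' : Param d} (h : ∀ i, l i < u i) (hsub : Icc l u ⊆ Icc l' u')
    (hw : DifferentiableWithinAt ℝ w (Icc l' u') x) (hx : x ∈ Icc l u) :
    jac l u w x = jac l' u' w x := by
  simp only [jac, fderivWithin_subset hsub (uniqueDiffOn_Icc_pi h x hx) hw]

theorem jac_apply (h : ∀ i, l i < u i) (hw : DifferentiableWithinAt ℝ w (Icc l u) x)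
    (hx : x ∈ Icc l u) (i j : Fin d) :
    jac l u w x i j = fderivWithin ℝ (fun y => w y i) (Icc l u) x (Pi.single j 1) := by
  have h1 := ((EuclideanSpace.proj i : Phys d →L[ℝ] ℝ).hasFDerivAt (x := w x)).comp_hasFDerivWithinAt
    x hw.hasFDerivWithinAt
  have h2 : HasFDerivWithinAt (fun y => w y i)
    ((EuclideanSpace.proj i : Phys d →L[ℝ] ℝ).comp (fderivWithin ℝ w (Icc l u) x)) (Icc l u) x := h1
  rw [h2.fderivWithin (uniqueDiffOn_Icc_pi h x hx)]
  rfl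

theorem continuousOn_jac_apply (h : ∀ i, l i < u i) (hw : ContDiffOn ℝ 1 w (Icc l u))
    (i j : Fin d) : ContinuousOn (fun x => jac l u w x i j) (Icc l u) := by
  have h1 := hw.continuousOn_fderivWithin (uniqueDiffOn_Icc_pi h) le_rfl
  have h2 : ContinuousOn (fun x => fderivWithin ℝ w (Icc l u) x (Pi.single j 1)) (Icc l u) :=
    h1.clm_apply continuousOn_const
  exact (EuclideanSpace.proj i : Phys d →L[ℝ] ℝ).continuous.comp_continuousOn h2

theorem continuousOn_jac (h : ∀ i, l i < u i) (hw : ContDiffOn ℝ 1 w (Icc l u)) :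
    ContinuousOn (jac l u w) (Icc l u) :=
  continuousOn_pi.2 fun i => continuousOn_pi.2 fun j => continuousOn_jac_apply h hw i j

theorem ContinuousOn.matrix_det {X ι : Type*} [TopologicalSpace X] [Fintype ι] [DecidableEq ι]
    {S : Set X} {A : X → Matrix ι ι ℝ} (hA : ContinuousOn A S) :
    ContinuousOn (fun x => (A x).det) S :=
  (Continuous.matrix_det continuous_id).comp_continuousOn hA

theorem ContinuousOn.matrix_inv {X ι : Type*} [TopologicalSpace X] [Fintype ι] [DecidableEq ι]
    {S : Set X} {A : X → Matrix ι ι ℝ} (hA : ContinuousOn A S) (h0 : ∀ x ∈ S, (A x).det ≠ 0) :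
    ContinuousOn (fun x => (A x)⁻¹) S := by
  simp only [Matrix.inv_def, Ring.inverse_eq_inv']
  exact (hA.matrix_det.inv₀ h0).smul
    ((Continuous.matrix_adjugate continuous_id).comp_continuousOn hA)

/-- The gradient of `w ∘ F⁻¹` at `F x`, expressed through `w`; here `w` is defined on the box
`Icc l u` inside the domain `Icc a b` of `F`. -/
def pullGrad (a b : Param d) (F : Param d → Phys d) (l u : Param d) (w : Param d → Phys d)
    (x : Param d) : Matrix (Fin d) (Fin d) ℝ :=
  (jac a b F x)⁻¹.transpose * (jac l u w x).transpose

/-- The symmetric part of `pullGrad`. -/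
def pullStrain (a b : Param d) (F : Param d → Phys d) (l u : Param d) (w : Param d → Phys d)
    (x : Param d) : Matrix (Fin d) (Fin d) ℝ :=
  (1 / 2 : ℝ) • (pullGrad a b F l u w x + (pullGrad a b F l u w x).transpose)

theorem continuousOn_pullGrad (hab : ∀ i, a i < b i) (hF : ContDiffOn ℝ 1 F (Icc a b))
    (hdet : ∀ x ∈ Icc a b, (jac a b F x).det ≠ 0) (h : ∀ i, l i < u i)
    (hsub : Icc l u ⊆ Icc a b) (hw : ContDiffOn ℝ 1 w (Icc l u)) :
    ContinuousOn (pullGrad a b F l u w) (Icc l u) := by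
  have h1 := ((continuousOn_jac hab hF).matrix_inv hdet).mono hsub
  have h2 := continuousOn_jac h hw
  have hT : Continuous fun A : Matrix (Fin d) (Fin d) ℝ => A.transpose :=
    Continuous.matrix_transpose continuous_id
  have hM : Continuous fun p : Matrix (Fin d) (Fin d) ℝ × Matrix (Fin d) (Fin d) ℝ => p.1 * p.2 :=
    continuous_fst.matrix_mul continuous_snd
  exact hM.comp_continuousOn ((hT.comp_continuousOn h1).prodMk (hT.comp_continuousOn h2))

theorem continuousOn_pullStrain (hab : ∀ i, a i < b i) (hF : ContDiffOn ℝ 1 F (Icc a b))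
    (hdet : ∀ x ∈ Icc a b, (jac a b F x).det ≠ 0) (h : ∀ i, l i < u i)
    (hsub : Icc l u ⊆ Icc a b) (hw : ContDiffOn ℝ 1 w (Icc l u)) :
    ContinuousOn (pullStrain a b F l u w) (Icc l u) := by
  have h1 := continuousOn_pullGrad hab hF hdet h hsub hw
  have hT : Continuous fun A : Matrix (Fin d) (Fin d) ℝ => (1 / 2 : ℝ) • (A + A.transpose) :=
    Continuous.const_smul (continuous_id.add (Continuous.matrix_transpose continuous_id))
      (1 / 2 : ℝ)
  exact hT.comp_continuousOn h1

/-- At an interior point with nonsingular Jacobian, `F` is strictly differentiable with an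
invertible derivative. -/
theorem exists_hasStrictFDerivAt_equiv (hF : ContDiffOn ℝ 1 F (Icc a b))
    (hx : x ∈ interior (Icc a b)) (hdet : (jac a b F x).det ≠ 0) :
    ∃ F' : Param d ≃L[ℝ] Phys d, HasStrictFDerivAt F (F' : Param d →L[ℝ] Phys d) x ∧
      (F' : Param d →L[ℝ] Phys d) = fderivWithin ℝ F (Icc a b) x := by
  have hnhds : Icc a b ∈ 𝓝 x := mem_interior_iff_mem_nhds.1 hx
  have h1 : HasStrictFDerivAt F (fderiv ℝ F x) x :=
    (hF.contDiffAt hnhds).hasStrictFDerivAt one_ne_zero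
  rw [← fderivWithin_of_mem_nhds hnhds] at h1
  have hinj : Function.Injective (fderivWithin ℝ F (Icc a b) x) := by
    intro v v' hv
    have : (jac a b F x).mulVec v = (jac a b F x).mulVec v' := by
      rw [jac_mulVec, jac_mulVec, hv]
    exact Matrix.mulVec_injective_of_isUnit
      ((Matrix.isUnit_iff_isUnit_det _).2 (isUnit_iff_ne_zero.2 hdet)) this
  -- The two spaces have equal dimension, so injectivity of the derivative suffices.
  let e : Param d ≃ₗ[ℝ] Phys d := LinearEquiv.ofInjectiveOfFinrankEq
    (fderivWithin ℝ F (Icc a b) x : Param d →ₗ[ℝ] Phys d) hinj (by simp)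
  have he : (e.toContinuousLinearEquiv : Param d →L[ℝ] Phys d) = fderivWithin ℝ F (Icc a b) x := by
    ext1 v; rfl
  exact ⟨e.toContinuousLinearEquiv, he ▸ h1, he⟩

/-- Near `F x` the field v equals (v ∘ F) ∘ F⁻¹ with the local inverse of F, so the chain rule gives
differentiability of v itself from that of v ∘ F. -/
theorem hasFDerivAt_of_comp {v : Phys d → Phys d} {F' : Param d ≃L[ℝ] Phys d}
    {w' : Param d →L[ℝ] Phys d} (hF : HasStrictFDerivAt F (F' : Param d →L[ℝ] Phys d) x)
    (hw : HasFDerivAt (fun y => v (F y)) w' x) :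
    HasFDerivAt v (w'.comp (F'.symm : Phys d →L[ℝ] Param d)) (F x) := by
  have hg := hF.to_localInverse
  have hgx : hF.localInverse F F' x (F x) = x := hF.localInverse_apply_image
  have h1 : HasFDerivAt (fun y => v (F (hF.localInverse F F' x y)))
      (w'.comp (F'.symm : Phys d →L[ℝ] Param d)) (F x) := by
    refine HasFDerivAt.comp (g := fun y => v (F y)) (F x) ?_ hg.hasFDerivAt
    rwa [hgx]
  refine h1.congr_of_eventuallyEq ?_
  filter_upwards [hF.eventually_right_inverse] with y hy
  rw [hy]

/-- Chain rule Dv = D(v ∘ F) (DF)⁻¹. The transposes in `pullGrad` reflect that `vgrad` is the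
transpose of the Jacobian matrix. -/
theorem vgrad_eq_pullGrad {v : Phys d → Phys d} (hsub : Icc l u ⊆ Icc a b)
    (hF : ContDiffOn ℝ 1 F (Icc a b)) (hx : x ∈ interior (Icc l u))
    (hdet : (jac a b F x).det ≠ 0)
    (hw : DifferentiableWithinAt ℝ (fun y => v (F y)) (Icc l u) x) :
    DifferentiableAt ℝ v (F x) ∧
    vgrad v (F x) = pullGrad a b F l u (fun y => v (F y)) x := by
  obtain ⟨F', hF', hFeq⟩ := exists_hasStrictFDerivAt_equiv hF (interior_mono hsub hx) hdet
  have hnhds : Icc l u ∈ 𝓝 x := mem_interior_iff_mem_nhds.1 hx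
  have hw' := (hw.hasFDerivWithinAt.hasFDerivAt hnhds)
  have hv := hasFDerivAt_of_comp hF' hw'
  refine ⟨hv.differentiableAt, ?_⟩
  ext i j
  have hz : F'.symm (EuclideanSpace.single i 1) = (jac a b F x)⁻¹.mulVec (Pi.single i 1) := by
    have h1 : (jac a b F x).mulVec (F'.symm (EuclideanSpace.single i 1)) = Pi.single i 1 := by
      rw [jac_mulVec, ← hFeq]; simp
    rw [← h1, Matrix.mulVec_mulVec, Matrix.nonsing_inv_mul _ (isUnit_iff_ne_zero.2 hdet),
      Matrix.one_mulVec]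
  have h2 : vgrad v (F x) i j = ((jac l u (fun y => v (F y)) x).mulVec
      ((jac a b F x)⁻¹.mulVec (Pi.single i 1))) j := by
    rw [jac_mulVec, ← hz]
    simp [vgrad, hv.fderiv]
  rw [h2, pullGrad, ← Matrix.transpose_mul, Matrix.transpose_apply, Matrix.mulVec_mulVec]
  simp

theorem symGrad_eq_pullStrain {v : Phys d → Phys d} (hsub : Icc l u ⊆ Icc a b)
    (hF : ContDiffOn ℝ 1 F (Icc a b)) (hx : x ∈ interior (Icc l u))
    (hdet : (jac a b F x).det ≠ 0)
    (hw : DifferentiableWithinAt ℝ (fun y => v (F y)) (Icc l u) x) :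
    symGrad v (F x) = pullStrain a b F l u (fun y => v (F y)) x := by
  rw [symGrad, (vgrad_eq_pullGrad hsub hF hx hdet hw).2, pullStrain]

/-- The inverse of a continuous injection on a compact set is uniformly continuous. -/
theorem exists_dist_lt_of_dist_image_lt {X Y : Type*} [PseudoMetricSpace X] [MetricSpace Y]
    {S : Set X} (hS : IsCompact S) {f : X → Y} (hf : ContinuousOn f S) (hinj : InjOn f S)
    {ε : ℝ} (hε : 0 < ε) :
    ∃ δ > 0, ∀ p ∈ S, ∀ q ∈ S, dist (f p) (f q) < δ → dist p q < ε := by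
  -- On the compact set of pairs at distance at least ε the distance of the images has a positive
  -- lower bound; this bound is the required δ.
  let T : Set (X × X) := (S ×ˢ S) ∩ {p | ε ≤ dist p.1 p.2}
  have hT : IsCompact T :=
    (hS.prod hS).inter_right (isClosed_le continuous_const (continuous_fst.dist continuous_snd))
  have hc : ContinuousOn (fun p : X × X => dist (f p.1) (f p.2)) T :=
    continuous_dist.comp_continuousOn
      ((hf.comp continuousOn_fst fun (p : X × X) (hp : p ∈ T) => hp.1.1).prodMk
        (hf.comp continuousOn_snd fun (p : X × X) (hp : p ∈ T) => hp.1.2))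
  obtain ⟨c, _, hc0, _, H⟩ := exists_bounds_of_continuousOn hT hc fun p hp => by
    refine dist_pos.2 fun h => ?_
    have h1 : ε ≤ dist p.1 p.2 := hp.2
    rw [hinj hp.1.1 hp.1.2 h, dist_self] at h1
    linarith
  refine ⟨c, hc0, fun p hp q hq hpq => ?_⟩
  by_contra! hcon
  exact absurd (H (p, q) ⟨⟨hp, hq⟩, hcon⟩).1 (not_le.2 hpq)

/-- The limit of the strain from an element, at a point of the closed element. -/
theorem limUnder_symGrad {v : Phys d → Phys d} (hab : ∀ i, a i < b i)
    (hF : ContDiffOn ℝ 1 F (Icc a b)) (hinj : InjOn F (Icc a b))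
    (hdet : ∀ x ∈ Icc a b, (jac a b F x).det ≠ 0) (h : ∀ i, l i < u i)
    (hsub : Icc l u ⊆ Icc a b) (hw : ContDiffOn ℝ 1 (fun y => v (F y)) (Icc l u))
    (hx : x ∈ Icc l u) :
    limUnder (𝓝[F '' Set.pi univ fun i => Ioo (l i) (u i)] (F x)) (symGrad v) =
      pullStrain a b F l u (fun y => v (F y)) x := by
  rw [← interior_Icc_pi]
  have hFc : ContinuousOn F (Icc l u) := hF.continuousOn.mono hsub
  have hcl : x ∈ closure (interior (Icc l u)) := by rwa [closure_interior_Icc_pi h]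
  -- Without this the limit would not be determined: `F x` must be a limit point of the open
  -- element.
  have hne : (𝓝[F '' interior (Icc l u)] (F x)).NeBot :=
    mem_closure_iff_nhdsWithin_neBot.1
      (((hFc x hx).mono interior_subset).mem_closure_image hcl)
  refine Tendsto.limUnder_eq ?_
  -- The inverse of F is continuous up to the boundary of the element, so the limit of the strain is
  -- the value of its pullback, which is continuous on the closed cell.
  have hinv : Tendsto (Function.invFunOn F (Icc l u)) (𝓝[F '' interior (Icc l u)] (F x))
      (𝓝[Icc l u] x) := by
    have hinj' : InjOn F (Icc l u) := hinj.mono hsub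
    have hleft : ∀ y ∈ Icc l u, Function.invFunOn F (Icc l u) (F y) = y :=
      fun y hy => hinj'.leftInvOn_invFunOn hy
    have hc : ContinuousOn (Function.invFunOn F (Icc l u)) (F '' Icc l u) := by
      refine Metric.continuousOn_iff.2 ?_
      rintro _ ⟨y, hy, rfl⟩ ε hε
      obtain ⟨δ, hδ, H⟩ := exists_dist_lt_of_dist_image_lt isCompact_Icc hFc hinj' hε
      refine ⟨δ, hδ, ?_⟩
      rintro _ ⟨z, hz, rfl⟩ hzy
      rw [hleft y hy, hleft z hz]
      exact H z hz y hy hzy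
    have h1 := hc (F x) ⟨x, hx, rfl⟩
    rw [ContinuousWithinAt, hleft x hx] at h1
    refine tendsto_nhdsWithin_iff.2 ⟨h1.mono_left (nhdsWithin_mono _
      (image_mono interior_subset)), ?_⟩
    filter_upwards [self_mem_nhdsWithin] with y hy
    obtain ⟨z, hz, rfl⟩ := hy
    rw [hleft z (interior_subset hz)]
    exact interior_subset hz
  have hc := (continuousOn_pullStrain hab hF hdet h hsub hw x hx).tendsto.comp hinv
  refine hc.congr' ?_
  filter_upwards [self_mem_nhdsWithin] with y hy
  obtain ⟨z, hz, rfl⟩ := hy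
  rw [Function.comp_apply, (hinj.mono hsub).leftInvOn_invFunOn (interior_subset hz),
    symGrad_eq_pullStrain hsub hF hz (hdet z (hsub (interior_subset hz)))
      ((hw.differentiableOn one_ne_zero) z (interior_subset hz))]

end

noncomputable section

/-! ### Side lengths of elements, change of variables -/

variable {d : ℕ} {a b l u : Param d} {F w : Param d → Phys d} {x : Param d}

/-- Compactness of the box times the unit sphere, where the derivative does not vanish, followed by
homogeneity in the vector. -/
theorem exists_fderivWithin_bounds (hab : ∀ i, a i < b i) (hF : ContDiffOn ℝ 1 F (Icc a b))
    (hdet : ∀ x ∈ Icc a b, (jac a b F x).det ≠ 0) :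
    ∃ c C : ℝ, 0 < c ∧ 0 < C ∧ ∀ x ∈ Icc a b, ∀ v : Param d,
      c * ‖v‖ ≤ ‖fderivWithin ℝ F (Icc a b) x v‖ ∧ ‖fderivWithin ℝ F (Icc a b) x v‖ ≤ C * ‖v‖ := by
  have hD := hF.continuousOn_fderivWithin (uniqueDiffOn_Icc_pi hab) le_rfl
  obtain ⟨c, C, hc, hC, H⟩ := exists_bounds_of_continuousOn
    ((isCompact_Icc (a := a) (b := b)).prod (isCompact_sphere (0 : Param d) 1))
    (f := fun p => ‖fderivWithin ℝ F (Icc a b) p.1 p.2‖)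
    (((hD.comp continuousOn_fst fun p hp => hp.1).clm_apply continuousOn_snd).norm) (by
      rintro ⟨x, v⟩ ⟨hx, hv⟩
      refine norm_pos_iff.2 fun h0 => ?_
      have h1 : (jac a b F x).mulVec v = 0 := by
        rw [jac_mulVec]; simp only at h0; rw [h0]; rfl
      have h2 : v = 0 := Matrix.eq_zero_of_mulVec_eq_zero (hdet x hx) h1
      simp [h2] at hv)
  refine ⟨c, C, hc, hC, fun x hx v => ?_⟩
  rcases eq_or_ne v 0 with rfl | hv
  · simp
  have hv' : 0 < ‖v‖ := norm_pos_iff.2 hv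
  have h1 := H (x, ‖v‖⁻¹ • v) ⟨hx, by simp [norm_smul, hv'.ne']⟩
  simp only [map_smul, norm_smul, norm_inv, norm_norm] at h1
  rw [inv_mul_eq_div, le_div_iff₀ hv', div_le_iff₀ hv'] at h1
  exact h1

/-- The image of a box can only contain a ball of radius `ρ` if all its sides are at least a
fixed multiple of `ρ`. -/
theorem exists_side_lower_bound (hab : ∀ i, a i < b i) (hF : ContDiffOn ℝ 1 F (Icc a b))
    (hinj : InjOn F (Icc a b)) (hdet : ∀ x ∈ Icc a b, (jac a b F x).det ≠ 0) :
    ∃ c : ℝ, 0 < c ∧ ∀ l u : Param d, Icc l u ⊆ Icc a b → ∀ ρ : ℝ, 0 < ρ →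
      (∃ y, Metric.ball y ρ ⊆ F '' Set.pi univ fun i => Ioo (l i) (u i)) →
      ∀ i, c * ρ ≤ u i - l i := by
  obtain ⟨μ, Λ, hμ, hΛ, hb⟩ := exists_fderivWithin_bounds hab hF hdet
  have hD := hF.continuousOn_fderivWithin (uniqueDiffOn_Icc_pi hab) le_rfl
  -- Within parametric distance ε, DF varies by less than a quarter of its lower bound μ, so F
  -- differs from its linearization by a small relative error.
  obtain ⟨ε, hε, hunif⟩ := Metric.uniformContinuousOn_iff.1
    (isCompact_Icc.uniformContinuousOn_of_continuous hD) (μ / 4) (by positivity)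
  obtain ⟨δ, hδ, hinv⟩ := exists_dist_lt_of_dist_image_lt isCompact_Icc hF.continuousOn hinj hε
  obtain ⟨R, hR, hRb⟩ : ∃ R : ℝ, 0 < R ∧ ∀ p ∈ Icc a b, ∀ q ∈ Icc a b, dist (F p) (F q) ≤ R := by
    have hbd := (isCompact_Icc.image_of_continuousOn hF.continuousOn).isBounded
    exact ⟨Metric.diam (F '' Icc a b) + 1, by positivity, fun p hp q hq =>
      (Metric.dist_le_diam_of_mem hbd ⟨p, hp, rfl⟩ ⟨q, hq, rfl⟩).trans (by linarith)⟩
  refine ⟨min 1 (δ / (2 * R)) / (4 * Λ), by positivity, ?_⟩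
  rintro l u hsub ρ hρ ⟨y, hy⟩ i
  have hopen : ∀ p ∈ Set.pi univ fun i => Ioo (l i) (u i), p ∈ Icc a b := fun p hp =>
    hsub ⟨fun j => (hp j trivial).1.le, fun j => (hp j trivial).2.le⟩
  obtain ⟨p₀, hp₀, rfl⟩ := hy (Metric.mem_ball_self hρ)
  -- The ball lies in an image of diameter at most R. This allows the minimum of ρ and δ, which
  -- appears below, to be bounded below by a fixed multiple of ρ.
  have hρR : ρ ≤ 2 * R := by
    have hm : F p₀ + EuclideanSpace.single i (ρ / 2) ∈ Metric.ball (F p₀) ρ := by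
      rw [Metric.mem_ball, dist_eq_norm, add_sub_cancel_left, PiLp.norm_single, Real.norm_eq_abs,
        abs_of_pos (by positivity)]
      linarith
    obtain ⟨q, hq, hqe⟩ := hy hm
    have := hRb q (hopen q hq) p₀ (hopen p₀ hp₀)
    rw [hqe, dist_eq_norm, add_sub_cancel_left, PiLp.norm_single, Real.norm_eq_abs,
      abs_of_pos (by positivity)] at this
    linarith
  -- With this t the vector DF(p₀)(t eᵢ) has length at most half of both ρ and δ: its endpoint stays
  -- in the ball, hence in the image of the open box, and its preimage p₁ stays within ε of p₀.
  set t := min ρ δ / (2 * Λ) with ht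
  have htpos : 0 < t := by positivity
  have htc : min 1 (δ / (2 * R)) * ρ ≤ min ρ δ := by
    refine le_min ?_ ?_
    · exact (mul_le_mul_of_nonneg_right (min_le_left _ _) hρ.le).trans (one_mul ρ).le
    · refine (mul_le_mul_of_nonneg_right (min_le_right _ _) hρ.le).trans ?_
      rw [div_mul_eq_mul_div, div_le_iff₀ (by positivity)]
      exact mul_le_mul_of_nonneg_left hρR hδ.le
  have htΛ : t * Λ = min ρ δ / 2 := by rw [ht]; field_simp
  set D := fderivWithin ℝ F (Icc a b) p₀ with hDdef
  have hDn : ‖D (Pi.single i t)‖ ≤ min ρ δ / 2 := by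
    have := (hb p₀ (hopen p₀ hp₀) (Pi.single i t)).2
    rw [Pi.norm_single, Real.norm_eq_abs, abs_of_pos htpos] at this
    rw [← htΛ, mul_comm]; exact this
  have hmin : 0 < min ρ δ := lt_min hρ hδ
  obtain ⟨p₁, hp₁, hp₁e⟩ := hy (show F p₀ + D (Pi.single i t) ∈ Metric.ball (F p₀) ρ by
    rw [Metric.mem_ball, dist_eq_norm, add_sub_cancel_left]
    linarith [min_le_left ρ δ])
  have hdist : dist p₁ p₀ < ε := hinv p₁ (hopen _ hp₁) p₀ (hopen _ hp₀) (by
    rw [hp₁e, dist_eq_norm, add_sub_cancel_left]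
    linarith [min_le_right ρ δ])
  have hmv : ‖F p₁ - F p₀ - D (p₁ - p₀)‖ ≤ μ / 4 * ‖p₁ - p₀‖ := by
    refine Convex.norm_image_sub_le_of_norm_hasFDerivWithin_le' (𝕜 := ℝ)
      (s := Icc a b ∩ Metric.ball p₀ ε) (f' := fderivWithin ℝ F (Icc a b)) (fun q hq =>
        ((hF.differentiableOn one_ne_zero) q hq.1).hasFDerivWithinAt.mono inter_subset_left)
      (fun q hq => ?_) ((convex_Icc a b).inter (convex_ball p₀ ε))
      ⟨hopen _ hp₀, Metric.mem_ball_self hε⟩ ⟨hopen _ hp₁, hdist⟩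
    rw [← dist_eq_norm]
    exact (hunif q hq.1 p₀ (hopen _ hp₀) hq.2).le
  -- Since F p₁ - F p₀ equals DF(p₀)(t eᵢ), the linearization error controls the distance of p₁ - p₀
  -- from t eᵢ. That distance is at most t/3, so the box extends at least 2t/3 in direction i.
  have hkey : μ * ‖Pi.single i t - (p₁ - p₀)‖ ≤ μ / 4 * ‖p₁ - p₀‖ := by
    refine ((hb p₀ (hopen _ hp₀) _).1).trans ?_
    rw [map_sub, ← hDdef]
    rwa [hp₁e, add_sub_cancel_left] at hmv
  have hkey' : ‖Pi.single i t - (p₁ - p₀)‖ ≤ ‖p₁ - p₀‖ / 4 := by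
    refine le_of_mul_le_mul_left (hkey.trans (le_of_eq ?_)) hμ
    ring
  have hz : ‖p₁ - p₀‖ ≤ t + ‖Pi.single i t - (p₁ - p₀)‖ := by
    have h1 : p₁ - p₀ = Pi.single i t - (Pi.single i t - (p₁ - p₀)) := by abel
    have h2 := norm_sub_le (Pi.single i t : Param d) (Pi.single i t - (p₁ - p₀))
    rw [← h1, Pi.norm_single, Real.norm_eq_abs, abs_of_pos htpos] at h2
    exact h2
  have hi := norm_le_pi_norm (Pi.single i t - (p₁ - p₀)) i
  simp only [Pi.sub_apply, Pi.single_eq_same, Real.norm_eq_abs] at hi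
  have hi' := (abs_le.1 hi).2
  have h0 := (hp₀ i trivial).1
  have h1 := (hp₁ i trivial).2
  have hfin : min 1 (δ / (2 * R)) / (4 * Λ) * ρ ≤ t / 2 := by
    rw [ht, div_mul_eq_mul_div, div_div, show 2 * Λ * 2 = 4 * Λ by ring]
    gcongr
  linarith

/-- The change of variables formula needs the determinant of an endomorphism, while F maps between
two different normed versions of the same space; composition with the identification repairs this.
-/
theorem det_fderivWithin_ofLp (hF : ContDiffOn ℝ 1 F (Icc a b))
    (hx : x ∈ Icc a b) :
    ∃ F' : Param d →L[ℝ] Param d, HasFDerivWithinAt (fun y => (F y).ofLp) F' (Icc a b) x ∧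
      F'.det = (jac a b F x).det := by
  have hd := ((hF.differentiableOn one_ne_zero) x hx).hasFDerivWithinAt
  let e : Phys d ≃L[ℝ] Param d := PiLp.continuousLinearEquiv 2 ℝ fun _ : Fin d => ℝ
  refine ⟨(e : Phys d →L[ℝ] Param d).comp (fderivWithin ℝ F (Icc a b) x),
    e.hasFDerivAt.comp_hasFDerivWithinAt x hd, ?_⟩
  rw [← LinearMap.det_toLin' (jac a b F x), ContinuousLinearMap.det]
  congr 1
  refine LinearMap.ext fun v => ?_
  rw [Matrix.toLin'_apply, jac_mulVec]
  rfl

theorem integral_physDomain (hF : ContDiffOn ℝ 1 F (Icc a b))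
    (hinj : InjOn F (Icc a b)) (g : Phys d → ℝ) :
    ∫ y in physDomain a b F, g y = ∫ x in Icc a b, |(jac a b F x).det| * g (F x) := by
  have hS : MeasurableSet (Set.pi univ fun i => Ioo (a i) (b i)) :=
    MeasurableSet.univ_pi fun i => measurableSet_Ioo
  have hsub : (Set.pi univ fun i => Ioo (a i) (b i)) ⊆ Icc a b := by
    rw [← interior_Icc_pi]; exact interior_subset
  -- The identification of coordinates with the Euclidean space preserves volume, so the integral
  -- may be moved to the coordinate space first.
  have hpre : (WithLp.toLp 2 : Param d → Phys d) ⁻¹' physDomain a b F =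
      (fun y => (F y).ofLp) '' Set.pi univ fun i => Ioo (a i) (b i) := by
    ext z
    constructor
    · rintro ⟨x, hx, hxz⟩; exact ⟨x, hx, by simp only [hxz]⟩
    · rintro ⟨x, hx, rfl⟩; exact ⟨x, hx, rfl⟩
  have hmp := (PiLp.volume_preserving_toLp (Fin d)).setIntegral_preimage_emb
    (MeasurableEquiv.toLp 2 (Fin d → ℝ)).measurableEmbedding g (physDomain a b F)
  rw [← hmp, hpre]
  choose! F' hF' hF'det using fun x (hx : x ∈ Icc a b) => det_fderivWithin_ofLp hF hx
  rw [integral_image_eq_integral_abs_det_fderiv_smul volume hS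
    (fun x hx => (hF' x (hsub hx)).mono hsub)
    (fun x hx y hy hxy => hinj (hsub hx) (hsub hy) (by
      have : (F x).ofLp = (F y).ofLp := hxy
      exact WithLp.ofLp_injective 2 this))]
  rw [show (∫ x in Icc a b, |(jac a b F x).det| * g (F x)) =
    ∫ x in Set.pi univ fun i => Ioo (a i) (b i), |(jac a b F x).det| * g (F x) from
      setIntegral_congr_set Measure.univ_pi_Ioo_ae_eq_Icc.symm]
  refine setIntegral_congr_fun hS fun x hx => ?_
  simp only [hF'det x (hsub hx), smul_eq_mul]

/-! ### Cells of a mesh -/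

/-- Induction on the number of spans: the point is in the last one, or the last knot can be dropped.
-/
theorem exists_mem_span {n : ℕ} {ζ : Fin (n + 1) → ℝ} (hn : 0 < n) {x : ℝ}
    (hx : x ∈ Icc (ζ 0) (ζ (Fin.last n))) :
    ∃ j : Fin n, x ∈ Icc (ζ j.castSucc) (ζ j.succ) := by
  induction n with
  | zero => exact absurd hn (lt_irrefl _)
  | succ n ih =>
    rcases le_total (ζ (Fin.last n).castSucc) x with h | h
    · exact ⟨Fin.last n, h, hx.2⟩
    · rcases Nat.eq_zero_or_pos n with rfl | hn'
      · exact ⟨0, hx.1, hx.2⟩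
      · obtain ⟨j, hj⟩ := ih (ζ := fun i => ζ i.castSucc) hn' ⟨hx.1, h⟩
        exact ⟨j.castSucc, hj⟩

namespace ParamMesh

theorem left_lt_right (M : ParamMesh a b) (i : Fin d) : a i < b i := by
  rw [← M.first i, ← M.last i]
  exact M.strictMono i (Fin.pos_iff_ne_zero.2 (by
    intro h; have := M.n_pos i; have h2 := congrArg Fin.val h; simp at h2; omega))

variable (M : ParamMesh a b)

theorem lo_lt_hi (c : M.Cell) (i : Fin d) : M.lo c i < M.hi c i :=
  M.strictMono i Fin.castSucc_lt_succ

theorem closedCell_subset (c : M.Cell) : M.closedCell c ⊆ Icc a b := by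
  refine Icc_subset_Icc (fun i => ?_) (fun i => ?_)
  · rw [← M.first i]; exact (M.strictMono i).monotone (Fin.zero_le _)
  · rw [← M.last i]; exact (M.strictMono i).monotone (Fin.le_last _)

theorem interior_closedCell (c : M.Cell) : interior (M.closedCell c) = M.openCell c :=
  interior_Icc_pi _ _

theorem openCell_ae_eq (c : M.Cell) : (M.openCell c : Set (Param d)) =ᵐ[volume] M.closedCell c :=
  Measure.univ_pi_Ioo_ae_eq_Icc

theorem iUnion_closedCell : ⋃ c : M.Cell, M.closedCell c = Icc a b := by
  refine Subset.antisymm (iUnion_subset M.closedCell_subset) fun x hx => ?_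
  choose j hj using fun i => exists_mem_span (M.n_pos i) (ζ := M.ζ i) (x := x i)
    ⟨(M.first i).trans_le (hx.1 i), (hx.2 i).trans (M.last i).ge⟩
  exact mem_iUnion.2 ⟨j, fun i => (hj i).1, fun i => (hj i).2⟩

theorem disjoint_openCell {c c' : M.Cell} (h : c ≠ c') : Disjoint (M.openCell c) (M.openCell c') := by
  obtain ⟨i, hne⟩ := Function.ne_iff.1 h
  refine Set.disjoint_left.2 fun x hx hx' => ?_
  have h1 := hx i trivial
  have h2 := hx' i trivial
  simp only [lo, hi, mem_Ioo] at h1 h2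
  rcases lt_or_gt_of_ne hne with hlt | hlt
  · have := (M.strictMono i).monotone (show (c i).succ ≤ (c' i).castSucc from hlt)
    linarith
  · have := (M.strictMono i).monotone (show (c' i).succ ≤ (c i).castSucc from hlt)
    linarith

theorem integral_eq_sum_closedCell {f : Param d → ℝ} (hf : ∀ c, IntegrableOn f (M.closedCell c)) :
    IntegrableOn f (Icc a b) ∧ ∫ x in Icc a b, f x = ∑ c : M.Cell, ∫ x in M.closedCell c, f x := by
  rw [← M.iUnion_closedCell]
  refine ⟨integrableOn_finite_iUnion.2 hf, ?_⟩
  rw [integral_iUnion_ae (s := M.closedCell)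
    (fun c => measurableSet_Icc.nullMeasurableSet) (fun c c' h => ?_)
    (integrableOn_finite_iUnion.2 hf), tsum_fintype]
  -- Closed cells share faces, but they differ from the disjoint open cells only by null sets.
  exact (M.disjoint_openCell h).aedisjoint.congr (M.openCell_ae_eq c).symm
    (M.openCell_ae_eq c').symm

end ParamMesh

end

noncomputable section

/-! ### Splines on cells -/

variable {d : ℕ} {a b l u : Param d} {F w : Param d → Phys d} {x : Param d}

theorem totalDegree_aeval_X_le (q : Polynomial ℝ) (j : Fin d) :
    (Polynomial.aeval (MvPolynomial.X j : MvPolynomial (Fin d) ℝ) q).totalDegree ≤ q.natDegree := by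
  rw [Polynomial.aeval_eq_sum_range, ← MvPolynomial.mem_restrictTotalDegree]
  refine Submodule.sum_mem _ fun i hi => Submodule.smul_mem _ _ ?_
  rw [MvPolynomial.mem_restrictTotalDegree, MvPolynomial.totalDegree_X_pow]
  exact Finset.mem_range_succ_iff.1 hi

/-- The two features of splines that matter below: global continuity, and being a polynomial on each
cell, of degree bounded independently of the mesh. -/
theorem tensorSplineSpace_continuousOn_and_polynomial {M : ParamMesh a b} {p r : Fin d → ℕ}
    {s : Param d → ℝ} (hs : s ∈ tensorSplineSpace M p r) :
    ContinuousOn s (Icc a b) ∧ ∀ c : M.Cell,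
      ∃ P : MvPolynomial (Fin d) ℝ, P.totalDegree ≤ ∑ j, p j ∧
        ∀ x ∈ M.closedCell c, s x = MvPolynomial.eval x P := by
  induction hs using Submodule.span_induction with
  | mem g hg =>
    obtain ⟨f, hf, rfl⟩ := hg
    refine ⟨continuousOn_finsetProd _ fun j _ => ?_, fun c => ?_⟩
    · refine (hf j).1.continuousOn.comp (continuous_apply j).continuousOn fun x hx => ?_
      rw [M.first, M.last]
      exact ⟨hx.1 j, hx.2 j⟩
    · choose q hq hqe using fun j => (hf j).2 (c j)
      refine ⟨∏ j, Polynomial.aeval (MvPolynomial.X j) (q j), ?_, fun x hx => ?_⟩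
      · exact (MvPolynomial.totalDegree_finsetProd _ _).trans
          (Finset.sum_le_sum fun j _ => (totalDegree_aeval_X_le _ _).trans (hq j))
      · rw [map_prod]
        refine Finset.prod_congr rfl fun j _ => ?_
        rw [hqe j (x j) ⟨hx.1 j, hx.2 j⟩, ← MvPolynomial.coe_aeval_eq_eval,
          RingHom.coe_coe, ← Polynomial.aeval_algHom_apply]
        simp
  | zero => exact ⟨continuousOn_const, fun c => ⟨0, by simp, by simp⟩⟩
  | add f g _ _ hf hg =>
    refine ⟨hf.1.add hg.1, fun c => ?_⟩
    obtain ⟨P, hP, hPe⟩ := hf.2 c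
    obtain ⟨Q, hQ, hQe⟩ := hg.2 c
    exact ⟨P + Q, (MvPolynomial.totalDegree_add _ _).trans (max_le hP hQ), fun x hx => by
      rw [Pi.add_apply, hPe x hx, hQe x hx, map_add]⟩
  | smul r f _ hf =>
    refine ⟨hf.1.const_smul r, fun c => ?_⟩
    obtain ⟨P, hP, hPe⟩ := hf.2 c
    exact ⟨r • P, (MvPolynomial.totalDegree_smul_le _ _).trans hP, fun x hx => by
      rw [Pi.smul_apply, hPe x hx, MvPolynomial.smul_eval, smul_eq_mul]⟩

/-! ### The Piola push-forward -/

/-- The Piola push-forward `det(DF)⁻¹ DF s` of a parametric field, as a function of the parametric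
point. -/
def pushField (a b : Param d) (F : Param d → Phys d) (s : Param d → Param d) (x : Param d) :
    Phys d :=
  WithLp.toLp 2 ((jac a b F x).det⁻¹ • (jac a b F x).mulVec (s x))

theorem apply_eq_pushField {v : Phys d → Phys d} (hdet : (jac a b F x).det ≠ 0) :
    v (F x) = pushField a b F (piolaPullback a b F v) x := by
  rw [pushField, piolaPullback, Matrix.mulVec_smul, smul_smul, inv_mul_cancel₀ hdet, one_smul,
    Matrix.mulVec_mulVec, Matrix.mul_nonsing_inv _ (isUnit_iff_ne_zero.2 hdet), Matrix.one_mulVec]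

theorem pushField_apply (s : Param d → Param d) (i : Fin d) :
    pushField a b F s x i = (jac a b F x).det⁻¹ * ∑ j, jac a b F x i j * s x j := by
  simp [pushField, Matrix.mulVec, dotProduct]

theorem continuousOn_pushField (hab : ∀ i, a i < b i) (hF : ContDiffOn ℝ 1 F (Icc a b))
    (hdet : ∀ x ∈ Icc a b, (jac a b F x).det ≠ 0) {s : Param d → Param d}
    (hs : ∀ i, ContinuousOn (fun x => s x i) (Icc a b)) :
    ContinuousOn (pushField a b F s) (Icc a b) := by
  refine (PiLp.continuous_toLp 2 _).comp_continuousOn (continuousOn_pi.2 fun i => ?_)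
  have h : ContinuousOn (fun x => (jac a b F x).det⁻¹ * ∑ j, jac a b F x i j * s x j) (Icc a b) :=
    ((continuousOn_jac hab hF).matrix_det.inv₀ hdet).mul
      (continuousOn_finsetSum _ fun j _ => (continuousOn_jac_apply hab hF i j).mul (hs j))
  exact h.congr fun x _ => pushField_apply s i

theorem ContDiffOn.matrix_det {E ι : Type*} [NormedAddCommGroup E] [NormedSpace ℝ E] [Fintype ι]
    [DecidableEq ι] {S : Set E} {n : WithTop ℕ∞} {A : E → Matrix ι ι ℝ}
    (hA : ∀ i j, ContDiffOn ℝ n (fun x => A x i j) S) : ContDiffOn ℝ n (fun x => (A x).det) S := by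
  simp only [Matrix.det_apply']
  exact ContDiffOn.sum fun σ _ => contDiffOn_const.mul (contDiffOn_prod fun i _ => hA _ _)

theorem contDiffOn_jac (h : ∀ i, l i < u i) (hw : ContDiffOn ℝ 2 w (Icc l u)) (i j : Fin d) :
    ContDiffOn ℝ 1 (fun x => jac l u w x i j) (Icc l u) := by
  have h1 : ContDiffOn ℝ 1 (fderivWithin ℝ w (Icc l u)) (Icc l u) :=
    hw.fderivWithin (uniqueDiffOn_Icc_pi h) (by norm_num)
  have h2 : ContDiffOn ℝ 1 (fun x => fderivWithin ℝ w (Icc l u) x (Pi.single j 1)) (Icc l u) :=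
    h1.clm_apply contDiffOn_const
  exact (EuclideanSpace.proj i : Phys d →L[ℝ] ℝ).contDiff.comp_contDiffOn h2

theorem contDiffOn_jac_of_subset (hF : ContDiffOn ℝ 1 F (Icc a b))
    (h : ∀ i, l i < u i) (hsub : Icc l u ⊆ Icc a b) (hF2 : ContDiffOn ℝ 2 F (Icc l u))
    (i j : Fin d) : ContDiffOn ℝ 1 (fun x => jac a b F x i j) (Icc l u) :=
  (contDiffOn_jac h hF2 i j).congr fun x hx => by
    rw [jac_eq_of_subset h hsub ((hF.differentiableOn one_ne_zero) x (hsub hx)) hx]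

/-- The push-forward contains DF, so one more derivative of F is required than of the result. F is
C² only cell by cell when α = 0, hence the restriction to a sub-box. -/
theorem contDiffOn_pushField (hF : ContDiffOn ℝ 1 F (Icc a b))
    (hdet : ∀ x ∈ Icc a b, (jac a b F x).det ≠ 0) (h : ∀ i, l i < u i) (hsub : Icc l u ⊆ Icc a b)
    (hF2 : ContDiffOn ℝ 2 F (Icc l u)) {s : Param d → Param d}
    (hs : ∀ i, ContDiffOn ℝ 1 (fun x => s x i) (Icc l u)) :
    ContDiffOn ℝ 1 (pushField a b F s) (Icc l u) := by
  have hJ := contDiffOn_jac_of_subset hF h hsub hF2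
  rw [contDiffOn_euclidean]
  intro i
  have h1 : ContDiffOn ℝ 1 (fun x => (jac a b F x).det⁻¹ * ∑ j, jac a b F x i j * s x j)
      (Icc l u) :=
    ((ContDiffOn.matrix_det hJ).inv fun x hx => hdet x (hsub hx)).mul
      (ContDiffOn.sum fun j _ => (hJ i j).mul (hs j))
  exact h1.congr fun x _ => pushField_apply s i

/-! ### Finite-dimensional families of polynomial fields on a cell -/

/-- Tuples of polynomials of total degree at most `D`. -/
abbrev PolyTuple (d D : ℕ) : Type := Fin d → MvPolynomial.restrictTotalDegree (Fin d) ℝ D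

/-- The push-forward of a polynomial field. -/
def polyField (a b : Param d) (F : Param d → Phys d) {D : ℕ} (v : PolyTuple d D) :
    Param d → Phys d :=
  pushField a b F fun x i => MvPolynomial.eval x (v i : MvPolynomial (Fin d) ℝ)

theorem MvPolynomial.contDiff_eval (P : MvPolynomial (Fin d) ℝ) {n : WithTop ℕ∞} :
    ContDiff ℝ n fun x : Param d => MvPolynomial.eval x P := by
  induction P using MvPolynomial.induction_on with
  | C r => simpa using contDiff_const
  | add p q hp hq => simpa only [map_add] using hp.add hq
  | mul_X p i hp => simpa only [map_mul, MvPolynomial.eval_X] using hp.mul (contDiff_apply ℝ ℝ i)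

section

variable {D : ℕ}

theorem contDiffOn_polyField (hF : ContDiffOn ℝ 1 F (Icc a b))
    (hdet : ∀ x ∈ Icc a b, (jac a b F x).det ≠ 0) (h : ∀ i, l i < u i) (hsub : Icc l u ⊆ Icc a b)
    (hF2 : ContDiffOn ℝ 2 F (Icc l u)) (v : PolyTuple d D) :
    ContDiffOn ℝ 1 (polyField a b F v) (Icc l u) :=
  contDiffOn_pushField hF hdet h hsub hF2 fun _ => (MvPolynomial.contDiff_eval _).contDiffOn

theorem polyField_add (v v' : PolyTuple d D) :
    polyField a b F (v + v') = polyField a b F v + polyField a b F v' := by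
  ext x i
  simp only [polyField, pushField_apply, Pi.add_apply, PiLp.add_apply, Submodule.coe_add, map_add,
    mul_add, Finset.sum_add_distrib]

theorem polyField_smul (c : ℝ) (v : PolyTuple d D) :
    polyField a b F (c • v) = c • polyField a b F v := by
  ext x i
  simp only [polyField, pushField_apply, Pi.smul_apply, PiLp.smul_apply, Submodule.coe_smul,
    MvPolynomial.smul_eval, smul_eq_mul, Finset.mul_sum]
  exact Finset.sum_congr rfl fun j _ => by ring

theorem jac_add {w' : Param d → Phys d} (h : ∀ i, l i < u i) (hx : x ∈ Icc l u)
    (hw : DifferentiableWithinAt ℝ w (Icc l u) x) (hw' : DifferentiableWithinAt ℝ w' (Icc l u) x) :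
    jac l u (w + w') x = jac l u w x + jac l u w' x := by
  ext i j
  simp [jac, fderivWithin_add (uniqueDiffOn_Icc_pi h x hx) hw hw']

theorem jac_smul (c : ℝ) (h : ∀ i, l i < u i) (hx : x ∈ Icc l u)
    (hw : DifferentiableWithinAt ℝ w (Icc l u) x) :
    jac l u (c • w) x = c • jac l u w x := by
  ext i j
  simp [jac, fderivWithin_const_smul (uniqueDiffOn_Icc_pi h x hx) hw]

theorem pullStrain_add {w' : Param d → Phys d} (h : ∀ i, l i < u i) (hx : x ∈ Icc l u)
    (hw : DifferentiableWithinAt ℝ w (Icc l u) x) (hw' : DifferentiableWithinAt ℝ w' (Icc l u) x) :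
    pullStrain a b F l u (w + w') x = pullStrain a b F l u w x + pullStrain a b F l u w' x := by
  simp only [pullStrain, pullGrad, jac_add h hx hw hw', Matrix.transpose_add, Matrix.mul_add,
    smul_add]
  abel

theorem pullStrain_smul (c : ℝ) (h : ∀ i, l i < u i) (hx : x ∈ Icc l u)
    (hw : DifferentiableWithinAt ℝ w (Icc l u) x) :
    pullStrain a b F l u (c • w) x = c • pullStrain a b F l u w x := by
  simp only [pullStrain, pullGrad, jac_smul c h hx hw, Matrix.transpose_smul, Matrix.mul_smul,
    smul_add, smul_comm c]

theorem pullStrain_polyField_add (hF : ContDiffOn ℝ 1 F (Icc a b))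
    (hdet : ∀ x ∈ Icc a b, (jac a b F x).det ≠ 0) (h : ∀ i, l i < u i) (hsub : Icc l u ⊆ Icc a b)
    (hF2 : ContDiffOn ℝ 2 F (Icc l u)) (v v' : PolyTuple d D) (hx : x ∈ Icc l u) (i j : Fin d) :
    pullStrain a b F l u (polyField a b F (v + v')) x i j =
      pullStrain a b F l u (polyField a b F v) x i j +
        pullStrain a b F l u (polyField a b F v') x i j := by
  have hd := fun v : PolyTuple d D =>
    ((contDiffOn_polyField hF hdet h hsub hF2 v).differentiableOn one_ne_zero) x hx
  rw [polyField_add, pullStrain_add h hx (hd v) (hd v'), Matrix.add_apply]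

theorem pullStrain_polyField_smul (hF : ContDiffOn ℝ 1 F (Icc a b))
    (hdet : ∀ x ∈ Icc a b, (jac a b F x).det ≠ 0) (h : ∀ i, l i < u i) (hsub : Icc l u ⊆ Icc a b)
    (hF2 : ContDiffOn ℝ 2 F (Icc l u)) (c : ℝ) (v : PolyTuple d D) (hx : x ∈ Icc l u)
    (i j : Fin d) :
    pullStrain a b F l u (polyField a b F (c • v)) x i j =
      c * pullStrain a b F l u (polyField a b F v) x i j := by
  have hd := ((contDiffOn_polyField hF hdet h hsub hF2 v).differentiableOn one_ne_zero) x hx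
  rw [polyField_smul, pullStrain_smul c h hx hd, Matrix.smul_apply, smul_eq_mul]

theorem continuousOn_pullStrain_polyField (hab : ∀ i, a i < b i) (hF : ContDiffOn ℝ 1 F (Icc a b))
    (hdet : ∀ x ∈ Icc a b, (jac a b F x).det ≠ 0) (h : ∀ i, l i < u i) (hsub : Icc l u ⊆ Icc a b)
    (hF2 : ContDiffOn ℝ 2 F (Icc l u)) (v : PolyTuple d D) (i j : Fin d) :
    ContinuousOn (fun x => pullStrain a b F l u (polyField a b F v) x i j) (Icc l u) :=
  continuousOn_pi.1 (continuousOn_pi.1 (continuousOn_pullStrain hab hF hdet h hsub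
    (contDiffOn_polyField hF hdet h hsub hF2 v)) i) j

theorem jac_mem_rationalOn (h : ∀ i, l i < u i) (hw : DifferentiableOn ℝ w (Icc l u))
    (hr : ∀ i, (fun x => w x i) ∈ rationalOn (Icc l u)) (i j : Fin d) :
    (fun x => jac l u w x i j) ∈ rationalOn (Icc l u) :=
  rationalOn.congr (rationalOn.fderivWithin_mem (hr i) (uniqueDiffOn_Icc_pi h) j) fun x hx =>
    jac_apply h (hw x hx) hx i j

/-- The strain is built from F and polynomials by derivatives, determinants, inverse matrices, sums
and products, and each of these operations preserves rationality without poles. -/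
theorem pullStrain_polyField_mem_rationalOn (hF : ContDiffOn ℝ 1 F (Icc a b))
    (hdet : ∀ x ∈ Icc a b, (jac a b F x).det ≠ 0) (h : ∀ i, l i < u i) (hsub : Icc l u ⊆ Icc a b)
    (hF2 : ContDiffOn ℝ 2 F (Icc l u)) (hr : ∀ i, (fun x => F x i) ∈ rationalOn (Icc l u))
    (v : PolyTuple d D) (i j : Fin d) :
    (fun x => pullStrain a b F l u (polyField a b F v) x i j) ∈ rationalOn (Icc l u) := by
  have hFd : DifferentiableOn ℝ F (Icc l u) := hF2.differentiableOn two_ne_zero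
  have hA : ∀ i j, (fun x => jac a b F x i j) ∈ rationalOn (Icc l u) := fun i j =>
    rationalOn.congr (jac_mem_rationalOn h hFd hr i j) fun x hx => by
      rw [jac_eq_of_subset h hsub ((hF.differentiableOn one_ne_zero) x (hsub hx)) hx]
  have hdet' : ∀ x ∈ Icc l u, (jac a b F x).det ≠ 0 := fun x hx => hdet x (hsub hx)
  have hw : ∀ i, (fun x => polyField a b F v x i) ∈ rationalOn (Icc l u) := fun i =>
    rationalOn.congr (rationalOn.mul_mem (rationalOn.inv_mem (rationalOn.det_mem hA) hdet')
      (rationalOn.sum_mem Finset.univ fun j _ => rationalOn.mul_mem (hA i j)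
        (rationalOn.eval_mem (v j : MvPolynomial (Fin d) ℝ))))
      fun x _ => pushField_apply _ i
  have hJ := jac_mem_rationalOn h
    ((contDiffOn_polyField hF hdet h hsub hF2 v).differentiableOn one_ne_zero) hw
  have hG : ∀ i j, (fun x => pullGrad a b F l u (polyField a b F v) x i j) ∈
      rationalOn (Icc l u) := fun i j =>
    rationalOn.congr (rationalOn.sum_mem Finset.univ fun k _ =>
      rationalOn.mul_mem (rationalOn.matrix_inv_mem hA hdet' k i) (hJ j k)) fun x _ => by
        simp [pullGrad, Matrix.mul_apply]
  exact rationalOn.congr (rationalOn.mul_mem (rationalOn.const_mem (1 / 2))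
    ((rationalOn (Icc l u)).add_mem (hG i j) (hG j i))) fun x _ => by
      simp [pullStrain]

end

end

noncomputable section

/-! ### Normals and area elements -/

section

variable {d : ℕ} {a b l u : Param d} {F w : Param d → Phys d} {x : Param d}

theorem normalCovector_ne_zero (hdet : (jac a b F x).det ≠ 0) (i : Fin d) :
    normalCovector a b F i x ≠ 0 := by
  intro h
  have h1 : (jac a b F x)⁻¹.transpose.mulVec (Pi.single i 1) = 0 := by
    simpa [normalCovector] using h
  have h2 : ((jac a b F x)⁻¹.transpose).det ≠ 0 := by
    rw [Matrix.det_transpose, Matrix.det_nonsing_inv]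
    simpa using hdet
  have h3 := congrFun (Matrix.eq_zero_of_mulVec_eq_zero h2 h1) i
  simp at h3

theorem norm_unitNormal (hdet : (jac a b F x).det ≠ 0) (i : Fin d) (s : Bool) :
    ‖unitNormal a b F i s x‖ = 1 := by
  have h := norm_ne_zero_iff.2 (normalCovector_ne_zero hdet i)
  rw [unitNormal, norm_smul, norm_smul, norm_inv, norm_norm, inv_mul_cancel₀ h]
  cases s <;> simp

theorem continuousOn_normalCovector (hab : ∀ i, a i < b i) (hF : ContDiffOn ℝ 1 F (Icc a b))
    (hdet : ∀ x ∈ Icc a b, (jac a b F x).det ≠ 0) (i : Fin d) :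
    ContinuousOn (normalCovector a b F i) (Icc a b) := by
  have h1 := (continuousOn_jac hab hF).matrix_inv hdet
  have h2 : Continuous fun A : Matrix (Fin d) (Fin d) ℝ =>
      (WithLp.toLp 2 (A.transpose.mulVec (Pi.single i 1)) : Phys d) :=
    (PiLp.continuous_toLp 2 _).comp
      ((Continuous.matrix_transpose continuous_id).matrix_mulVec continuous_const)
  exact h2.comp_continuousOn h1

theorem continuousOn_unitNormal (hab : ∀ i, a i < b i) (hF : ContDiffOn ℝ 1 F (Icc a b))
    (hdet : ∀ x ∈ Icc a b, (jac a b F x).det ≠ 0) (i : Fin d) (s : Bool) :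
    ContinuousOn (unitNormal a b F i s) (Icc a b) := by
  have h := continuousOn_normalCovector hab hF hdet i
  exact ((h.norm.inv₀ fun x hx =>
    norm_ne_zero_iff.2 (normalCovector_ne_zero (hdet x hx) i)).smul h).const_smul
      (if s then (1 : ℝ) else -1)

theorem continuousOn_areaElement (hab : ∀ i, a i < b i) (hF : ContDiffOn ℝ 1 F (Icc a b))
    (hdet : ∀ x ∈ Icc a b, (jac a b F x).det ≠ 0) (i : Fin d) :
    ContinuousOn (areaElement a b F i) (Icc a b) :=
  (continuousOn_jac hab hF).matrix_det.abs.mul (continuousOn_normalCovector hab hF hdet i).norm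

theorem areaElement_nonneg (i : Fin d) : 0 ≤ areaElement a b F i x := by
  unfold areaElement; positivity

theorem ddot_self_nonneg (S : Matrix (Fin d) (Fin d) ℝ) : 0 ≤ ddot S S :=
  Finset.sum_nonneg fun _ _ => Finset.sum_nonneg fun _ _ => mul_self_nonneg _

/-- Cauchy–Schwarz in every column of `S`. -/
theorem norm_sq_vecMul_le {n : Phys d} (hn : ‖n‖ = 1) (S : Matrix (Fin d) (Fin d) ℝ) :
    ‖(WithLp.toLp 2 (Matrix.vecMul n.ofLp S) : Phys d)‖ ^ 2 ≤ ddot S S := by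
  have h1 : ∑ i, n i ^ 2 = 1 := by
    have := EuclideanSpace.real_norm_sq_eq n
    rw [← this, hn, one_pow]
  rw [EuclideanSpace.real_norm_sq_eq, ddot, Finset.sum_comm]
  refine Finset.sum_le_sum fun j _ => ?_
  have := Finset.sum_mul_sq_le_sq_mul_sq Finset.univ (fun i => n i) fun i => S i j
  rw [h1, one_mul] at this
  simpa [Matrix.vecMul, dotProduct, pow_two] using this

end

namespace ParamMesh

variable {m : ℕ} {a b : Param (m + 1)} {M : ParamMesh a b} {F : Param (m + 1) → Phys (m + 1)}
  {k α : ℕ} {u : Phys (m + 1) → Phys (m + 1)}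

/-! ### Discrete velocities and their strains on an element -/

theorem IsGeometryMap.contDiffOn_one (h : M.IsGeometryMap α F) : ContDiffOn ℝ 1 F (Icc a b) :=
  h.contDiffOn.of_le (by exact_mod_cast Nat.le_add_left 1 α)

theorem IsGeometryMap.contDiffOn_two (h : M.IsGeometryMap α F) (c : M.Cell) :
    ContDiffOn ℝ 2 F (M.closedCell c) :=
  (h.contDiffOn_cell c).of_le (by exact_mod_cast Nat.le_add_left 2 α)

/-- The strain of `u` on a closed element, pulled back to the parametric domain. -/
def cellStrain (M : ParamMesh a b) (F : Param (m + 1) → Phys (m + 1))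
    (u : Phys (m + 1) → Phys (m + 1)) (c : M.Cell) (x : Param (m + 1)) :
    Matrix (Fin (m + 1)) (Fin (m + 1)) ℝ :=
  pullStrain a b F (M.lo c) (M.hi c) (fun y => u (F y)) x

/-- On a cell the discrete field is the push-forward of polynomials, which places it in a fixed
finite-dimensional family. The degree bound counts at most `k + 1` for each of the `m + 1`
directions and is the same for all meshes. -/
theorem exists_eqOn_polyField (h : M.IsGeometryMap α F) (hu : u ∈ M.velocitySpace F k α)
    (c : M.Cell) : ∃ v : PolyTuple (m + 1) ((m + 1) * (k + 1)),
      EqOn (fun y => u (F y)) (polyField a b F v) (M.closedCell c) ∧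
      ∀ x ∈ M.closedCell c, ∀ i, piolaPullback a b F u x i = MvPolynomial.eval x (v i).1 := by
  choose s hs hse using hu.1
  choose P hP hPe using fun i => (tensorSplineSpace_continuousOn_and_polynomial (hs i)).2 c
  have hv : ∀ x ∈ M.closedCell c, ∀ i, piolaPullback a b F u x i = MvPolynomial.eval x (P i) :=
    fun x hx i => by rw [hse i x (M.closedCell_subset c hx), hPe i x hx]
  refine ⟨fun i => ⟨P i, (MvPolynomial.mem_restrictTotalDegree _ _ _).2 ((hP i).trans ?_)⟩,
    fun x hx => ?_, hv⟩
  · calc _ ≤ ∑ _j : Fin (m + 1), (k + 1) := Finset.sum_le_sum fun j _ => by split_ifs <;> omega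
      _ = _ := by simp
  · simp only [apply_eq_pushField (v := u) (h.det_ne_zero x (M.closedCell_subset c hx)), polyField,
      pushField]
    rw [funext (hv x hx)]

theorem contDiffOn_comp (h : M.IsGeometryMap α F) (hu : u ∈ M.velocitySpace F k α)
    (c : M.Cell) : ContDiffOn ℝ 1 (fun y => u (F y)) (M.closedCell c) := by
  obtain ⟨v, hv, -⟩ := exists_eqOn_polyField h hu c
  exact (contDiffOn_polyField h.contDiffOn_one h.det_ne_zero (M.lo_lt_hi c)
    (M.closedCell_subset c) (h.contDiffOn_two c) v).congr hv

theorem continuousOn_piolaPullback (hu : u ∈ M.velocitySpace F k α) (i : Fin (m + 1)) :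
    ContinuousOn (fun x => piolaPullback a b F u x i) (Icc a b) := by
  obtain ⟨s, hs, hse⟩ := hu.1 i
  exact (tensorSplineSpace_continuousOn_and_polynomial hs).1.congr hse

theorem continuousOn_comp (h : M.IsGeometryMap α F) (hu : u ∈ M.velocitySpace F k α) :
    ContinuousOn (fun y => u (F y)) (Icc a b) :=
  (continuousOn_pushField M.left_lt_right h.contDiffOn_one h.det_ne_zero
    (continuousOn_piolaPullback hu)).congr fun x hx => apply_eq_pushField (h.det_ne_zero x hx)

theorem continuousOn_cellStrain (h : M.IsGeometryMap α F) (hu : u ∈ M.velocitySpace F k α)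
    (c : M.Cell) : ContinuousOn (M.cellStrain F u c) (M.closedCell c) :=
  continuousOn_pullStrain M.left_lt_right h.contDiffOn_one h.det_ne_zero (M.lo_lt_hi c)
    (M.closedCell_subset c) (contDiffOn_comp h hu c)

theorem continuousOn_cellStrain_apply (h : M.IsGeometryMap α F) (hu : u ∈ M.velocitySpace F k α)
    (c : M.Cell) (i j : Fin (m + 1)) :
    ContinuousOn (fun x => M.cellStrain F u c x i j) (M.closedCell c) :=
  continuousOn_pi.1 (continuousOn_pi.1 (continuousOn_cellStrain h hu c) i) j

theorem symGrad_eq_cellStrain (h : M.IsGeometryMap α F) (hu : u ∈ M.velocitySpace F k α)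
    (c : M.Cell) {x : Param (m + 1)} (hx : x ∈ M.openCell c) :
    symGrad u (F x) = M.cellStrain F u c x := by
  rw [← M.interior_closedCell] at hx
  have hx' := interior_subset hx
  exact symGrad_eq_pullStrain (M.closedCell_subset c) h.contDiffOn_one hx
    (h.det_ne_zero x (M.closedCell_subset c hx'))
    ((contDiffOn_comp h hu c).differentiableOn one_ne_zero x hx')

/-- Replaces the limit in the definition of the trace by a function continuous on the closed cell,
so that facet integrands are integrable. -/
theorem normalStrain_eq (h : M.IsGeometryMap α F) (hu : u ∈ M.velocitySpace F k α)
    (e : M.Facet) {x : Param (m + 1)} (hx : x ∈ M.closedCell e.1) :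
    M.normalStrain F u e x =
      WithLp.toLp 2 (Matrix.vecMul (M.normal F e x).ofLp (M.cellStrain F u e.1 x)) := by
  rw [normalStrain]
  congr 2
  exact limUnder_symGrad M.left_lt_right h.contDiffOn_one h.injOn h.det_ne_zero (M.lo_lt_hi e.1)
    (M.closedCell_subset e.1) (contDiffOn_comp h hu e.1) hx

theorem continuousOn_normalStrain (h : M.IsGeometryMap α F) (hu : u ∈ M.velocitySpace F k α)
    (e : M.Facet) : ContinuousOn (M.normalStrain F u e) (M.closedCell e.1) := by
  have h1 : ContinuousOn (M.normal F e) (M.closedCell e.1) :=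
    (continuousOn_unitNormal M.left_lt_right h.contDiffOn_one h.det_ne_zero _ _).mono
      (M.closedCell_subset e.1)
  have h2 : Continuous fun p : Phys (m + 1) × Matrix (Fin (m + 1)) (Fin (m + 1)) ℝ =>
      (WithLp.toLp 2 (Matrix.vecMul p.1.ofLp p.2) : Phys (m + 1)) :=
    (PiLp.continuous_toLp 2 _).comp
      (((PiLp.continuous_ofLp 2 _).comp continuous_fst).matrix_vecMul continuous_snd)
  exact (h2.comp_continuousOn (h1.prodMk (continuousOn_cellStrain h hu e.1))).congr
    fun x hx => normalStrain_eq h hu e hx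

/-! ### Facet integrals -/

theorem facetLevel_mem (M : ParamMesh a b) (e : M.Facet) :
    M.facetLevel e ∈ Icc (M.lo e.1 e.2.1) (M.hi e.1 e.2.1) := by
  have := (M.lo_lt_hi e.1 e.2.1).le
  rw [facetLevel]
  split_ifs
  · exact ⟨this, le_rfl⟩
  · exact ⟨le_rfl, this⟩

theorem insertNth_mem_closedCell (M : ParamMesh a b) (e : M.Facet) {y : Fin m → ℝ}
    (hy : y ∈ Icc (fun j => M.lo e.1 (e.2.1.succAbove j)) (fun j => M.hi e.1 (e.2.1.succAbove j))) :
    Fin.insertNth (α := fun _ => ℝ) e.2.1 (M.facetLevel e) y ∈ M.closedCell e.1 :=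
  (insertNth_mem_Icc_iff _).2 ⟨M.facetLevel_mem e, hy⟩

theorem integrableOn_facet (e : M.Facet) {g : Param (m + 1) → ℝ}
    (hg : ContinuousOn g (M.closedCell e.1)) :
    IntegrableOn (fun y => g (Fin.insertNth (α := fun _ => ℝ) e.2.1 (M.facetLevel e) y))
      (Icc (fun j => M.lo e.1 (e.2.1.succAbove j)) (fun j => M.hi e.1 (e.2.1.succAbove j))) :=
  (hg.comp (continuous_insertNth_const _ _).continuousOn
    fun _ hy => M.insertNth_mem_closedCell e hy).integrableOn_compact isCompact_Icc

theorem integrableOn_facet_mul_area (h : M.IsGeometryMap α F) (e : M.Facet)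
    {g : Param (m + 1) → ℝ} (hg : ContinuousOn g (M.closedCell e.1)) :
    IntegrableOn (fun y => g (Fin.insertNth (α := fun _ => ℝ) e.2.1 (M.facetLevel e) y) *
        areaElement a b F e.2.1 (Fin.insertNth (α := fun _ => ℝ) e.2.1 (M.facetLevel e) y))
      (Icc (fun j => M.lo e.1 (e.2.1.succAbove j)) (fun j => M.hi e.1 (e.2.1.succAbove j))) :=
  integrableOn_facet e (g := fun x => g x * areaElement a b F e.2.1 x)
    (hg.mul ((continuousOn_areaElement M.left_lt_right h.contDiffOn_one h.det_ne_zero _).mono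
      (M.closedCell_subset _)))

theorem facetIntegral_nonneg (e : M.Facet) {g : Param (m + 1) → ℝ} (hg : ∀ x, 0 ≤ g x) :
    0 ≤ M.facetIntegral F e g :=
  integral_nonneg fun _ => mul_nonneg (hg _) (areaElement_nonneg _)

theorem facetIntegral_mono (h : M.IsGeometryMap α F) (e : M.Facet) {f g : Param (m + 1) → ℝ}
    (hf : ContinuousOn f (M.closedCell e.1)) (hg : ContinuousOn g (M.closedCell e.1))
    (hfg : ∀ x ∈ M.closedCell e.1, f x ≤ g x) :
    M.facetIntegral F e f ≤ M.facetIntegral F e g :=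
  setIntegral_mono_on (integrableOn_facet_mul_area h e hf) (integrableOn_facet_mul_area h e hg)
    measurableSet_Icc fun _ hy =>
      mul_le_mul_of_nonneg_right (hfg _ (M.insertNth_mem_closedCell e hy)) (areaElement_nonneg _)

theorem facetIntegral_const_mul (e : M.Facet) (c : ℝ) (g : Param (m + 1) → ℝ) :
    M.facetIntegral F e (fun x => c * g x) = c * M.facetIntegral F e g := by
  simp only [facetIntegral, mul_assoc, integral_const_mul]

theorem facetIntegral_add (h : M.IsGeometryMap α F) (e : M.Facet) {f g : Param (m + 1) → ℝ}
    (hf : ContinuousOn f (M.closedCell e.1)) (hg : ContinuousOn g (M.closedCell e.1)) :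
    M.facetIntegral F e (fun x => f x + g x) =
      M.facetIntegral F e f + M.facetIntegral F e g := by
  simp only [facetIntegral, add_mul]
  exact integral_add (integrableOn_facet_mul_area h e hf) (integrableOn_facet_mul_area h e hg)

/-! ### The strain energy, cell by cell -/

/-- The integrand need only be known inside the elements, since gradients of discrete fields may
jump or fail to exist on the interfaces, which are null sets. The functions `f c` are its continuous
extensions to the closed cells. -/
theorem integral_physDomain_eq_sum (h : M.IsGeometryMap α F) {g : Phys (m + 1) → ℝ}
    {f : M.Cell → Param (m + 1) → ℝ} (hf : ∀ c, ContinuousOn (f c) (M.closedCell c))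
    (hgf : ∀ c, ∀ x ∈ M.openCell c, g (F x) = f c x) :
    ∫ y in physDomain a b F, g y =
      ∑ c : M.Cell, ∫ x in M.closedCell c, |(jac a b F x).det| * f c x := by
  have hae : ∀ c : M.Cell, (fun x => |(jac a b F x).det| * g (F x))
      =ᵐ[volume.restrict (M.closedCell c)] fun x => |(jac a b F x).det| * f c x := fun c => by
    rw [← Measure.restrict_congr_set (M.openCell_ae_eq c)]
    have hm : MeasurableSet (M.openCell c) := MeasurableSet.univ_pi fun i => measurableSet_Ioo
    filter_upwards [ae_restrict_mem hm] with x hx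
    rw [hgf c x hx]
  have hJ : ContinuousOn (fun x => |(jac a b F x).det|) (Icc a b) :=
    (continuousOn_jac M.left_lt_right h.contDiffOn_one).matrix_det.abs
  have hint : ∀ c : M.Cell, IntegrableOn (fun x => |(jac a b F x).det| * g (F x))
      (M.closedCell c) := fun c =>
    (integrable_congr (hae c)).2 (((hJ.mono (M.closedCell_subset c)).mul
      (hf c)).integrableOn_compact isCompact_Icc)
  rw [integral_physDomain h.contDiffOn_one h.injOn, (M.integral_eq_sum_closedCell hint).2]
  exact Finset.sum_congr rfl fun c _ => integral_congr_ae (hae c)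

theorem continuousOn_ddot_cellStrain (h : M.IsGeometryMap α F) (hu : u ∈ M.velocitySpace F k α)
    (c : M.Cell) :
    ContinuousOn (fun x => ddot (M.cellStrain F u c x) (M.cellStrain F u c x)) (M.closedCell c) :=
  continuousOn_finsetSum _ fun i _ => continuousOn_finsetSum _ fun j _ =>
    (continuousOn_cellStrain_apply h hu c i j).mul (continuousOn_cellStrain_apply h hu c i j)

theorem strainEnergy_eq_sum (h : M.IsGeometryMap α F) (hu : u ∈ M.velocitySpace F k α) :
    strainEnergy a b F u = ∑ c : M.Cell, ∫ x in M.closedCell c,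
      |(jac a b F x).det| * ddot (M.cellStrain F u c x) (M.cellStrain F u c x) :=
  integral_physDomain_eq_sum h (g := fun y => ddot (symGrad u y) (symGrad u y))
    (continuousOn_ddot_cellStrain h hu)
    fun c x hx => by rw [symGrad_eq_cellStrain h hu c hx]

/-- A trace inequality for the entries of the strain, on the sides of every element, gives a trace
constant. -/
theorem exists_isTraceConstant_of_entries {M₀ : ParamMesh a b} (h₀ : M₀.IsGeometryMap α F) :
    ∃ C : ℝ, 0 < C ∧ ∀ M : ParamMesh a b, M.IsGeometryMap α F → ∀ h : ℝ, 0 < h →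
      ∀ k : ℕ, ∀ C₁ : ℝ, 0 ≤ C₁ →
      (∀ u ∈ M.velocitySpace F k α, ∀ e : M.Facet, ∀ i j,
        ∫ y in Icc (fun j => M.lo e.1 (e.2.1.succAbove j)) (fun j => M.hi e.1 (e.2.1.succAbove j)),
          (M.cellStrain F u e.1
            (Fin.insertNth (α := fun _ => ℝ) e.2.1 (M.facetLevel e) y) i j) ^ 2 ≤
        C₁ * ∫ x in M.closedCell e.1, (M.cellStrain F u e.1 x i j) ^ 2) →
      M.IsTraceConstant F h (M.velocitySpace F k α) (h * (C * C₁)) := by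
  -- The bounds on the Jacobian determinant and on the area elements are taken on the whole box, so
  -- they depend on F and not on the mesh `M` introduced later.
  have hab := M₀.left_lt_right
  obtain ⟨jm, jM, hjm, hjM, hj⟩ := exists_bounds_of_continuousOn isCompact_Icc
    (continuousOn_jac hab h₀.contDiffOn_one).matrix_det.abs
    fun x hx => abs_pos.2 (h₀.det_ne_zero x hx)
  choose am aM ham haM hA using fun i => exists_bounds_of_continuousOn isCompact_Icc
    (continuousOn_areaElement hab h₀.contDiffOn_one h₀.det_ne_zero i)
    fun x hx => mul_pos (abs_pos.2 (h₀.det_ne_zero x hx))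
      (norm_pos_iff.2 (normalCovector_ne_zero (h₀.det_ne_zero x hx) i))
  obtain ⟨A, hApos, hAle⟩ : ∃ A : ℝ, 0 < A ∧ ∀ i, aM i ≤ A :=
    ⟨∑ i, aM i, Finset.sum_pos (fun i _ => haM i) Finset.univ_nonempty,
      fun i => Finset.single_le_sum (fun i _ => (haM i).le) (Finset.mem_univ i)⟩
  -- A bounds the area elements from above, `jm` bounds |det DF| from below, and 2(m + 1) is the
  -- number of sides of a cell.
  refine ⟨2 * (m + 1) * (A / jm), by positivity, fun M hM h hh k C₁ hC₁ H u hu => ?_⟩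
  have hcell : ∀ e : M.Facet, M.facetIntegral F e (fun x => ‖M.normalStrain F u e x‖ ^ 2) ≤
      A / jm * C₁ * ∫ x in M.closedCell e.1,
        |(jac a b F x).det| * ddot (M.cellStrain F u e.1 x) (M.cellStrain F u e.1 x) := by
    intro e
    have hc := fun i j => continuousOn_cellStrain_apply hM hu e.1 i j
    have hface : ∀ i j, IntegrableOn (fun y => (M.cellStrain F u e.1
        (Fin.insertNth (α := fun _ => ℝ) e.2.1 (M.facetLevel e) y) i j) ^ 2)
        (Icc (fun j => M.lo e.1 (e.2.1.succAbove j)) (fun j => M.hi e.1 (e.2.1.succAbove j))) :=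
      fun i j => integrableOn_facet e ((hc i j).pow 2)
    have hbox : ∀ i j, IntegrableOn (fun x => (M.cellStrain F u e.1 x i j) ^ 2)
        (M.closedCell e.1) :=
      fun i j => ((hc i j).pow 2).integrableOn_compact isCompact_Icc
    calc _ ≤ ∫ y in Icc (fun j => M.lo e.1 (e.2.1.succAbove j))
          (fun j => M.hi e.1 (e.2.1.succAbove j)), A * ∑ i, ∑ j, (M.cellStrain F u e.1
            (Fin.insertNth (α := fun _ => ℝ) e.2.1 (M.facetLevel e) y) i j) ^ 2 := by
          refine setIntegral_mono_on (integrableOn_facet_mul_area hM e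
            ((continuousOn_normalStrain hM hu e).norm.pow 2))
            ((integrable_finsetSum _ fun i _ => integrable_finsetSum _ fun j _ =>
              hface i j).const_mul A) measurableSet_Icc fun y hy => ?_
          have hy' := M.insertNth_mem_closedCell e hy
          have hy'' := M.closedCell_subset e.1 hy'
          rw [mul_comm]
          refine mul_le_mul (((hA _ _ hy'').2).trans (hAle _)) ?_ (by positivity) hApos.le
          simp only [normalStrain_eq hM hu e hy']
          refine (norm_sq_vecMul_le (norm_unitNormal (hM.det_ne_zero _ hy'') _ _) _).trans_eq ?_
          simp only [ddot, pow_two]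
      _ = A * ∑ i, ∑ j, ∫ y in Icc (fun j => M.lo e.1 (e.2.1.succAbove j))
          (fun j => M.hi e.1 (e.2.1.succAbove j)), (M.cellStrain F u e.1
            (Fin.insertNth (α := fun _ => ℝ) e.2.1 (M.facetLevel e) y) i j) ^ 2 := by
          rw [integral_const_mul, integral_finsetSum _ fun i _ =>
            integrable_finsetSum _ fun j _ => hface i j]
          congr 1
          exact Finset.sum_congr rfl fun i _ => integral_finsetSum _ fun j _ => hface i j
      _ ≤ A * ∑ i, ∑ j, C₁ * ∫ x in M.closedCell e.1, (M.cellStrain F u e.1 x i j) ^ 2 := by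
          gcongr with i _ j _
          exact H u hu e i j
      _ = A * C₁ * ∫ x in M.closedCell e.1,
            ddot (M.cellStrain F u e.1 x) (M.cellStrain F u e.1 x) := by
          have : ∫ x in M.closedCell e.1, ddot (M.cellStrain F u e.1 x) (M.cellStrain F u e.1 x) =
              ∑ i, ∑ j, ∫ x in M.closedCell e.1, (M.cellStrain F u e.1 x i j) ^ 2 := by
            simp only [ddot, ← pow_two]
            rw [integral_finsetSum _ fun i _ => integrable_finsetSum _ fun j _ => hbox i j]
            exact Finset.sum_congr rfl fun i _ => integral_finsetSum _ fun j _ => hbox i j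
          rw [this]
          simp only [← Finset.mul_sum, mul_assoc]
      _ ≤ A * C₁ * ∫ x in M.closedCell e.1,
            jm⁻¹ * (|(jac a b F x).det| *
              ddot (M.cellStrain F u e.1 x) (M.cellStrain F u e.1 x)) := by
          gcongr ?_ * ?_
          have hdd := continuousOn_ddot_cellStrain hM hu e.1
          refine setIntegral_mono_on (hdd.integrableOn_compact isCompact_Icc)
            ((((((continuousOn_jac hab h₀.contDiffOn_one).matrix_det.abs).mono
              (M.closedCell_subset e.1)).mul hdd).integrableOn_compact isCompact_Icc).const_mul _)
            measurableSet_Icc fun x hx => ?_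
          rw [inv_mul_eq_div, le_div_iff₀ hjm, mul_comm]
          exact mul_le_mul_of_nonneg_right (hj x (M.closedCell_subset e.1 hx)).1
            (ddot_self_nonneg _)
      _ = _ := by rw [integral_const_mul]; field_simp
  -- Summing over all sides of all cells is wasteful but makes the sum factor into cells times
  -- sides.
  calc _ ≤ ∑ e : M.Facet, M.facetIntegral F e (fun x => ‖M.normalStrain F u e x‖ ^ 2) :=
        Finset.sum_le_sum_of_subset_of_nonneg (Finset.subset_univ _)
          fun e _ _ => facetIntegral_nonneg e fun x => by positivity
    _ ≤ ∑ e : M.Facet, A / jm * C₁ * ∫ x in M.closedCell e.1,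
        |(jac a b F x).det| * ddot (M.cellStrain F u e.1 x) (M.cellStrain F u e.1 x) :=
        Finset.sum_le_sum fun e _ => hcell e
    _ = _ := by
        rw [Fintype.sum_prod_type, strainEnergy_eq_sum hM hu, Finset.mul_sum]
        refine Finset.sum_congr rfl fun c _ => ?_
        simp only [Finset.sum_const, Finset.card_univ, Fintype.card_prod, Fintype.card_fin,
          Fintype.card_bool, nsmul_eq_mul]
        push_cast
        field_simp

end ParamMesh

end

noncomputable section

/-! ### Trace constants -/

namespace ParamMesh

variable {m : ℕ} {a b : Param (m + 1)} {F : Param (m + 1) → Phys (m + 1)} {k α : ℕ}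

theorem cellStrain_eq_polyField {M : ParamMesh a b} {u : Phys (m + 1) → Phys (m + 1)} {D : ℕ}
    {c : M.Cell} {v : PolyTuple (m + 1) D}
    (hv : EqOn (fun y => u (F y)) (polyField a b F v) (M.closedCell c)) {x : Param (m + 1)}
    (hx : x ∈ M.closedCell c) :
    M.cellStrain F u c x = pullStrain a b F (M.lo c) (M.hi c) (polyField a b F v) x := by
  simp only [cellStrain, pullStrain, pullGrad, jac_congr hv hx]

/-- On a fixed mesh the supremum bound is enough: the integral over a side is at most its measure
times the supremum over the cell. The constant adds up the finitely many products for all sides and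
entries. -/
theorem exists_trace_entries (M : ParamMesh a b) (hM : M.IsGeometryMap α F) (k : ℕ) :
    ∃ C₁ : ℝ, 0 < C₁ ∧ ∀ u ∈ M.velocitySpace F k α, ∀ e : M.Facet, ∀ i j,
        ∫ y in Icc (fun j => M.lo e.1 (e.2.1.succAbove j)) (fun j => M.hi e.1 (e.2.1.succAbove j)),
          (M.cellStrain F u e.1
            (Fin.insertNth (α := fun _ => ℝ) e.2.1 (M.facetLevel e) y) i j) ^ 2 ≤
        C₁ * ∫ x in M.closedCell e.1, (M.cellStrain F u e.1 x i j) ^ 2 := by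
  have hab := M.left_lt_right
  have hF := hM.contDiffOn_one
  choose K hK H using fun (c : M.Cell) (i j : Fin (m + 1)) =>
    exists_sq_le_integral_Icc (V := PolyTuple (m + 1) ((m + 1) * (k + 1))) (M.lo_lt_hi c)
      (fun v x => pullStrain a b F (M.lo c) (M.hi c) (polyField a b F v) x i j)
      (fun v => continuousOn_pullStrain_polyField hab hF hM.det_ne_zero (M.lo_lt_hi c)
        (M.closedCell_subset c) (hM.contDiffOn_two c) v i j)
      (fun v v' x hx => pullStrain_polyField_add hF hM.det_ne_zero (M.lo_lt_hi c)
        (M.closedCell_subset c) (hM.contDiffOn_two c) v v' hx i j)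
      (fun r v x hx => pullStrain_polyField_smul hF hM.det_ne_zero (M.lo_lt_hi c)
        (M.closedCell_subset c) (hM.contDiffOn_two c) r v hx i j)
  let B : M.Facet × Fin (m + 1) × Fin (m + 1) → ℝ := fun p =>
    volume.real (Icc (fun j => M.lo p.1.1 (p.1.2.1.succAbove j))
      (fun j => M.hi p.1.1 (p.1.2.1.succAbove j))) * K p.1.1 p.2.1 p.2.2
  have hB : ∀ p, 0 ≤ B p := fun p => mul_nonneg measureReal_nonneg (hK _ _ _).le
  refine ⟨1 + ∑ p, B p, by have := Finset.sum_nonneg fun p (_ : p ∈ Finset.univ) => hB p; linarith,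
    fun u hu e i j => ?_⟩
  obtain ⟨v, hv, -⟩ := exists_eqOn_polyField hM hu e.1
  have hI : 0 ≤ ∫ x in M.closedCell e.1, (M.cellStrain F u e.1 x i j) ^ 2 :=
    integral_nonneg fun x => sq_nonneg _
  have hpt : ∀ x ∈ M.closedCell e.1, (M.cellStrain F u e.1 x i j) ^ 2 ≤
      K e.1 i j * ∫ x in M.closedCell e.1, (M.cellStrain F u e.1 x i j) ^ 2 := fun x hx => by
    have h1 := H e.1 i j v x hx
    have h2 : ∫ x in M.closedCell e.1, (M.cellStrain F u e.1 x i j) ^ 2 =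
        ∫ x in Icc (M.lo e.1) (M.hi e.1),
          (pullStrain a b F (M.lo e.1) (M.hi e.1) (polyField a b F v) x i j) ^ 2 :=
      setIntegral_congr_fun measurableSet_Icc fun y hy => by
        simp only [cellStrain_eq_polyField hv hy]
    rw [h2, cellStrain_eq_polyField hv hx]
    exact h1
  calc _ ≤ ∫ y in Icc (fun j => M.lo e.1 (e.2.1.succAbove j))
        (fun j => M.hi e.1 (e.2.1.succAbove j)),
        K e.1 i j * ∫ x in M.closedCell e.1, (M.cellStrain F u e.1 x i j) ^ 2 := by
        refine setIntegral_mono_on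
          (integrableOn_facet e ((continuousOn_cellStrain_apply hM hu e.1 i j).pow 2))
          (integrableOn_const (isCompact_Icc.measure_lt_top).ne) measurableSet_Icc fun y hy => ?_
        exact hpt _ (M.insertNth_mem_closedCell e hy)
    _ = B (e, i, j) * ∫ x in M.closedCell e.1, (M.cellStrain F u e.1 x i j) ^ 2 := by
        rw [setIntegral_const, smul_eq_mul, mul_assoc]
    _ ≤ _ := by
        refine mul_le_mul_of_nonneg_right ?_ hI
        have := Finset.single_le_sum (fun p _ => hB p) (Finset.mem_univ (e, i, j))
        linarith

/-- On a single mesh the size h is only a normalization: the factor h in the constant cancels the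
division by h in `IsTraceConstant`. -/
theorem exists_isTraceConstant (M : ParamMesh a b) (hM : M.IsGeometryMap α F) (k : ℕ) {h : ℝ}
    (hh : 0 < h) : ∃ Ctr : ℝ, 0 < Ctr ∧ M.IsTraceConstant F h (M.velocitySpace F k α) Ctr := by
  obtain ⟨C, hC, H⟩ := exists_isTraceConstant_of_entries hM
  obtain ⟨C₁, hC₁, H₁⟩ := M.exists_trace_entries hM k
  exact ⟨h * (C * C₁), by positivity, H M hM h hh k C₁ hC₁.le H₁⟩

/-! ### Refinements of a rational geometry -/

theorem Refines.exists_closedCell_subset {M M₀ : ParamMesh a b} (hR : M.Refines M₀) (c : M.Cell) :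
    ∃ c₀ : M₀.Cell, M.closedCell c ⊆ M₀.closedCell c₀ := by
  have key : ∀ i, ∃ j : Fin (M₀.n i), M₀.ζ i j.castSucc ≤ M.lo c i ∧ M.hi c i ≤ M₀.ζ i j.succ := by
    intro i
    have hlt := M.lo_lt_hi c i
    have hsub := M.closedCell_subset c
    have hlo := (hsub ⟨le_rfl, fun j => (M.lo_lt_hi c j).le⟩).1 i
    have hhi := (hsub ⟨fun j => (M.lo_lt_hi c j).le, le_rfl⟩).2 i
    -- Any coarse span containing the midpoint of the fine span works: the ends of the coarse span
    -- are knots of the fine mesh, so they cannot lie strictly inside the fine span.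
    obtain ⟨j, hj1, hj2⟩ := exists_mem_span (M₀.n_pos i) (ζ := M₀.ζ i)
      (x := (M.lo c i + M.hi c i) / 2)
      ⟨by rw [M₀.first]; linarith, by rw [M₀.last]; linarith⟩
    refine ⟨j, ?_, ?_⟩
    · obtain ⟨p, hp⟩ := hR i ⟨j.castSucc, rfl⟩
      rw [← hp] at hj1 ⊢
      have h1 : M.ζ i p < M.ζ i (c i).succ := lt_of_le_of_lt hj1 (by
        change _ < M.hi c i; linarith)
      have h2 := (M.strictMono i).lt_iff_lt.1 h1
      exact (M.strictMono i).monotone (Fin.le_castSucc_iff.2 h2)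
    · obtain ⟨p, hp⟩ := hR i ⟨j.succ, rfl⟩
      rw [← hp] at hj2 ⊢
      have h1 : M.ζ i (c i).castSucc < M.ζ i p := lt_of_lt_of_le (by
        change M.lo c i < _; linarith) hj2
      have h2 := (M.strictMono i).lt_iff_lt.1 h1
      exact (M.strictMono i).monotone (Fin.castSucc_lt_iff_succ_le.1 h2)
  choose j hj using key
  exact ⟨j, Icc_subset_Icc (fun i => (hj i).1) (fun i => (hj i).2)⟩

theorem Refines.isGeometryMap {M M₀ : ParamMesh a b} (hR : M.Refines M₀)
    (h₀ : M₀.IsGeometryMap α F) : M.IsGeometryMap α F where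
  contDiffOn := h₀.contDiffOn
  contDiffOn_cell c := by
    obtain ⟨c₀, hc₀⟩ := hR.exists_closedCell_subset c
    exact (h₀.contDiffOn_cell c₀).mono hc₀
  injOn := h₀.injOn
  det_ne_zero := h₀.det_ne_zero

theorem exists_uniform_isTraceConstant (M₀ : ParamMesh a b) (h₀ : M₀.IsGeometryMap α F)
    (hrat : M₀.IsRationalMap F) (k : ℕ) {κ : ℝ} (hκ : 0 < κ) :
    ∃ Ctr : ℝ, 0 < Ctr ∧ ∀ M : ParamMesh a b, M.Refines M₀ → ∀ h : ℝ, 0 < h →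
      M.QuasiUniform F κ h → M.IsTraceConstant F h (M.velocitySpace F k α) Ctr := by
  have hab := M₀.left_lt_right
  have hF := h₀.contDiffOn_one
  have hr : ∀ (c : M₀.Cell) (i : Fin (m + 1)), (fun x => F x i) ∈ rationalOn (M₀.closedCell c) :=
    fun c i => by
      obtain ⟨W, N, H⟩ := hrat c
      exact ⟨N i, W, fun x hx => ⟨(H x hx).1, (H x hx).2 i⟩⟩
  choose K hK H using fun (c : M₀.Cell) (i j : Fin (m + 1)) =>
    exists_rational_trace (V := PolyTuple (m + 1) ((m + 1) * (k + 1)))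
      (fun v x => pullStrain a b F (M₀.lo c) (M₀.hi c) (polyField a b F v) x i j)
      (fun v => pullStrain_polyField_mem_rationalOn hF h₀.det_ne_zero (M₀.lo_lt_hi c)
        (M₀.closedCell_subset c) (h₀.contDiffOn_two c) (hr c) v i j)
      (fun v v' x hx => pullStrain_polyField_add hF h₀.det_ne_zero (M₀.lo_lt_hi c)
        (M₀.closedCell_subset c) (h₀.contDiffOn_two c) v v' hx i j)
      (fun r v x hx => pullStrain_polyField_smul hF h₀.det_ne_zero (M₀.lo_lt_hi c)
        (M₀.closedCell_subset c) (h₀.contDiffOn_two c) r v hx i j)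
  obtain ⟨Kb, hKb, hKle⟩ : ∃ Kb : ℝ, 0 < Kb ∧ ∀ c i j, K c i j ≤ Kb := by
    have h0 : ∀ p : M₀.Cell × Fin (m + 1) × Fin (m + 1), 0 ≤ K p.1 p.2.1 p.2.2 :=
      fun p => (hK _ _ _).le
    refine ⟨1 + ∑ p : M₀.Cell × Fin (m + 1) × Fin (m + 1), K p.1 p.2.1 p.2.2, ?_, fun c i j => ?_⟩
    · have := Finset.sum_nonneg fun p (_ : p ∈ Finset.univ) => h0 p
      linarith
    · have := Finset.single_le_sum (fun p _ => h0 p) (Finset.mem_univ (c, i, j))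
      linarith
  obtain ⟨C, hC, hgeo⟩ := exists_isTraceConstant_of_entries h₀
  obtain ⟨σ, hσ, hside⟩ := exists_side_lower_bound hab hF h₀.injOn h₀.det_ne_zero
  -- The entrywise constant on a cell is Kb divided by the lower bound σκh of the side;
  -- multiplication by h removes the mesh size.
  refine ⟨C * (Kb / (σ * κ)), by positivity, fun M hR h hh hQ => ?_⟩
  have hM := hR.isGeometryMap h₀
  have hmain := hgeo M hM h hh k (Kb / (σ * (κ * h))) (by positivity) ?_
  · convert hmain using 1
    field_simp
  intro u hu e i j
  obtain ⟨c₀, hc₀⟩ := hR.exists_closedCell_subset e.1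
  obtain ⟨v, hv, -⟩ := exists_eqOn_polyField hM hu e.1
  -- The polynomials representing the field on the fine cell define a field on the whole coarse
  -- cell, so the rational family may be fixed once on the coarse cell and used for all fine cells
  -- in it.
  have hE : ∀ x ∈ M.closedCell e.1, M.cellStrain F u e.1 x =
      pullStrain a b F (M₀.lo c₀) (M₀.hi c₀) (polyField a b F v) x := fun x hx => by
    rw [cellStrain_eq_polyField hv hx]
    have hd := ((contDiffOn_polyField hF h₀.det_ne_zero (M₀.lo_lt_hi c₀)
      (M₀.closedCell_subset c₀) (h₀.contDiffOn_two c₀) v).differentiableOn one_ne_zero) x (hc₀ hx)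
    simp only [pullStrain, pullGrad, jac_eq_of_subset (M.lo_lt_hi e.1) hc₀ hd hx]
  have hI : 0 ≤ ∫ x in M.closedCell e.1, (M.cellStrain F u e.1 x i j) ^ 2 :=
    integral_nonneg fun x => sq_nonneg _
  have hT := H c₀ i j v (M.lo e.1) (M.hi e.1) (M.lo_lt_hi e.1) hc₀ e.2.1 (M.facetLevel e)
    (M.facetLevel_mem e)
  have h1 : ∫ x in M.closedCell e.1, (M.cellStrain F u e.1 x i j) ^ 2 =
      ∫ x in Icc (M.lo e.1) (M.hi e.1),
        (pullStrain a b F (M₀.lo c₀) (M₀.hi c₀) (polyField a b F v) x i j) ^ 2 :=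
    setIntegral_congr_fun measurableSet_Icc fun y hy => by simp only [hE y hy]
  have h2 : ∫ y in Icc (fun j => M.lo e.1 (e.2.1.succAbove j))
        (fun j => M.hi e.1 (e.2.1.succAbove j)),
      (M.cellStrain F u e.1
        (Fin.insertNth (α := fun _ => ℝ) e.2.1 (M.facetLevel e) y) i j) ^ 2 =
      ∫ y in Icc (fun j => M.lo e.1 (e.2.1.succAbove j)) (fun j => M.hi e.1 (e.2.1.succAbove j)),
      (pullStrain a b F (M₀.lo c₀) (M₀.hi c₀) (polyField a b F v)
        (Fin.insertNth (α := fun _ => ℝ) e.2.1 (M.facetLevel e) y) i j) ^ 2 :=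
    setIntegral_congr_fun measurableSet_Icc fun y hy => by
      simp only [hE _ (M.insertNth_mem_closedCell e hy)]
  rw [h2]
  refine hT.trans ?_
  rw [← h1]
  refine mul_le_mul_of_nonneg_right ?_ hI
  have hs := hside (M.lo e.1) (M.hi e.1) (M.closedCell_subset e.1) (κ * h) (by positivity)
    (hQ e.1).2.2 e.2.1
  exact div_le_div₀ hKb.le (hKle _ _ _) (by positivity) hs

end ParamMesh

end

noncomputable section

/-! ### The Piola identity -/

/-- det(1 + tB) = 1 + t tr B + t² q(t) for a polynomial q. -/
theorem Matrix.hasDerivAt_det_one_add_smul {ι : Type*} [Fintype ι] [DecidableEq ι]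
    (B : Matrix ι ι ℝ) : HasDerivAt (fun t : ℝ => (1 + t • B).det) B.trace 0 := by
  rw [funext fun t : ℝ => Matrix.det_one_add_smul t B]
  have h1 : HasDerivAt (fun t : ℝ => 1 + B.trace * t) B.trace 0 := by
    simpa using ((hasDerivAt_id (0 : ℝ)).const_mul B.trace).const_add 1
  have h2 := ((Matrix.det (1 + (Polynomial.X : Polynomial ℝ) • B.map Polynomial.C)).divX.divX.hasDerivAt
    (0 : ℝ)).fun_mul ((hasDerivAt_id (0 : ℝ)).fun_pow 2)
  simpa using h1.fun_add h2

/-- Jacobi's formula for the derivative of a determinant. -/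
theorem hasFDerivAt_matrix_det {E ι : Type*} [NormedAddCommGroup E] [NormedSpace ℝ E] [Fintype ι]
    [DecidableEq ι] {A : E → Matrix ι ι ℝ} {A' : ι → ι → E →L[ℝ] ℝ} {x : E}
    (hA : ∀ i j, HasFDerivAt (fun y => A y i j) (A' i j) x) (h0 : (A x).det ≠ 0) :
    HasFDerivAt (fun y => (A y).det) (∑ i, ∑ j, ((A x).det * (A x)⁻¹ j i) • A' i j) x := by
  let f : (ι → ι → ℝ) → ℝ := fun B => (Matrix.of B).det
  have hf : Differentiable ℝ f := by
    simp only [f, Matrix.det_apply', Matrix.of_apply]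
    fun_prop
  let A₀ : ι → ι → ℝ := A x
  -- The determinant is a polynomial in the entries and hence differentiable, so its derivative can
  -- be read off along lines, where A + tH = A (1 + t A⁻¹ H).
  have hf' : ∀ H : ι → ι → ℝ, fderiv ℝ f A₀ H = (A x).det * ((A x)⁻¹ * Matrix.of H).trace := by
    intro H
    have h1 : HasDerivAt (fun t : ℝ => A₀ + t • H) H 0 := by
      simpa using ((hasDerivAt_id (0 : ℝ)).smul_const H).const_add A₀
    have h2 : HasDerivAt (fun t : ℝ => f (A₀ + t • H)) (fderiv ℝ f A₀ H) 0 := by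
      have h3 : HasFDerivAt f (fderiv ℝ f A₀) (A₀ + (0 : ℝ) • H) := by
        rw [zero_smul, add_zero]; exact (hf _).hasFDerivAt
      exact h3.comp_hasDerivAt 0 h1
    have h4 := (Matrix.hasDerivAt_det_one_add_smul ((A x)⁻¹ * Matrix.of H)).const_mul (A x).det
    refine h2.unique (h4.congr_of_eventuallyEq (Eventually.of_forall fun t => ?_))
    change (A x + t • Matrix.of H).det = (A x).det * (1 + t • ((A x)⁻¹ * Matrix.of H)).det
    rw [← Matrix.det_mul, Matrix.mul_add, Matrix.mul_one, Matrix.mul_smul, ← Matrix.mul_assoc,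
      Matrix.mul_nonsing_inv _ (isUnit_iff_ne_zero.2 h0), Matrix.one_mul]
  have hA' : HasFDerivAt (fun y => (A y : ι → ι → ℝ))
      (ContinuousLinearMap.pi fun i => ContinuousLinearMap.pi fun j => A' i j) x :=
    hasFDerivAt_pi.2 fun i => hasFDerivAt_pi.2 fun j => hA i j
  have h := (hf A₀).hasFDerivAt.comp x hA'
  refine HasFDerivAt.congr_fderiv h ?_
  ext v
  rw [ContinuousLinearMap.comp_apply, hf']
  simp only [Matrix.trace, Matrix.diag, Matrix.mul_apply, Matrix.of_apply,
    ContinuousLinearMap.coe_pi', sum_apply, smul_apply, smul_eq_mul, Finset.mul_sum]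
  rw [Finset.sum_comm]
  exact Finset.sum_congr rfl fun i _ => Finset.sum_congr rfl fun j _ => by ring

/-- The algebra behind the Piola identity: `dA l`, `dw l`, `ds l` are the partial derivatives in
direction `l` of `A`, `w`, `s`, where `A s = det A • w` and `A` is a Jacobian matrix. -/
theorem piola_identity_algebra {ι : Type*} [Fintype ι] [DecidableEq ι] (A : Matrix ι ι ℝ)
    (h0 : A.det ≠ 0) (w s : ι → ℝ) (hws : A.mulVec s = A.det • w) (dA : ι → ι → ι → ℝ)
    (hsymm : ∀ l i j, dA l i j = dA j i l) (dw ds : ι → ι → ℝ)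
    (hd : ∀ l i, (∑ p, ∑ q, A.det * A⁻¹ q p * dA l p q) * w i + A.det * dw l i =
      ∑ j, (dA l i j * s j + A i j * ds l j)) :
    ∑ i, ∑ l, A⁻¹ l i * dw l i = A.det⁻¹ * ∑ l, ds l l := by
  have hinv : A⁻¹ * A = 1 := Matrix.nonsing_inv_mul _ (isUnit_iff_ne_zero.2 h0)
  have hw : ∀ l, A.det * ∑ i, A⁻¹ l i * w i = s l := fun l => by
    have h1 : A⁻¹.mulVec (A.mulVec s) = s := by
      rw [Matrix.mulVec_mulVec, hinv, Matrix.one_mulVec]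
    rw [hws, Matrix.mulVec_smul] at h1
    have := congrFun h1 l
    simpa [Matrix.mulVec, dotProduct] using this
  have h1 : A.det * ∑ l, ∑ i, A⁻¹ l i * dw l i =
      ∑ l, ∑ i, A⁻¹ l i * ∑ j, (dA l i j * s j + A i j * ds l j) -
      ∑ l, ∑ i, A⁻¹ l i * ((∑ p, ∑ q, A.det * A⁻¹ q p * dA l p q) * w i) := by
    rw [Finset.mul_sum, ← Finset.sum_sub_distrib]
    refine Finset.sum_congr rfl fun l _ => ?_
    rw [Finset.mul_sum, ← Finset.sum_sub_distrib]
    refine Finset.sum_congr rfl fun i _ => ?_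
    rw [← hd l i]; ring
  have h2 : ∑ l, ∑ i, A⁻¹ l i * ∑ j, A i j * ds l j = ∑ l, ds l l := by
    refine Finset.sum_congr rfl fun l _ => ?_
    simp only [Finset.mul_sum]
    rw [Finset.sum_comm]
    have : ∀ j, ∑ i, A⁻¹ l i * (A i j * ds l j) = (1 : Matrix ι ι ℝ) l j * ds l j := fun j => by
      rw [← hinv, Matrix.mul_apply, Finset.sum_mul]
      exact Finset.sum_congr rfl fun i _ => by ring
    simp only [this, Matrix.one_apply, ite_mul, one_mul, zero_mul, Finset.sum_ite_eq,
      Finset.mem_univ, if_true]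
  -- The contribution of the derivative of det A, with A⁻¹ w replaced by s / det A.
  have h3 : ∑ l, ∑ i, A⁻¹ l i * ((∑ p, ∑ q, A.det * A⁻¹ q p * dA l p q) * w i) =
      ∑ l, (∑ p, ∑ q, A⁻¹ q p * dA l p q) * s l := by
    refine Finset.sum_congr rfl fun l _ => ?_
    rw [← hw l]
    simp only [Finset.mul_sum, Finset.sum_mul]
    refine Finset.sum_congr rfl fun i _ => Finset.sum_congr rfl fun p _ =>
      Finset.sum_congr rfl fun q _ => by ring
  -- The contribution of the derivative of A. Symmetry of the second derivatives of F exchanges the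
  -- differentiation index with the column index, and the result is the same expression as before;
  -- the two cancel, and only the divergence of s survives.
  have h4 : ∑ l, ∑ i, A⁻¹ l i * ∑ j, dA l i j * s j =
      ∑ l, (∑ p, ∑ q, A⁻¹ q p * dA l p q) * s l := by
    simp only [Finset.mul_sum, Finset.sum_mul]
    have : ∀ l, ∑ i, ∑ j, A⁻¹ l i * (dA l i j * s j) = ∑ j, ∑ i, A⁻¹ l i * (dA j i l * s j) :=
      fun l => by
        rw [Finset.sum_comm]
        exact Finset.sum_congr rfl fun j _ => Finset.sum_congr rfl fun i _ => by rw [hsymm l i j]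
    simp only [this]
    rw [Finset.sum_comm]
    refine Finset.sum_congr rfl fun j _ => ?_
    rw [Finset.sum_comm]
    exact Finset.sum_congr rfl fun p _ => Finset.sum_congr rfl fun q _ => by ring
  simp only [Finset.sum_add_distrib, mul_add, h2, h3, h4] at h1
  rw [Finset.sum_comm, eq_inv_mul_iff_mul_eq₀ h0, h1]
  ring

namespace ParamMesh

variable {m : ℕ} {a b : Param (m + 1)} {M : ParamMesh a b} {F : Param (m + 1) → Phys (m + 1)}
  {k α : ℕ} {u : Phys (m + 1) → Phys (m + 1)}

theorem contDiffOn_piolaPullback (h : M.IsGeometryMap α F) (hu : u ∈ M.velocitySpace F k α)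
    (c : M.Cell) (i : Fin (m + 1)) :
    ContDiffOn ℝ 1 (fun x => piolaPullback a b F u x i) (M.closedCell c) := by
  obtain ⟨v, -, hv⟩ := exists_eqOn_polyField h hu c
  exact (MvPolynomial.contDiff_eval (v i).1).contDiffOn.congr fun x hx => hv x hx i

theorem closedCell_mem_nhds {c : M.Cell} {x : Param (m + 1)} (hx : x ∈ M.openCell c) :
    M.closedCell c ∈ 𝓝 x := by
  rw [← M.interior_closedCell] at hx
  exact mem_interior_iff_mem_nhds.1 hx

theorem openCell_subset (c : M.Cell) : M.openCell c ⊆ M.closedCell c := by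
  rw [← M.interior_closedCell]; exact interior_subset

theorem vgrad_eq (h : M.IsGeometryMap α F) (hu : u ∈ M.velocitySpace F k α)
    {c : M.Cell} {x : Param (m + 1)} (hx : x ∈ M.openCell c) (i j : Fin (m + 1)) :
    vgrad u (F x) i j = ∑ l, (jac a b F x)⁻¹ l i *
      fderiv ℝ (fun y => u (F y) j) x (Pi.single l 1) := by
  have hx' := M.openCell_subset c hx
  have hd := (contDiffOn_comp h hu c).differentiableOn one_ne_zero x hx'
  rw [(vgrad_eq_pullGrad (M.closedCell_subset c) h.contDiffOn_one
    (by rw [← M.interior_closedCell] at hx; exact hx)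
    (h.det_ne_zero x (M.closedCell_subset c hx')) hd).2, pullGrad, Matrix.mul_apply]
  refine Finset.sum_congr rfl fun l _ => ?_
  rw [Matrix.transpose_apply, Matrix.transpose_apply, jac_apply (M.lo_lt_hi c) hd hx']
  have := fderivWithin_of_mem_nhds (𝕜 := ℝ) (f := fun y => u (F y) j) (closedCell_mem_nhds hx)
  rw [closedCell] at this
  rw [this]

/-- The Piola identity: the divergence of a velocity field is, up to the Jacobian determinant,
the parametric divergence of its Piola pullback. -/
theorem vdiv_eq (h : M.IsGeometryMap α F) (hu : u ∈ M.velocitySpace F k α)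
    {c : M.Cell} {x : Param (m + 1)} (hx : x ∈ M.openCell c) :
    vdiv u (F x) = (jac a b F x).det⁻¹ *
      ∑ l, fderiv ℝ (fun y => piolaPullback a b F u y l) x (Pi.single l 1) := by
  have hx' := M.openCell_subset c hx
  have hnhds := closedCell_mem_nhds hx
  have hnhds' : Icc a b ∈ 𝓝 x := mem_of_superset hnhds (M.closedCell_subset c)
  have h0 := h.det_ne_zero x (mem_of_mem_nhds hnhds')
  have hA : ∀ i j, HasFDerivAt (fun y => jac a b F y i j)
      (fderiv ℝ (fun y => jac a b F y i j) x) x := fun i j =>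
    (((contDiffOn_jac_of_subset h.contDiffOn_one (M.lo_lt_hi c) (M.closedCell_subset c)
      (h.contDiffOn_two c) i j).contDiffAt hnhds).differentiableAt one_ne_zero).hasFDerivAt
  have hJ := hasFDerivAt_matrix_det hA h0
  have hw : ∀ i, HasFDerivAt (fun y => u (F y) i) (fderiv ℝ (fun y => u (F y) i) x) x := fun i =>
    (((contDiffOn_euclidean.1 (contDiffOn_comp h hu c) i).contDiffAt hnhds).differentiableAt
      one_ne_zero).hasFDerivAt
  have hs : ∀ j, HasFDerivAt (fun y => piolaPullback a b F u y j)
      (fderiv ℝ (fun y => piolaPullback a b F u y j) x) x := fun j =>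
    (((contDiffOn_piolaPullback h hu c j).contDiffAt hnhds).differentiableAt
      one_ne_zero).hasFDerivAt
  have hrel : ∀ y ∈ Icc a b, ∀ i, (jac a b F y).det * u (F y) i =
      ∑ j, jac a b F y i j * piolaPullback a b F u y j := fun y hy i => by
    rw [apply_eq_pushField (v := u) (h.det_ne_zero y hy), pushField_apply,
      mul_inv_cancel_left₀ (h.det_ne_zero y hy)]
  -- Near x the entries of the Jacobian are first derivatives of F, which is C² in the open cell, so
  -- mixed second derivatives commute.
  have hsymm : ∀ l i j, fderiv ℝ (fun y => jac a b F y i j) x (Pi.single l 1) =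
      fderiv ℝ (fun y => jac a b F y i l) x (Pi.single j 1) := by
    have hF2 : ContDiffAt ℝ 2 F x := (h.contDiffOn_two c).contDiffAt hnhds
    have hF1 : HasFDerivAt (fderiv ℝ F) (fderiv ℝ (fderiv ℝ F) x) x :=
      ((hF2.fderiv_right (m := 1) (by norm_num)).differentiableAt one_ne_zero).hasFDerivAt
    have hform : ∀ l i j, fderiv ℝ (fun y => jac a b F y i j) x (Pi.single l 1) =
        (fderiv ℝ (fderiv ℝ F) x (Pi.single l 1) (Pi.single j 1)) i := by
      intro l i j
      have hint : ∀ᶠ y in 𝓝 x, Icc a b ∈ 𝓝 y := eventually_mem_nhds_iff.2 hnhds'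
      have he : (fun y => jac a b F y i j) =ᶠ[𝓝 x]
          fun y => (EuclideanSpace.proj i : Phys (m + 1) →L[ℝ] ℝ) (fderiv ℝ F y (Pi.single j 1)) := by
        filter_upwards [hint] with y hy
        simp only [jac, Matrix.of_apply, fderivWithin_of_mem_nhds hy]
        rfl
      rw [he.fderiv_eq]
      have h1 := hF1.clm_apply (hasFDerivAt_const (Pi.single j (1 : ℝ) : Param (m + 1)) x)
      have h2 := (EuclideanSpace.proj i : Phys (m + 1) →L[ℝ] ℝ).hasFDerivAt.comp x h1
      have h3 : fderiv ℝ (fun y => (EuclideanSpace.proj i : Phys (m + 1) →L[ℝ] ℝ)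
          (fderiv ℝ F y (Pi.single j 1))) x = _ := h2.fderiv
      rw [h3]
      simp
    intro l i j
    rw [hform, hform, (hF2.isSymmSndFDerivAt (by simp)).eq]
  have halg := piola_identity_algebra (jac a b F x) h0 (fun i => u (F x) i)
    (piolaPullback a b F u x) (by
      ext i
      rw [Pi.smul_apply, smul_eq_mul, hrel x (mem_of_mem_nhds hnhds') i]
      rfl)
    (fun l i j => fderiv ℝ (fun y => jac a b F y i j) x (Pi.single l 1)) hsymm
    (fun l i => fderiv ℝ (fun y => u (F y) i) x (Pi.single l 1))
    (fun l j => fderiv ℝ (fun y => piolaPullback a b F u y j) x (Pi.single l 1)) (by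
      intro l i
      have h1 := hJ.fun_mul (hw i)
      have h2 : HasFDerivAt (fun y => ∑ j, jac a b F y i j * piolaPullback a b F u y j) _ x :=
        HasFDerivAt.fun_sum fun j (_ : j ∈ Finset.univ) => (hA i j).fun_mul (hs j)
      have h3 : (fun y => (jac a b F y).det * u (F y) i) =ᶠ[𝓝 x]
          fun y => ∑ j, jac a b F y i j * piolaPullback a b F u y j := by
        filter_upwards [hnhds'] with y hy
        exact hrel y hy i
      have h4 := (h1.congr_of_eventuallyEq h3.symm).unique h2
      have h5 := congrArg (fun L => L (Pi.single l 1)) h4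
      simp only [add_apply, smul_apply, sum_apply, smul_eq_mul] at h5
      rw [add_comm, mul_comm (∑ p, _) _]
      refine h5.trans (Finset.sum_congr rfl fun j _ => ?_)
      ring)
  rw [vdiv, Matrix.trace]
  simp only [Matrix.diag, vgrad_eq h hu hx]
  exact halg

end ParamMesh

end

noncomputable section

/-! ### The convective term vanishes -/

/-- Intermediate value theorem. It is applied to det DF, so that |det DF| det(DF)⁻¹ is one constant
over the whole box and the integrals of all cells carry the same sign. -/
theorem exists_sign_of_continuousOn {X : Type*} [TopologicalSpace X] {S : Set X}
    (hS : IsPreconnected S) {f : X → ℝ} (hf : ContinuousOn f S) (h0 : ∀ x ∈ S, f x ≠ 0) :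
    ∃ σ : ℝ, ∀ x ∈ S, |f x| = σ * f x := by
  by_cases hpos : ∃ x ∈ S, 0 < f x
  · obtain ⟨x, hx, hfx⟩ := hpos
    refine ⟨1, fun y hy => ?_⟩
    rw [one_mul, abs_of_nonneg]
    by_contra! hfy
    obtain ⟨z, hz, hfz⟩ := hS.intermediate_value hy hx hf ⟨hfy.le, hfx.le⟩
    exact h0 z hz hfz
  · push Not at hpos
    exact ⟨-1, fun y hy => by rw [abs_of_nonpos (hpos y hy)]; ring⟩

namespace ParamMesh

variable {m : ℕ} {a b : Param (m + 1)} {M : ParamMesh a b} {F : Param (m + 1) → Phys (m + 1)}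
  {k α : ℕ} {u : Phys (m + 1) → Phys (m + 1)}

theorem exists_mem_openCell {x : Param (m + 1)} (hx : x ∈ Icc a b)
    (hne : ∀ i p, x i ≠ M.ζ i p) : ∃ c : M.Cell, x ∈ M.openCell c := by
  rw [← M.iUnion_closedCell] at hx
  obtain ⟨c, hc⟩ := mem_iUnion.1 hx
  exact ⟨c, fun i _ => ⟨(hc.1 i).lt_of_ne (hne i _).symm, (hc.2 i).lt_of_ne (hne i _)⟩⟩

/-- The integral of a partial derivative of a continuous, piecewise `C¹` function which vanishes on
the two sides of the box in that direction. -/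
theorem sum_integral_partial_eq_zero (M : ParamMesh a b) (l : Fin (m + 1))
    {g : Param (m + 1) → ℝ} (hc : ContinuousOn g (Icc a b))
    (hd : ∀ c : M.Cell, ContDiffOn ℝ 1 g (M.closedCell c))
    (h0 : ∀ x ∈ Icc a b, x l = a l ∨ x l = b l → g x = 0) :
    ∑ c : M.Cell, ∫ x in M.closedCell c,
      fderivWithin ℝ g (M.closedCell c) x (Pi.single l 1) = 0 := by
  let D : Param (m + 1) → ℝ := fun x => fderiv ℝ g x (Pi.single l 1)
  have hae : ∀ c : M.Cell, (fun x => fderivWithin ℝ g (M.closedCell c) x (Pi.single l 1))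
      =ᵐ[volume.restrict (M.closedCell c)] D := fun c => by
    rw [← Measure.restrict_congr_set (M.openCell_ae_eq c)]
    have hm : MeasurableSet (M.openCell c) := MeasurableSet.univ_pi fun i => measurableSet_Ioo
    filter_upwards [ae_restrict_mem hm] with x hx
    simp only [D, fderivWithin_of_mem_nhds (closedCell_mem_nhds hx)]
  have hint : ∀ c : M.Cell, IntegrableOn D (M.closedCell c) := fun c => by
    refine (integrable_congr (hae c)).1 ?_
    have h1 := (hd c).continuousOn_fderivWithin (uniqueDiffOn_Icc_pi (M.lo_lt_hi c)) le_rfl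
    exact (h1.clm_apply continuousOn_const).integrableOn_compact isCompact_Icc
  obtain ⟨hI, hsum⟩ := M.integral_eq_sum_closedCell hint
  rw [Finset.sum_congr rfl fun c _ => integral_congr_ae (hae c), ← hsum]
  obtain ⟨-, hslice, hfub⟩ := integral_Icc_insertNth l hI
  rw [hfub]
  refine integral_eq_zero_of_ae ?_
  -- Almost every line in direction l avoids the knot hyperplanes of the other directions. It then
  -- crosses cell interfaces only at knots of direction l, a finite set of exceptions that the
  -- fundamental theorem of calculus tolerates for a continuous function.
  have hknot : ∀ᵐ y : Fin m → ℝ, ∀ j, ∀ p, y j ≠ M.ζ (l.succAbove j) p :=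
    ae_all_iff.2 fun j => ae_all_iff.2 fun p =>
      Measure.ae_eval_ne (μ := fun _ : Fin m => (volume : Measure ℝ)) j _
  filter_upwards [hslice, ae_restrict_of_ae hknot, ae_restrict_mem measurableSet_Icc]
    with y hy hyk hymem
  have hle : a l ≤ b l := (M.left_lt_right l).le
  have hmem : ∀ t ∈ Icc (a l) (b l), Fin.insertNth (α := fun _ => ℝ) l t y ∈ Icc a b :=
    fun t ht => (insertNth_mem_Icc_iff l).2 ⟨ht, hymem⟩
  have hcont : Continuous fun t : ℝ => Fin.insertNth (α := fun _ => ℝ) l t y :=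
    Continuous.finInsertNth (A := fun _ => ℝ) l continuous_id continuous_const
  have hftc := integral_eq_of_hasDerivAt_off_countable_of_le
    (fun t => g (Fin.insertNth (α := fun _ => ℝ) l t y))
    (fun t => D (Fin.insertNth (α := fun _ => ℝ) l t y)) hle
    (s := range (M.ζ l)) (countable_range _) (hc.comp hcont.continuousOn hmem) (by
      rintro t ⟨ht, htk⟩
      obtain ⟨c, hcx⟩ := exists_mem_openCell (M := M) (hmem t ⟨ht.1.le, ht.2.le⟩) (by
        intro i
        refine Fin.succAboveCases l (fun p h => ?_) (fun j p h => ?_) i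
        · rw [Fin.insertNth_apply_same] at h; exact htk ⟨p, h.symm⟩
        · rw [Fin.insertNth_apply_succAbove] at h; exact hyk j p h)
      have h1 := (((hd c).contDiffAt (closedCell_mem_nhds hcx)).differentiableAt
        one_ne_zero).hasFDerivAt
      have h2 : HasDerivAt (fun t : ℝ => Fin.insertNth (α := fun _ => ℝ) l t y)
          (Pi.single l (1 : ℝ)) t := by
        have := hasDerivAt_update (Fin.insertNth (α := fun _ => ℝ) l t y) l t
        refine this.congr_of_eventuallyEq (Eventually.of_forall fun s => ?_)
        exact (Fin.update_insertNth (α := fun _ => ℝ) l t s y).symm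
      exact h1.comp_hasDerivAt t h2)
    ((intervalIntegrable_iff_integrableOn_Icc_of_le hle).2 hy)
  rw [intervalIntegral.integral_of_le hle, ← integral_Icc_eq_integral_Ioc] at hftc
  rw [hftc, h0 _ (hmem _ (right_mem_Icc.2 hle)) (Or.inr (Fin.insertNth_apply_same ..)),
    h0 _ (hmem _ (left_mem_Icc.2 hle)) (Or.inl (Fin.insertNth_apply_same ..))]
  simp

/-- The normal is parallel to DF⁻ᵀ e_l, so u · n is a multiple of component l of DF⁻¹ u, which is
the Piola component up to the determinant. -/
theorem piolaPullback_eq_zero_of_mem_boundary (h : M.IsGeometryMap α F)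
    (hu : u ∈ M.velocitySpace F k α) (l : Fin (m + 1)) {x : Param (m + 1)} (hx : x ∈ Icc a b)
    (hb : x l = a l ∨ x l = b l) : piolaPullback a b F u x l = 0 := by
  obtain ⟨e, he, hel, hxe, hxl⟩ : ∃ e ∈ M.boundaryFacets, e.2.1 = l ∧ x ∈ M.closedCell e.1 ∧
      x e.2.1 = M.facetLevel e := by
    have hx' := hx
    rw [← M.iUnion_closedCell] at hx'
    obtain ⟨c, hc⟩ := mem_iUnion.1 hx'
    have hn := M.n_pos l
    rcases hb with hb | hb
    · have hz : M.ζ l (⟨0, hn⟩ : Fin (M.n l)).castSucc = a l := by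
        rw [← M.first l]; rfl
      -- A cell containing x need not be the one whose boundary facet is wanted: x may also lie on
      -- other interfaces. Moving it to the extreme span in direction l gives a cell that still
      -- contains x and has a boundary facet through it.
      refine ⟨(Function.update c l ⟨0, hn⟩, l, false), ?_, rfl, ?_, ?_⟩
      · simp [boundaryFacets]
      · refine ⟨fun i => ?_, fun i => ?_⟩ <;> rcases eq_or_ne i l with rfl | hi
        · simp only [lo, Function.update_self, hz]; exact hx.1 i
        · simpa only [lo, Function.update_of_ne hi] using hc.1 i
        · simp only [ParamMesh.hi, Function.update_self]
          rw [hb, ← hz]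
          exact (M.strictMono i Fin.castSucc_lt_succ).le
        · simpa only [ParamMesh.hi, Function.update_of_ne hi] using hc.2 i
      · simp only [facetLevel, lo, Function.update_self, hz, hb]; simp
    · have hz : M.ζ l (⟨M.n l - 1, by omega⟩ : Fin (M.n l)).succ = b l := by
        rw [← M.last l]; congr 1; ext; simp; omega
      refine ⟨(Function.update c l ⟨M.n l - 1, by omega⟩, l, true), ?_, rfl, ?_, ?_⟩
      · simp [boundaryFacets]; omega
      · refine ⟨fun i => ?_, fun i => ?_⟩ <;> rcases eq_or_ne i l with rfl | hi
        · simp only [lo, Function.update_self]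
          rw [hb, ← hz]
          exact (M.strictMono i Fin.castSucc_lt_succ).le
        · simpa only [lo, Function.update_of_ne hi] using hc.1 i
        · simp only [ParamMesh.hi, Function.update_self, hz]; exact hx.2 i
        · simpa only [ParamMesh.hi, Function.update_of_ne hi] using hc.2 i
      · simp only [facetLevel, ParamMesh.hi, Function.update_self, hz, hb]; simp
  have hin := hu.2 e he x hxe hxl
  have hne := norm_ne_zero_iff.2 (normalCovector_ne_zero (h.det_ne_zero x hx) e.2.1)
  rw [normal, unitNormal, inner_smul_right, inner_smul_right] at hin
  have h1 : inner ℝ (u (F x)) (normalCovector a b F e.2.1 x) = 0 := by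
    rcases mul_eq_zero.1 hin with h2 | h2
    · split_ifs at h2 <;> norm_num at h2
    · exact (mul_eq_zero.1 h2).resolve_left (inv_ne_zero hne)
  have h2 : ((jac a b F x)⁻¹.mulVec (u (F x)).ofLp) l = 0 := by
    rw [← h1, hel]
    simp [normalCovector, PiLp.inner_apply, Matrix.mulVec, dotProduct]
  rw [piolaPullback, Pi.smul_apply, h2, smul_zero]

/-- u ⊗ u : ∇u is the derivative of |u|²/2 along u. In Piola coordinates it is a divergence, because
the Piola pullback is divergence free, and the boundary values of the flux vanish. -/
theorem convectionForm_self_eq_zero (h : M.IsGeometryMap α F)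
    (hu : u ∈ M.solenoidalSpace F k α) : convectionForm a b F u u u = 0 := by
  obtain ⟨hu, hdiv⟩ := hu
  let s : Fin (m + 1) → Param (m + 1) → ℝ := fun l x => piolaPullback a b F u x l
  let φ : Param (m + 1) → ℝ := fun x => (1 / 2) * ∑ j, u (F x) j ^ 2
  have hφc : ContinuousOn φ (Icc a b) :=
    continuousOn_const.mul (continuousOn_finsetSum _ fun j _ =>
      (((EuclideanSpace.proj j : Phys (m + 1) →L[ℝ] ℝ).continuous.comp_continuousOn
        (continuousOn_comp h hu)).pow 2))
  have hφd : ∀ c : M.Cell, ContDiffOn ℝ 1 φ (M.closedCell c) := fun c =>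
    contDiffOn_const.mul (ContDiffOn.sum fun j _ =>
      (contDiffOn_euclidean.1 (contDiffOn_comp h hu c) j).pow 2)
  have hsd := contDiffOn_piolaPullback h hu
  have hgd : ∀ l (c : M.Cell), ContDiffOn ℝ 1 (fun x => s l x * φ x) (M.closedCell c) :=
    fun l c => (hsd c l).mul (hφd c)
  have hzero := fun l => sum_integral_partial_eq_zero M l (g := fun x => s l x * φ x)
    ((continuousOn_piolaPullback hu l).mul hφc) (hgd l)
    fun x hx hb => by
      simp only [s, piolaPullback_eq_zero_of_mem_boundary h hu l hx hb, zero_mul]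
  let P : M.Cell → Fin (m + 1) → Param (m + 1) → ℝ := fun c l x =>
    fderivWithin ℝ (fun x => s l x * φ x) (M.closedCell c) x (Pi.single l 1)
  have hPc : ∀ c l, ContinuousOn (P c l) (M.closedCell c) := fun c l =>
    ((hgd l c).continuousOn_fderivWithin (uniqueDiffOn_Icc_pi (M.lo_lt_hi c)) le_rfl).clm_apply
      continuousOn_const
  have hdet : ContinuousOn (fun x => (jac a b F x).det) (Icc a b) :=
    (continuousOn_jac M.left_lt_right h.contDiffOn_one).matrix_det
  have hpt : ∀ c, ∀ x ∈ M.openCell c,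
      ddot (Matrix.vecMulVec (u (F x)).ofLp (u (F x)).ofLp) (vgrad u (F x)) =
        (jac a b F x).det⁻¹ * ∑ l, P c l x := by
    intro c x hx
    have hx' := M.openCell_subset c hx
    have hx'' := M.closedCell_subset c hx'
    have h0 := h.det_ne_zero x hx''
    have hnhds := closedCell_mem_nhds hx
    have hw : ∀ i, HasFDerivAt (fun y => u (F y) i) (fderiv ℝ (fun y => u (F y) i) x) x := fun i =>
      (((contDiffOn_euclidean.1 (contDiffOn_comp h hu c) i).contDiffAt hnhds).differentiableAt
        one_ne_zero).hasFDerivAt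
    have hs : ∀ j, HasFDerivAt (s j) (fderiv ℝ (s j) x) x := fun j =>
      (((hsd c j).contDiffAt hnhds).differentiableAt one_ne_zero).hasFDerivAt
    have hφ : HasFDerivAt φ ((1 / 2 : ℝ) • ∑ j, (2 * u (F x) j) •
        fderiv ℝ (fun y => u (F y) j) x) x := by
      refine HasFDerivAt.const_mul (HasFDerivAt.fun_sum fun j _ => ?_) _
      refine HasFDerivAt.congr_fderiv (HasFDerivAt.pow (hw j) 2) ?_
      simp
    have hP : ∀ l, P c l x = s l x * ∑ j, u (F x) j * fderiv ℝ (fun y => u (F y) j) x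
        (Pi.single l 1) + φ x * fderiv ℝ (s l) x (Pi.single l 1) := fun l => by
      simp only [P]
      rw [fderivWithin_of_mem_nhds hnhds, ((hs l).fun_mul hφ).fderiv]
      simp only [add_apply, smul_apply, sum_apply, smul_eq_mul]
      congr 2
      rw [Finset.mul_sum]
      exact Finset.sum_congr rfl fun j _ => by ring
    have hdiv0 : ∑ l, fderiv ℝ (s l) x (Pi.single l 1) = 0 := by
      have h1 := vdiv_eq h hu hx
      rw [hdiv c (F x) ⟨x, hx, rfl⟩] at h1
      exact (mul_eq_zero.1 h1.symm).resolve_left (inv_ne_zero h0)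
    have hAs : ∀ l, ∑ i, (jac a b F x)⁻¹ l i * u (F x) i = (jac a b F x).det⁻¹ * s l x := fun l => by
      simp only [s, piolaPullback, Pi.smul_apply, smul_eq_mul]
      rw [inv_mul_cancel_left₀ h0]
      rfl
    simp only [hP, Finset.sum_add_distrib]
    rw [← Finset.mul_sum (f := fun l => fderiv ℝ (s l) x (Pi.single l 1)), hdiv0, mul_zero,
      add_zero, Finset.mul_sum]
    simp only [← mul_assoc, ← hAs]
    simp only [ddot, Matrix.vecMulVec_apply, vgrad_eq h hu hx, Finset.mul_sum, Finset.sum_mul]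
    rw [Finset.sum_congr rfl fun i _ => Finset.sum_comm, Finset.sum_comm]
    refine Finset.sum_congr rfl fun l _ => ?_
    rw [Finset.sum_comm]
    exact Finset.sum_congr rfl fun j _ => Finset.sum_congr rfl fun i _ => by ring
  -- The volume factor |det DF| meets det(DF)⁻¹ from the Piola transform and leaves the constant σ,
  -- so the sum over cells is σ times a sum of integrals of exact partial derivatives.
  obtain ⟨σ, hσ⟩ := exists_sign_of_continuousOn (convex_Icc a b).isPreconnected hdet h.det_ne_zero
  rw [convectionForm, integral_physDomain_eq_sum h
    (g := fun y => ddot (Matrix.vecMulVec (u y).ofLp (u y).ofLp) (vgrad u y))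
    (f := fun c x => (jac a b F x).det⁻¹ * ∑ l, P c l x) (fun c =>
      (((hdet.inv₀ h.det_ne_zero).mono (M.closedCell_subset c))).mul
        (continuousOn_finsetSum _ fun l _ => hPc c l)) hpt]
  have hcell : ∀ c : M.Cell, ∫ x in M.closedCell c,
      |(jac a b F x).det| * ((jac a b F x).det⁻¹ * ∑ l, P c l x) =
      ∑ l, σ * ∫ x in M.closedCell c, P c l x := fun c => by
    have hint : ∀ l ∈ Finset.univ, IntegrableOn (P c l) (M.closedCell c) := fun l _ =>
      (hPc c l).integrableOn_compact isCompact_Icc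
    rw [← Finset.mul_sum, ← integral_finsetSum _ hint, ← integral_const_mul]
    refine setIntegral_congr_fun measurableSet_Icc fun x hx => ?_
    have hx' := M.closedCell_subset c hx
    rw [hσ x hx', mul_assoc, mul_inv_cancel_left₀ (h.det_ne_zero x hx')]
  rw [Finset.sum_congr rfl fun c _ => hcell c, Finset.sum_comm]
  simp only [← Finset.mul_sum]
  rw [neg_eq_zero, mul_eq_zero]
  right
  exact Finset.sum_eq_zero fun l _ => hzero l

/-! ### Coercivity -/

theorem isCoercive_of_isTraceConstant (hM : M.IsGeometryMap α F) {h : ℝ} (hh : 0 < h) {Ctr : ℝ}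
    (hC : 0 < Ctr) (htr : M.IsTraceConstant F h (M.solenoidalSpace F k α) Ctr) {CNit : ℝ}
    (hN : 4 * Ctr ≤ CNit) : M.IsCoercive F k α h CNit (1 / 2) := by
  intro ν hν u hu η hη
  have hconv := convectionForm_self_eq_zero hM hu
  have htr := htr u hu
  have hv := hu.1
  have hvisc : viscousForm a b F ν u u = 2 * ν * strainEnergy a b F u := by
    rw [viscousForm, strainEnergy, integral_const_mul]
  set S := strainEnergy a b F u
  have hjump : M.jumpForm F α η u u = ∑ e ∈ M.interiorFacets, M.facetIntegral F e fun x =>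
      ‖Real.sqrt (η (F x)) • normalDerivJump (α + 1) u (F x) (M.normal F e x)‖ ^ 2 := by
    refine Finset.sum_congr rfl fun e _ => ?_
    congr 1
    ext x
    rw [real_inner_self_eq_norm_sq, norm_smul, mul_pow, Real.norm_eq_abs, sq_abs,
      Real.sq_sqrt (hη _)]
  have hjump0 : 0 ≤ M.jumpForm F α η u u := by
    rw [hjump]
    exact Finset.sum_nonneg fun e _ => facetIntegral_nonneg e fun x => by positivity
  set T := ∑ e ∈ M.boundaryFacets, M.facetIntegral F e fun x => ‖M.normalStrain F u e x‖ ^ 2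
  set B := ∑ e ∈ M.boundaryFacets, M.facetIntegral F e fun x => ‖u (F x)‖ ^ 2 with hBdef
  have hB0 : 0 ≤ B := Finset.sum_nonneg fun e _ => facetIntegral_nonneg e fun x => by positivity
  have hpen : (∑ e ∈ M.boundaryFacets, M.facetIntegral F e fun x =>
      inner ℝ ((2 * ν * (CNit / h)) • u (F x)) (u (F x))) = 2 * ν * (CNit / h) * B := by
    rw [hBdef, Finset.mul_sum]
    refine Finset.sum_congr rfl fun e _ => ?_
    rw [← facetIntegral_const_mul]
    congr 1
    ext x
    rw [real_inner_smul_left, real_inner_self_eq_norm_sq]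
  -- The Young weights have product 1/4, so the difference is a perfect square. They are chosen so
  -- that the trace inequality turns the first term into a quarter of the strain energy and `4 * Ctr
  -- ≤ CNit` makes the second at most a quarter of the penalty.
  have hcross : (∑ e ∈ M.boundaryFacets, M.facetIntegral F e fun x =>
      inner ℝ ((2 * ν) • M.normalStrain F u e x) (u (F x))) ≤
      2 * ν * (h / (4 * Ctr)) * T + 2 * ν * (Ctr / h) * B := by
    rw [Finset.mul_sum, Finset.mul_sum, ← Finset.sum_add_distrib]
    refine Finset.sum_le_sum fun e _ => ?_
    have hu' := (continuousOn_comp hM hv).mono (M.closedCell_subset e.1)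
    have hN' := continuousOn_normalStrain hM hv e
    have hN2 : ContinuousOn (fun x => 2 * ν * (h / (4 * Ctr)) * ‖M.normalStrain F u e x‖ ^ 2)
        (M.closedCell e.1) := continuousOn_const.mul (hN'.norm.pow 2)
    have hu2 : ContinuousOn (fun x => 2 * ν * (Ctr / h) * ‖u (F x)‖ ^ 2) (M.closedCell e.1) :=
      continuousOn_const.mul (hu'.norm.pow 2)
    rw [← facetIntegral_const_mul, ← facetIntegral_const_mul, ← facetIntegral_add hM e hN2 hu2]
    refine facetIntegral_mono hM e ((hN'.const_smul (2 * ν)).inner (𝕜 := ℝ) hu') (hN2.add hu2)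
      fun x _ => ?_
    rw [real_inner_smul_left]
    have h1 := real_inner_le_norm (M.normalStrain F u e x) (u (F x))
    have h2 : ‖M.normalStrain F u e x‖ * ‖u (F x)‖ ≤
        h / (4 * Ctr) * ‖M.normalStrain F u e x‖ ^ 2 + Ctr / h * ‖u (F x)‖ ^ 2 := by
      have h3 : h / (4 * Ctr) * ‖M.normalStrain F u e x‖ ^ 2 + Ctr / h * ‖u (F x)‖ ^ 2 -
          ‖M.normalStrain F u e x‖ * ‖u (F x)‖ =
          (h * ‖M.normalStrain F u e x‖ - 2 * Ctr * ‖u (F x)‖) ^ 2 / (4 * Ctr * h) := by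
        field_simp
        ring
      have h4 : 0 ≤ (h * ‖M.normalStrain F u e x‖ - 2 * Ctr * ‖u (F x)‖) ^ 2 / (4 * Ctr * h) := by
        positivity
      linarith
    have h5 := mul_le_mul_of_nonneg_left (h1.trans h2) (by positivity : 0 ≤ 2 * ν)
    linarith
  have hT : h / (4 * Ctr) * T ≤ S / 4 := by
    have h1 := mul_le_mul_of_nonneg_left htr (by positivity : 0 ≤ h / (4 * Ctr))
    refine h1.trans_eq ?_
    field_simp
  have hCB : Ctr / h * B ≤ (CNit / h * B) / 4 := by
    have h1 : Ctr / h ≤ CNit / h / 4 := by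
      rw [div_div, div_le_div_iff₀ hh (by positivity)]
      nlinarith
    have h2 := mul_le_mul_of_nonneg_right h1 hB0
    linarith
  rw [stabForm, nitscheForm, hvisc, hpen, hconv, energyNormSq, ← hjump]
  have e1 := mul_le_mul_of_nonneg_left hT (by positivity : 0 ≤ 2 * ν)
  have e2 := mul_le_mul_of_nonneg_left hCB (by positivity : 0 ≤ 2 * ν)
  linarith

end ParamMesh

end

/-! ### The coercivity lemma -/

theorem mainTheorem3 (m : ℕ) (hm : m = 1 ∨ m = 2) (k α : ℕ) (hα : α + 1 ≤ k)
    (a b : Param (m + 1)) (F : Param (m + 1) → Phys (m + 1)) :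
    -- on every discretization a trace constant exists, and `C_Nit ≥ 4 C_tr` gives coercivity
    (∀ M : ParamMesh a b, M.IsGeometryMap α F → ∀ h : ℝ, 0 < h →
      (∃ Ctr : ℝ, 0 < Ctr ∧ M.IsTraceConstant F h (M.velocitySpace F k α) Ctr) ∧
      (∀ Ctr : ℝ, 0 < Ctr → M.IsTraceConstant F h (M.solenoidalSpace F k α) Ctr →
        ∀ CNit : ℝ, 4 * Ctr ≤ CNit → M.IsCoercive F k α h CNit (1 / 2))) ∧
    -- under refinement of a rational geometry the threshold does not depend on the mesh
    (∀ M₀ : ParamMesh a b, M₀.IsGeometryMap α F → M₀.IsRationalMap F → ∀ κ : ℝ, 0 < κ →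
      ∃ Ctr : ℝ, 0 < Ctr ∧ ∀ M : ParamMesh a b, M.Refines M₀ → ∀ h : ℝ, 0 < h →
        M.QuasiUniform F κ h →
          M.IsTraceConstant F h (M.velocitySpace F k α) Ctr ∧
          ∀ CNit : ℝ, 4 * Ctr ≤ CNit → M.IsCoercive F k α h CNit (1 / 2)) := by
  refine ⟨fun M hM h hh => ⟨M.exists_isTraceConstant hM k hh, fun Ctr hC htr CNit hN =>
    ParamMesh.isCoercive_of_isTraceConstant hM hh hC htr hN⟩, fun M₀ h₀ hrat κ hκ => ?_⟩
  obtain ⟨Ctr, hC, H⟩ := M₀.exists_uniform_isTraceConstant h₀ hrat k hκ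
  refine ⟨Ctr, hC, fun M hR h hh hQ => ⟨H M hR h hh hQ, fun CNit hN => ?_⟩⟩
  -- A trace constant for the full velocity space is one for its solenoidal subspace.
  exact ParamMesh.isCoercive_of_isTraceConstant (hR.isGeometryMap h₀) hh hC
    (fun u hu => H M hR h hh hQ u hu.1) hN
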